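/- **Theorem.** Let $m\ge n$ be non-negative integers, $G=GL(m+n,\mathbb C)$, and let $K=GL(m)\times GL(n)\subset G$ be the block diagonal subgroup; write $k=(k_1,k_2)\in K$. Let $a,b,c\in\mathbb Z$ and $v\in\mathbb Z_{\ge 0}$, put $$\vec\kappa=(\kappa_1,\kappa_2,\kappa_3)=(b-a,\;v,\;c-b),\qquad \vec s=(s_1,s_2,s_3)=(m-n,\;1,\;\tfrac12),\qquad \vec r=\vec\kappa+\vec s,$$ and assume $\kappa_3\ge\kappa_1+\kappa_3\ge 0$. Let $W$ be an irreducible representation of $GL(m)$ with highest weight $(c-a)1^n+a1^m$ (where $1^n=(1,\dots,1,0,\dots,0)$ with $n$ ones), let $V$ be an irreducible representation of $GL(n)$ with highest weight $(v(n-1),-v,\dots,-v)+(a+b-c)1^n$, and let $U=W\boxtimes V$. Let $F$ be the space of polynomial functions $f:G\to U$ (polynomials in the matrix entries and $\det^{-1}$) such that for all $g\in G$, $k\in K$ $$f(gk)=\det(k_1)^{a}\det(k_2)^{b}f(g),\qquad f(kg)=k\,f(g).$$ For $x\in\mathbb C^n$ let $a(x)=\sum_{i=1}^n x_i(E_{m+i,i}+E_{i,m+i})$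 and $A=\{e^{a(x)}\}$. For $X\in\mathfrak{gl}_{m+n}$ let $D_Xf(g)=\frac{d}{dt}f(ge^{tX})|_{t=0}$, and let $D_{C_2}=\sum_{i,j=1}^{m+n}D_{E_{ij}}D_{E_{ji}}$ be the operator given by the Casimir element $C_2=\sum_{i,j}E_{ij}E_{ji}$. Let $\Sigma_+$ be the set of positive roots $\varepsilon_i$, $2\varepsilon_i$ $(1\le i\le n)$, $\varepsilon_i\pm\varepsilon_j$ $(1\le i<j\le n)$ of $BC_n$, where $\varepsilon_i(a(x))=x_i$ and $(\varepsilon_i,\varepsilon_j)=\delta_{ij}$. For $\vec p\in\mathbb C^3$ let $p_\alpha=p_1,p_2,p_3$ for $\alpha=\varepsilon_i$, $\varepsilon_i\pm\varepsilon_j$, $2\varepsilon_i$ respectively and $p_\alpha=0$ if $\alpha$ is not a root, and let $\delta_{\vec p}(x)=\prod_{\alpha\in\Sigma_+}\sinh(\alpha(a(x)))^{p_\alpha}$ (any local holomorphic branch). Call $x$ regular if $\sinh\alpha(a(x))\neq0$ for all $\alpha\in\Sigma_+$. Then there is a second order differential operator $R_{C_2}$ in $x_1,\dots,x_n$, with coefficients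 holomorphic at all regular points, such that $(D_{C_2}f)(e^{a(x)})=R_{C_2}\bigl(f(e^{a(x)})\bigr)$ for all $f\in F$ and all regular $x$ (the radial part of $D_{C_2}$ on $F$). Moreover every differential operator $R_{C_2}$, of any finite order, with these properties is given, at every regular $x$ and for every function $\psi$ holomorphic near $x$, by $$2(R_{C_2}\psi)(x)=\delta_{\vec s}(x)^{-1}\bigl(\Delta_A-u_{\vec r}(x)+C\bigr)\bigl(\delta_{\vec s}\psi\bigr)(x),\qquad \Delta_A=\sum_{i=1}^n\frac{\partial^2}{\partial x_i^2},$$ $$u_{\vec r}(x)=\sum_{\alpha\in\Sigma_+}\frac{r_\alpha(r_\alpha+2r_{2\alpha}-1)(\alpha,\alpha)}{\sinh^2(\alpha(a(x)))},$$ $$C=\frac{(m+n)-(m+n)^3}{6}+\frac{(m-n)^3-m+n}{6}+(a+b)^2n+2(m-n)a^2 .$$ -/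

import Mathlib

open Matrix TensorProduct Topology

noncomputable section

namespace CM

/-! ### Regular functions on `GL` and left-invariant differential operators -/

/-- Polynomial functions on the algebraic group `GL_ι(ℂ)`: polynomials in the matrix entries and in
the inverse of the determinant. -/
def IsPolynomialFunction {ι : Type*} [Fintype ι] [DecidableEq ι] (φ : GL ι ℂ → ℂ) : Prop :=
  ∃ (p : MvPolynomial (ι × ι) ℂ) (k : ℕ), ∀ g : GL ι ℂ,
    φ g = MvPolynomial.eval (fun q => (g : Matrix ι ι ℂ) q.1 q.2) p /
      (g : Matrix ι ι ℂ).det ^ k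

/-- The exponential map `𝔤𝔩_ι → GL_ι`. -/
def expGL {ι : Type*} [Fintype ι] [DecidableEq ι] (X : Matrix ι ι ℂ) : GL ι ℂ :=
  (Matrix.isUnit_exp X).unit

/-- `D_X φ (g) = d/dt φ (g e^{tX})` at `t = 0`, for `X` in the Lie algebra of `GL_ι(ℂ)`. -/
def leftInvDeriv {ι : Type*} [Fintype ι] [DecidableEq ι] (X : Matrix ι ι ℂ) (φ : GL ι ℂ → ℂ) :
    GL ι ℂ → ℂ :=
  fun g => deriv (fun t : ℂ => φ (g * expGL (t • X))) 0

/-- The differential operator on `GL_ι(ℂ)` given by the Casimir element `C₂ = ∑ E_ij E_ji`; a product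
in the universal enveloping algebra acts by the composition of the operators `D_X`. -/
def casimirOp {ι : Type*} [Fintype ι] [DecidableEq ι] (φ : GL ι ℂ → ℂ) : GL ι ℂ → ℂ :=
  fun g => ∑ i, ∑ j,
    leftInvDeriv (Matrix.single i j 1) (leftInvDeriv (Matrix.single j i 1) φ) g

/-! ### Irreducible representations of `GL_r` with a given highest weight -/

/-- The diagonal matrix with invertible entries `t`, as an element of `GL_r`. -/
def diagGL {r : ℕ} (t : Fin r → ℂˣ) : GL (Fin r) ℂ where
  val := Matrix.diagonal fun i => (t i : ℂ)
  inv := Matrix.diagonal fun i => ((t i)⁻¹ : ℂˣ)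
  val_inv := by simp
  inv_val := by simp

/-- Upper unitriangular matrices. -/
def IsUpperUnitriangular {r : ℕ} (u : GL (Fin r) ℂ) : Prop :=
  (∀ i, (u : Matrix (Fin r) (Fin r) ℂ) i i = 1) ∧
    ∀ i j, j < i → (u : Matrix (Fin r) (Fin r) ℂ) i j = 0

/-- `ρ` is (a realization of) the finite-dimensional irreducible polynomial representation `L_w` of
the algebraic group `GL_r(ℂ)` with highest weight `w`. -/
structure IsIrrepOfHighestWeight {r : ℕ} {V : Type*} [AddCommGroup V] [Module ℂ V]
    (ρ : Representation ℂ (GL (Fin r) ℂ) V) (w : Fin r → ℤ) : Prop where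
  finite : Module.Finite ℂ V
  polynomial : ∀ (v : V) (l : Module.Dual ℂ V), IsPolynomialFunction fun g => l (ρ g v)
  irreducible : ρ.IsIrreducible
  highest : ∃ v : V, v ≠ 0 ∧ (∀ u, IsUpperUnitriangular u → ρ u v = v) ∧
    ∀ t : Fin r → ℂˣ, ρ (diagGL t) v = (∏ i, (t i : ℂ) ^ w i) • v

/-! ### The symmetric pair and the spherical functions -/

/-- The embedding `GL(m) × GL(n) = K ⊂ G = GL(m + n)`. The index set of `G` is `Fin m ⊕ Fin n`. -/
def kEmb {m n : ℕ} (k₁ : GL (Fin m) ℂ) (k₂ : GL (Fin n) ℂ) : GL (Fin m ⊕ Fin n) ℂ where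
  val := Matrix.fromBlocks k₁ 0 0 k₂
  inv := Matrix.fromBlocks (k₁⁻¹ : GL (Fin m) ℂ) 0 0 (k₂⁻¹ : GL (Fin n) ℂ)
  val_inv := by
    rw [Matrix.fromBlocks_multiply, ← Matrix.fromBlocks_one]
    simp only [← Units.val_mul]
    simp
  inv_val := by
    rw [Matrix.fromBlocks_multiply, ← Matrix.fromBlocks_one]
    simp only [← Units.val_mul]
    simp

/-- `a(x) = ∑ x_i (E_{m+i,i} + E_{i,m+i})`, the element `J̃ diag(x, 0, -x) J̃⁻¹` of the abelian
subspace `𝔞 ⊂ 𝔭`. -/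
def aMat {m n : ℕ} (h : n ≤ m) (x : Fin n → ℂ) : Matrix (Fin m ⊕ Fin n) (Fin m ⊕ Fin n) ℂ :=
  ∑ i : Fin n, x i • (Matrix.single (Sum.inr i) (Sum.inl (Fin.castLE h i)) 1 +
    Matrix.single (Sum.inl (Fin.castLE h i)) (Sum.inr i) 1)

/-- The element `e^{a(x)}` of the torus `A`. -/
def expA {m n : ℕ} (h : n ≤ m) (x : Fin n → ℂ) : GL (Fin m ⊕ Fin n) ℂ :=
  expGL (aMat h x)

/-- The highest weight `(c - a) 1^n + a 1^m` of the representation `W` of `GL(m)`. -/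
def weightW (m n : ℕ) (a c : ℤ) : Fin m → ℤ :=
  fun i => (if (i : ℕ) < n then c - a else 0) + a

/-- The highest weight `(v (n - 1), -v, …, -v) + (b + a - c) 1^n` of the representation `V` of
`GL(n)`. -/
def weightV (n : ℕ) (a b c : ℤ) (v : ℕ) : Fin n → ℤ :=
  fun i => (if (i : ℕ) = 0 then (v : ℤ) * ((n : ℤ) - 1) else -(v : ℤ)) + (b + a - c)

/-- The space of `K`-equivariant twisted spherical functions with values in `U = W ⊠ V`: polynomial
`f : G → U` with `f (g k) = f (g) det(k₁)^a det(k₂)^b` and `f (k g) = k f (g)`. -/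
structure IsSphericalFunction {m n : ℕ} {W V : Type*} [AddCommGroup W] [Module ℂ W]
    [AddCommGroup V] [Module ℂ V] (ρW : Representation ℂ (GL (Fin m) ℂ) W)
    (ρV : Representation ℂ (GL (Fin n) ℂ) V) (a b : ℤ)
    (f : GL (Fin m ⊕ Fin n) ℂ → W ⊗[ℂ] V) : Prop where
  polynomial : ∀ l : Module.Dual ℂ (W ⊗[ℂ] V), IsPolynomialFunction fun g => l (f g)
  right : ∀ g k₁ k₂, f (g * kEmb k₁ k₂) =
    ((k₁ : Matrix (Fin m) (Fin m) ℂ).det ^ a * (k₂ : Matrix (Fin n) (Fin n) ℂ).det ^ b) • f g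
  left : ∀ g k₁ k₂, f (kEmb k₁ k₂ * g) = TensorProduct.map (ρW k₁) (ρV k₂) (f g)

/-! ### The root system `BC_n` -/

/-- The positive roots of `BC_n`: `ε_i`, `2 ε_i`, and `ε_i ± ε_j` for `i < j`. -/
inductive PosRoot (n : ℕ) : Type
  | short (i : Fin n) : PosRoot n
  | long (i : Fin n) : PosRoot n
  | minus (i j : Fin n) (hij : i < j) : PosRoot n
  | plus (i j : Fin n) (hij : i < j) : PosRoot n

instance (n : ℕ) : Fintype (PosRoot n) :=
  Fintype.ofEquiv
    (Fin n ⊕ Fin n ⊕ {q : Fin n × Fin n // q.1 < q.2} ⊕ {q : Fin n × Fin n // q.1 < q.2})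
    { toFun := fun s => match s with
        | .inl i => .short i
        | .inr (.inl i) => .long i
        | .inr (.inr (.inl q)) => .minus q.1.1 q.1.2 q.2
        | .inr (.inr (.inr q)) => .plus q.1.1 q.1.2 q.2
      invFun := fun r => match r with
        | .short i => .inl i
        | .long i => .inr (.inl i)
        | .minus i j h => .inr (.inr (.inl ⟨(i, j), h⟩))
        | .plus i j h => .inr (.inr (.inr ⟨(i, j), h⟩))
      left_inv := by rintro (i | i | q | q) <;> rfl
      right_inv := by rintro (i | i | ⟨i, j, h⟩ | ⟨i, j, h⟩) <;> rfl }

/-- The coordinates of a root in the orthonormal basis `ε_1, …, ε_n` of `𝔞*`. -/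
def PosRoot.vec {n : ℕ} : PosRoot n → Fin n → ℂ
  | .short i => Pi.single i 1
  | .long i => Pi.single i 2
  | .minus i j _ => Pi.single i 1 - Pi.single j 1
  | .plus i j _ => Pi.single i 1 + Pi.single j 1

/-- The value `α(a(x))`. -/
def PosRoot.eval {n : ℕ} (α : PosRoot n) (x : Fin n → ℂ) : ℂ := α.vec ⬝ᵥ x

/-- The value `(α, α)` of the standard bilinear form. -/
def PosRoot.normSq {n : ℕ} (α : PosRoot n) : ℂ := α.vec ⬝ᵥ α.vec

/-- `p_α` for `p = (p₁, p₂, p₃)`, indexed by short, medium and long roots. -/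
def mult {n : ℕ} (p : Fin 3 → ℂ) : PosRoot n → ℂ
  | .short _ => p 0
  | .minus _ _ _ => p 1
  | .plus _ _ _ => p 1
  | .long _ => p 2

/-- `p_{2α}`, which is `0` if `2α` is not a root. -/
def multDouble {n : ℕ} (p : Fin 3 → ℂ) : PosRoot n → ℂ
  | .short _ => p 2
  | .minus _ _ _ => 0
  | .plus _ _ _ => 0
  | .long _ => 0

/-- The regular points of `𝔞 ≅ ℂⁿ`: `sinh α(a(x)) ≠ 0` for all positive roots `α`. -/
def regularSet (n : ℕ) : Set (Fin n → ℂ) := {x | ∀ α : PosRoot n, Complex.sinh (α.eval x) ≠ 0}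

/-- `δ` is, near `x`, a holomorphic branch of the generally multivalued function
`δ_p = ∏_{α > 0} sinh(α)^{p_α}`: near `x`, `δ = exp (∑ p_α L_α)` where `L_α` is a holomorphic
branch of `log (sinh α)`. -/
def IsDenominatorBranch {n : ℕ} (p : Fin 3 → ℂ) (δ : (Fin n → ℂ) → ℂ) (x : Fin n → ℂ) : Prop :=
  ∃ L : PosRoot n → (Fin n → ℂ) → ℂ,
    (∀ α, AnalyticAt ℂ (L α) x ∧ ∀ᶠ y in 𝓝 x, Complex.exp (L α y) = Complex.sinh (α.eval y)) ∧
    ∀ᶠ y in 𝓝 x, δ y = Complex.exp (∑ α, mult p α * L α y)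

/-- The Calogero–Moser potential
`u_r(x) = ∑_{α > 0} r_α (r_α + 2 r_{2α} - 1) (α, α) / sinh² α(a(x))`. -/
def potential {n : ℕ} (r : Fin 3 → ℂ) (x : Fin n → ℂ) : ℂ :=
  ∑ α : PosRoot n, mult r α * (mult r α + 2 * multDouble r α - 1) * α.normSq /
    Complex.sinh (α.eval x) ^ 2

/-- The Laplacian `∑ ∂²/∂x_i²`. -/
def laplacianA {n : ℕ} (ψ : (Fin n → ℂ) → ℂ) (x : Fin n → ℂ) : ℂ :=
  ∑ i, iteratedFDeriv ℂ 2 ψ x fun _ => Pi.single i 1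

/-! ### Differential operators on `A` and radial parts -/

/-- A linear differential operator in the coordinates `x_1, …, x_n` along `A` with holomorphic
coefficients on the regular set: `∑_{k ≤ order} ∑_{I : Fin k → Fin n} c_{k,I}(x) ∂_{I_1} ⋯ ∂_{I_k}`. -/
structure DiffOp (n : ℕ) where
  order : ℕ
  coeff : (k : ℕ) → (Fin k → Fin n) → (Fin n → ℂ) → ℂ
  holomorphic : ∀ k I, DifferentiableOn ℂ (coeff k I) (regularSet n)

/-- The action of a differential operator on a (germ of a) holomorphic function. -/
def DiffOp.apply {n : ℕ} (R : DiffOp n) (ψ : (Fin n → ℂ) → ℂ) (x : Fin n → ℂ) : ℂ :=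
  ∑ k ∈ Finset.range (R.order + 1), ∑ I : Fin k → Fin n,
    R.coeff k I x * iteratedFDeriv ℂ k ψ x fun j => Pi.single (I j) 1

/-- `R` is the radial part of the Casimir operator on the space of spherical functions:
`(D_{C₂} f)(e^{a(x)}) = R (f (e^{a(x)}))` for every spherical function `f`. The equation between
vectors of `U = W ⊠ V` is tested by linear functionals on `U`. -/
def IsRadialPartOfCasimir {m n : ℕ} (h : n ≤ m) {W V : Type*} [AddCommGroup W] [Module ℂ W]
    [AddCommGroup V] [Module ℂ V] (ρW : Representation ℂ (GL (Fin m) ℂ) W)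
    (ρV : Representation ℂ (GL (Fin n) ℂ) V) (a b : ℤ) (R : DiffOp n) : Prop :=
  ∀ f : GL (Fin m ⊕ Fin n) ℂ → W ⊗[ℂ] V, IsSphericalFunction ρW ρV a b f →
    ∀ l : Module.Dual ℂ (W ⊗[ℂ] V), ∀ x ∈ regularSet n,
      casimirOp (fun g => l (f g)) (expA h x) = R.apply (fun y => l (f (expA h y))) x

/-- `κ = (κ₁, κ₂, κ₃) = (b - a, v, c - b)`. -/
def kappaVec (a b c : ℤ) (v : ℕ) : Fin 3 → ℂ := ![(b : ℂ) - a, (v : ℂ), (c : ℂ) - b]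

/-- The half multiplicities `s = (m - n, 1, 1/2)` of the restricted roots. -/
def sVec (m n : ℕ) : Fin 3 → ℂ := ![(m : ℂ) - n, 1, 1 / 2]

/-- The constant `C_κ`. -/
def constC (m n : ℕ) (a b : ℤ) : ℂ :=
  ((m : ℂ) + n - ((m : ℂ) + n) ^ 3) / 6 + (((m : ℂ) - n) ^ 3 - m + n) / 6 +
    ((a : ℂ) + b) ^ 2 * n + 2 * ((m : ℂ) - n) * (a : ℂ) ^ 2

end CM

end

/-! Restriction to the torus. For a spherical function `f`, the vector `f(e^{a(x)})` transforms by a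
character under the diagonal elements of `K` that commute with `A`. The highest weight theory gives
models: with `N = c - a` and `e = b + a - c - v`, vectors of `W` become functions of `p` such as
`det(p)^a` times the `N`-th power of the top `n × n` minor of `p * B`, and vectors of `V` become
`det(q)^e` times forms of degree `n v` in the first row of `q`. In these models a semi-invariant
vector is a multiple of one explicit function, `coeffFun` (`IsModel.test_eq_mul_coeffFun`), so on
`A` a spherical function is a single scalar function.

Radial part. The summands of the Casimir element lying in the Lie algebra of `K` act by scalars,
because of the right equivariance. For `Y` in this Lie algebra, the right derivative along `e^{-a} Y
e^{a}` at `k e^{a}` is a derivative of the model function along `K` (`leftInvDeriv_adA`). Solving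
these relations for the root vectors outside the Lie algebra of `K` gives the contributions of the
root types (`pairOp_short`, `pairOp_pair`, `pairOp_diag`), hence an explicit operator `½ ∑ ∂_i² + ∑
θ_i ∂_i + potential`, namely `radialOp`.

Uniqueness. The inequalities on `κ` say that `c - b` and `c - a` are natural numbers, and these are
the exponents in an explicit spherical function whose scalar part has no zeros at regular points.
Its products with polynomials in the bi-invariant functions `tr (D D')^{j+1}`, where `D` and `D'`
are the lower right blocks of `g` and `g⁻¹`, are again spherical. On `A` these invariants are the
power sums of `cosh² x_i`, which are local coordinates at every regular point because their Jacobian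
is essentially a Vandermonde matrix. Hence all jets are reached, and two radial parts of any finite
order agree on all analytic functions (`DiffOp.apply_eq_of_agreement`).

Conjugation. The coefficients `θ_i` are the logarithmic derivatives of `δ_s` (`sum_mult_coth`), so
conjugating the Laplacian by `δ_s` produces `2 θ_i ∂_i` and the zeroth order term `∑ (θ_i² + ∂_i
θ_i)`. The mixed terms of that sum collapse to constants (`sum_radCoeff_sq`); what remains is an
identity of rational functions in one `sinh² x_i` at a time. -/

set_option linter.unusedSectionVars false

noncomputable section

namespace CM

/-! ### Calculus of left-invariant derivatives on polynomial functions -/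

section LeftInvariant

variable {ι : Type*} [Fintype ι] [DecidableEq ι]

@[simp] lemma coe_expGL (X : Matrix ι ι ℂ) :
    (expGL X : Matrix ι ι ℂ) = NormedSpace.exp X := rfl

/-- The derivation of the polynomial ring in the matrix entries induced by right translation by
`e^{tX}`. -/
def polyDeriv (X : Matrix ι ι ℂ) :
    Derivation ℂ (MvPolynomial (ι × ι) ℂ) (MvPolynomial (ι × ι) ℂ) :=
  MvPolynomial.mkDerivation ℂ fun q => ∑ l, MvPolynomial.C (X l q.2) * MvPolynomial.X (q.1, l)

lemma polyDeriv_X (X : Matrix ι ι ℂ) (q : ι × ι) :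
    polyDeriv X (MvPolynomial.X q) =
      ∑ l, MvPolynomial.C (X l q.2) * MvPolynomial.X (q.1, l) :=
  MvPolynomial.mkDerivation_X _ _ _

lemma polyDeriv_add (X Y : Matrix ι ι ℂ) : polyDeriv (X + Y) = polyDeriv X + polyDeriv Y := by
  refine MvPolynomial.derivation_ext fun q => ?_
  simp [polyDeriv_X, add_mul, Finset.sum_add_distrib]

lemma polyDeriv_smul (c : ℂ) (X : Matrix ι ι ℂ) : polyDeriv (c • X) = c • polyDeriv X := by
  refine MvPolynomial.derivation_ext fun q => ?_
  simp [polyDeriv_X, Finset.smul_sum, MvPolynomial.smul_eq_C_mul, mul_assoc]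

/-- Derivations are determined by the coordinate functions, and on these the composition for `A` and
`B` multiplies the generic matrix on the right by `A * B`. -/
lemma polyDeriv_lie (X Y : Matrix ι ι ℂ) :
    polyDeriv (X * Y - Y * X) = ⁅polyDeriv X, polyDeriv Y⁆ := by
  refine MvPolynomial.derivation_ext fun q => ?_
  have key : ∀ A B : Matrix ι ι ℂ, polyDeriv A (polyDeriv B (MvPolynomial.X q)) =
      ∑ l, MvPolynomial.C ((A * B) l q.2) * MvPolynomial.X (q.1, l) := by
    intro A B
    simp only [polyDeriv_X, map_sum, Derivation.leibniz, smul_eq_mul, MvPolynomial.derivation_C,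
      mul_zero, add_zero, Finset.mul_sum, Matrix.mul_apply, Finset.sum_mul]
    rw [Finset.sum_comm]
    refine Finset.sum_congr rfl fun i _ => Finset.sum_congr rfl fun j _ => ?_
    rw [MvPolynomial.C_mul]; ring
  rw [Derivation.commutator_apply, key, key, polyDeriv_X, ← Finset.sum_sub_distrib]
  exact Finset.sum_congr rfl fun l _ => by
    rw [Matrix.sub_apply, MvPolynomial.C_sub, sub_mul]

/-- Evaluation of a polynomial at the entries of a matrix. -/
def evalMat (A : Matrix ι ι ℂ) (p : MvPolynomial (ι × ι) ℂ) : ℂ :=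
  MvPolynomial.eval (fun q => A q.1 q.2) p

lemma evalMat_sub (A : Matrix ι ι ℂ) (p q : MvPolynomial (ι × ι) ℂ) :
    evalMat A (p - q) = evalMat A p - evalMat A q := map_sub _ _ _

lemma evalMat_add (A : Matrix ι ι ℂ) (p q : MvPolynomial (ι × ι) ℂ) :
    evalMat A (p + q) = evalMat A p + evalMat A q := map_add _ _ _

lemma evalMat_mul (A : Matrix ι ι ℂ) (p q : MvPolynomial (ι × ι) ℂ) :
    evalMat A (p * q) = evalMat A p * evalMat A q := map_mul _ _ _

lemma evalMat_C (A : Matrix ι ι ℂ) (c : ℂ) : evalMat A (MvPolynomial.C c) = c :=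
  MvPolynomial.eval_C _

lemma evalMat_smul (A : Matrix ι ι ℂ) (c : ℂ) (p : MvPolynomial (ι × ι) ℂ) :
    evalMat A (c • p) = c * evalMat A p := MvPolynomial.smul_eval _ _ _

/-- Only the velocity of the curve at `0` enters, so the same formula serves one-parameter groups
and straight lines. -/
lemma hasDerivAt_evalMat {A : ℂ → Matrix ι ι ℂ} {X : Matrix ι ι ℂ}
    (hA : ∀ i j, HasDerivAt (fun t => A t i j) ((A 0 * X) i j) 0)
    (p : MvPolynomial (ι × ι) ℂ) :
    HasDerivAt (fun t => evalMat (A t) p) (evalMat (A 0) (polyDeriv X p)) 0 := by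
  induction p using MvPolynomial.induction_on with
  | C c =>
    simp only [evalMat, MvPolynomial.eval_C, MvPolynomial.derivation_C, map_zero]
    exact hasDerivAt_const _ _
  | add p q hp hq =>
    simp only [evalMat, map_add] at *
    exact hp.add hq
  | mul_X p q hp =>
    have hX : HasDerivAt (fun t => evalMat (A t) (MvPolynomial.X q))
        (evalMat (A 0) (polyDeriv X (MvPolynomial.X q))) 0 := by
      have h := hA q.1 q.2
      rw [Matrix.mul_apply] at h
      simp only [evalMat, polyDeriv_X, map_sum, map_mul, MvPolynomial.eval_X,
        MvPolynomial.eval_C]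
      simpa only [mul_comm] using h
    simp only [evalMat_mul, evalMat_add, Derivation.leibniz, smul_eq_mul]
    refine (hp.mul hX).congr_deriv ?_
    ring

lemma hasDerivAt_exp_entry (g X : Matrix ι ι ℂ) (i j : ι) :
    HasDerivAt (fun t : ℂ => (g * NormedSpace.exp (t • X)) i j) ((g * X) i j) 0 := by
  open scoped Norms.Operator in
  have h := (hasDerivAt_exp_smul_const (𝕂 := ℂ) X (0 : ℂ)).const_mul g
  rw [zero_smul, NormedSpace.exp_zero, one_mul] at h
  have h2 := ((LinearMap.toContinuousLinearMap
    (Matrix.entryLinearMap ℂ ℂ i j)).hasFDerivAt.comp_hasDerivAt (0 : ℂ) h)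
  exact h2

/-- The determinant as a polynomial in the entries. -/
def detPoly (ι : Type*) [Fintype ι] [DecidableEq ι] : MvPolynomial (ι × ι) ℂ :=
  (Matrix.of fun i j => (MvPolynomial.X (i, j) : MvPolynomial (ι × ι) ℂ)).det

lemma evalMat_detPoly (A : Matrix ι ι ℂ) : evalMat A (detPoly ι) = A.det := by
  rw [evalMat, detPoly, RingHom.map_det]
  congr 1
  ext i j
  simp

/-- The determinant is a polynomial, so its derivative depends on the tangent vector alone. It can
be computed on the line `1 + t X`, where the linear coefficient is the trace. -/
lemma hasDerivAt_det {A : ℂ → Matrix ι ι ℂ} {X : Matrix ι ι ℂ} (h0 : A 0 = 1)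
    (hA : ∀ i j, HasDerivAt (fun t => A t i j) (X i j) 0) :
    HasDerivAt (fun t => (A t).det) X.trace 0 := by
  have h1 := hasDerivAt_evalMat (A := A) (X := X) (by simpa [h0] using hA) (detPoly ι)
  have h2 := hasDerivAt_evalMat (A := fun t => 1 + t • X) (X := X) (fun i j => by
    have := ((hasDerivAt_id (0 : ℂ)).mul_const (X i j)).const_add ((1 : Matrix ι ι ℂ) i j)
    simpa using this) (detPoly ι)
  simp only [evalMat_detPoly, h0, zero_smul, add_zero] at h1 h2
  convert h1 using 1
  refine HasDerivAt.unique ?_ h2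
  have h3 : ∀ t : ℂ, (1 + t • X).det = 1 + X.trace * t + _ := fun t => Matrix.det_one_add_smul t X
  have h4 : HasDerivAt (fun t : ℂ => 1 + X.trace * t +
      (Polynomial.eval t ((1 + (Polynomial.X : Polynomial ℂ) • X.map Polynomial.C).det.divX.divX))
        * t ^ 2) X.trace 0 := by
    have hp := Polynomial.hasDerivAt
      ((1 + (Polynomial.X : Polynomial ℂ) • X.map Polynomial.C).det.divX.divX) 0
    have := (((hasDerivAt_id (0 : ℂ)).const_mul X.trace).const_add 1).add
      (hp.mul ((hasDerivAt_id (0 : ℂ)).pow 2))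
    exact this.congr_deriv (by simp)
  exact h4.congr_of_eventuallyEq (Filter.Eventually.of_forall h3)

lemma hasDerivAt_det_exp (X : Matrix ι ι ℂ) :
    HasDerivAt (fun t : ℂ => (NormedSpace.exp (t • X)).det) X.trace 0 :=
  hasDerivAt_det (by simp) fun i j => by simpa using hasDerivAt_exp_entry 1 X i j

variable {φ φ' : GL ι ℂ → ℂ}

/-- The logarithmic derivative of `det^k` along `X` is the constant `k tr X`. Therefore the exponent
of the denominator does not grow, and the formula can be iterated on numerators. -/
lemma hasDerivAt_polynomialFunction {p : MvPolynomial (ι × ι) ℂ} {k : ℕ}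
    (hφ : ∀ g : GL ι ℂ, φ g = evalMat g p / (g : Matrix ι ι ℂ).det ^ k) (g : GL ι ℂ)
    (X : Matrix ι ι ℂ) :
    HasDerivAt (fun t : ℂ => φ (g * expGL (t • X)))
      (evalMat g (polyDeriv X p - MvPolynomial.C (k * X.trace) * p) /
        (g : Matrix ι ι ℂ).det ^ k) 0 := by
  have hg : (g : Matrix ι ι ℂ).det ≠ 0 := g.isUnit.map Matrix.detMonoidHom |>.ne_zero
  have h1 := hasDerivAt_evalMat (A := fun t => (g : Matrix ι ι ℂ) * NormedSpace.exp (t • X))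
    (X := X) (fun i j => by simpa using hasDerivAt_exp_entry (g : Matrix ι ι ℂ) X i j) p
  have h2 := (hasDerivAt_det_exp X).const_mul (g : Matrix ι ι ℂ).det |>.pow k
  have h3 := h1.div h2 (by simp [hg])
  have h4 : (fun t : ℂ => φ (g * expGL (t • X))) = fun t : ℂ =>
      evalMat ((g : Matrix ι ι ℂ) * NormedSpace.exp (t • X)) p /
        ((g : Matrix ι ι ℂ).det * (NormedSpace.exp (t • X)).det) ^ k := by
    ext t
    rw [hφ, Units.val_mul, coe_expGL, Matrix.det_mul]
  rw [h4]
  refine h3.congr_deriv ?_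
  simp only [zero_smul, NormedSpace.exp_zero, Matrix.det_one, mul_one,
    evalMat_sub, evalMat_mul, evalMat_C, Pi.pow_apply]
  rcases k with _ | k
  · simp
  · have : (g : Matrix ι ι ℂ).det ^ k ≠ 0 := pow_ne_zero _ hg
    simp only [Nat.add_sub_cancel]
    field_simp
    ring

lemma IsPolynomialFunction.exists_evalMat (h : IsPolynomialFunction φ) :
    ∃ (p : MvPolynomial (ι × ι) ℂ) (k : ℕ), ∀ g : GL ι ℂ,
      φ g = evalMat g p / (g : Matrix ι ι ℂ).det ^ k := h

lemma leftInvDeriv_eq {p : MvPolynomial (ι × ι) ℂ} {k : ℕ}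
    (hφ : ∀ g : GL ι ℂ, φ g = evalMat g p / (g : Matrix ι ι ℂ).det ^ k) (X : Matrix ι ι ℂ)
    (g : GL ι ℂ) : leftInvDeriv X φ g =
      evalMat g (polyDeriv X p - MvPolynomial.C (k * X.trace) * p) /
        (g : Matrix ι ι ℂ).det ^ k :=
  (hasDerivAt_polynomialFunction hφ g X).deriv

lemma IsPolynomialFunction.hasDerivAt (h : IsPolynomialFunction φ) (g : GL ι ℂ)
    (X : Matrix ι ι ℂ) :
    HasDerivAt (fun t : ℂ => φ (g * expGL (t • X))) (leftInvDeriv X φ g) 0 := by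
  obtain ⟨p, k, hφ⟩ := h.exists_evalMat
  rw [leftInvDeriv_eq hφ]
  exact hasDerivAt_polynomialFunction hφ g X

lemma IsPolynomialFunction.leftInvDeriv (h : IsPolynomialFunction φ) (X : Matrix ι ι ℂ) :
    IsPolynomialFunction (leftInvDeriv X φ) := by
  obtain ⟨p, k, hφ⟩ := h.exists_evalMat
  exact ⟨_, k, leftInvDeriv_eq hφ X⟩

lemma IsPolynomialFunction.leftInvDeriv_add_left (h : IsPolynomialFunction φ)
    (X Y : Matrix ι ι ℂ) (g : GL ι ℂ) :
    CM.leftInvDeriv (X + Y) φ g = CM.leftInvDeriv X φ g + CM.leftInvDeriv Y φ g := by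
  obtain ⟨p, k, hφ⟩ := h.exists_evalMat
  simp only [leftInvDeriv_eq hφ, evalMat_sub, evalMat_add, evalMat_mul, evalMat_C,
    polyDeriv_add, Derivation.add_apply, Matrix.trace_add]
  ring

lemma IsPolynomialFunction.leftInvDeriv_smul_left (h : IsPolynomialFunction φ)
    (c : ℂ) (X : Matrix ι ι ℂ) (g : GL ι ℂ) :
    CM.leftInvDeriv (c • X) φ g = c * CM.leftInvDeriv X φ g := by
  obtain ⟨p, k, hφ⟩ := h.exists_evalMat
  simp only [leftInvDeriv_eq hφ, evalMat_sub, evalMat_smul, evalMat_mul, evalMat_C,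
    polyDeriv_smul, Derivation.smul_apply, Matrix.trace_smul, smul_eq_mul]
  ring

lemma IsPolynomialFunction.leftInvDeriv_sub_left (h : IsPolynomialFunction φ)
    (X Y : Matrix ι ι ℂ) (g : GL ι ℂ) :
    CM.leftInvDeriv (X - Y) φ g = CM.leftInvDeriv X φ g - CM.leftInvDeriv Y φ g := by
  rw [sub_eq_add_neg, h.leftInvDeriv_add_left, ← neg_one_smul ℂ Y, h.leftInvDeriv_smul_left]
  ring

/-- On numerators this is `polyDeriv_lie`; the corrections by traces commute, and a commutator has
trace zero. -/
lemma IsPolynomialFunction.leftInvDeriv_comm (h : IsPolynomialFunction φ)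
    (X Y : Matrix ι ι ℂ) (g : GL ι ℂ) :
    CM.leftInvDeriv X (CM.leftInvDeriv Y φ) g =
      CM.leftInvDeriv Y (CM.leftInvDeriv X φ) g + CM.leftInvDeriv (X * Y - Y * X) φ g := by
  obtain ⟨p, k, hφ⟩ := h.exists_evalMat
  rw [leftInvDeriv_eq (leftInvDeriv_eq hφ Y), leftInvDeriv_eq (leftInvDeriv_eq hφ X),
    leftInvDeriv_eq hφ, polyDeriv_lie]
  simp only [Derivation.commutator_apply, map_sub, Derivation.leibniz, smul_eq_mul,
    MvPolynomial.derivation_C, Matrix.trace_sub, Matrix.trace_mul_comm Y X, mul_zero, add_zero,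
    sub_self, evalMat_sub, evalMat_mul, evalMat_C]
  ring

lemma IsPolynomialFunction.smul (h : IsPolynomialFunction φ) (c : ℂ) :
    IsPolynomialFunction (c • φ) := by
  obtain ⟨p, k, hφ⟩ := h.exists_evalMat
  refine ⟨c • p, k, fun g => ?_⟩
  change c * φ g = evalMat g (c • p) / _
  rw [hφ, evalMat_smul, mul_div_assoc]

lemma leftInvDeriv_add (h : IsPolynomialFunction φ) (h' : IsPolynomialFunction φ')
    (X : Matrix ι ι ℂ) : leftInvDeriv X (φ + φ') = leftInvDeriv X φ + leftInvDeriv X φ' := by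
  ext g
  exact ((h.hasDerivAt g X).add (h'.hasDerivAt g X)).deriv

lemma leftInvDeriv_smul (h : IsPolynomialFunction φ) (c : ℂ) (X : Matrix ι ι ℂ) :
    leftInvDeriv X (c • φ) = c • leftInvDeriv X φ := by
  ext g
  exact ((h.hasDerivAt g X).const_mul c).deriv

lemma leftInvDeriv_translate (φ : GL ι ℂ → ℂ) (k : GL ι ℂ) (X : Matrix ι ι ℂ) :
    leftInvDeriv X (fun g => φ (k * g)) = fun g => leftInvDeriv X φ (k * g) := by
  ext g
  simp only [leftInvDeriv, mul_assoc]

/-- Right derivatives commute with left translations. This carries computations at `k e^{a(x)}` back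
to `e^{a(x)}`. -/
lemma casimirOp_translate (φ : GL ι ℂ → ℂ) (k g : GL ι ℂ) :
    casimirOp (fun g => φ (k * g)) g = casimirOp φ (k * g) := by
  simp only [casimirOp, leftInvDeriv_translate]

lemma casimirOp_add (h : IsPolynomialFunction φ) (h' : IsPolynomialFunction φ') (g : GL ι ℂ) :
    casimirOp (φ + φ') g = casimirOp φ g + casimirOp φ' g := by
  simp only [casimirOp, leftInvDeriv_add h h',
    leftInvDeriv_add (h.leftInvDeriv _) (h'.leftInvDeriv _), Pi.add_apply,
    Finset.sum_add_distrib]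

lemma casimirOp_smul (h : IsPolynomialFunction φ) (c : ℂ) (g : GL ι ℂ) :
    casimirOp (c • φ) g = c * casimirOp φ g := by
  simp only [casimirOp, leftInvDeriv_smul h, leftInvDeriv_smul (h.leftInvDeriv _), Pi.smul_apply,
    Finset.mul_sum, smul_eq_mul]

end LeftInvariant

/-! ### The torus `A` and the block diagonal subgroup -/

section Torus

variable {ι : Type*} [Fintype ι] [DecidableEq ι]

/-- The columns of `N` are eigenvectors of `H`; the exponential series is summed termwise. -/
lemma exp_mul_eq_smul {H N : Matrix ι ι ℂ} {z : ℂ} (h : H * N = z • N) :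
    NormedSpace.exp H * N = Complex.exp z • N := by
  open scoped Norms.Operator in
  have h1 := (NormedSpace.exp_series_hasSum_exp' (𝕂 := ℂ) H).mul_right N
  have h2 := (NormedSpace.exp_series_hasSum_exp' (𝕂 := ℂ) z).smul_const N
  have hk : ∀ k : ℕ, H ^ k * N = z ^ k • N := by
    intro k
    induction k with
    | zero => simp
    | succ k ih => rw [pow_succ, mul_assoc, h, Matrix.mul_smul, ih, smul_smul, pow_succ']
  rw [Complex.exp_eq_exp_ℂ]
  have h3 : (fun k : ℕ => (k.factorial : ℂ)⁻¹ • H ^ k * N) =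
      fun k : ℕ => ((k.factorial : ℂ)⁻¹ • z ^ k) • N := by
    ext1 k
    rw [Matrix.smul_mul, hk, smul_smul, smul_eq_mul]
  rw [h3] at h1
  exact h1.unique h2

lemma single_mul_single_one (p q r s : ι) :
    Matrix.single p q (1 : ℂ) * Matrix.single r s 1 = if q = r then Matrix.single p s 1 else 0 := by
  split_ifs with hqr
  · subst hqr
    rw [Matrix.single_mul_single_same, mul_one]
  · exact Matrix.single_mul_single_of_ne _ _ _ _ hqr _

lemma expGL_conj {a : GL ι ℂ} {X Y : Matrix ι ι ℂ}
    (h : (a : Matrix ι ι ℂ) * X = Y * a) : a * expGL X = expGL Y * a := by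
  have hY : Y = a * X * (a⁻¹ : GL ι ℂ) := by
    rw [h, mul_assoc, ← Units.val_mul, mul_inv_cancel, Units.val_one, mul_one]
  ext1
  rw [Units.val_mul, Units.val_mul, coe_expGL, coe_expGL, hY, Matrix.exp_units_conj, mul_assoc,
    ← Units.val_mul, inv_mul_cancel, Units.val_one, mul_one]

/-- Conjugation turns `a e^{tX}` into `e^{tY} a`, so the variation moves to the left of `a`, where
left equivariance can be used. -/
lemma leftInvDeriv_mul_right (φ : GL ι ℂ → ℂ) {a : GL ι ℂ} {X Y : Matrix ι ι ℂ}
    (h : (a : Matrix ι ι ℂ) * X = Y * a) (g : GL ι ℂ) :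
    leftInvDeriv X φ (g * a) = deriv (fun t : ℂ => φ (g * expGL (t • Y) * a)) 0 := by
  simp only [leftInvDeriv]
  congr 1
  ext t
  rw [mul_assoc, mul_assoc, expGL_conj (a := a) (X := t • X) (Y := t • Y)]
  rw [Matrix.mul_smul, Matrix.smul_mul, h]

lemma expGL_add_of_commute {X Y : Matrix ι ι ℂ} (h : Commute X Y) :
    expGL (X + Y) = expGL X * expGL Y := by
  ext1
  exact Matrix.exp_add_of_commute X Y h

end Torus

/-! ### Entries of `e^{a(x)}` and the embedding of `GL(m) × GL(n)` -/

section KEmbedding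

variable {m n : ℕ} (h : n ≤ m)

/-- The index of the first block paired with the index `i` of the second block. -/
abbrev pairIdx (i : Fin n) : Fin m ⊕ Fin n := Sum.inl (Fin.castLE h i)

lemma castLE_injective' : Function.Injective (Fin.castLE h) := Fin.castLE_injective h

lemma pairIdx_ne_of_le {l : Fin m} (hl : n ≤ l) (i : Fin n) : Fin.castLE h i ≠ l := fun hil => by
  have := congrArg Fin.val hil
  simp at this
  omega

lemma aMat_mul_single_inr (x : Fin n → ℂ) (j : Fin n) (q : Fin m ⊕ Fin n) :
    aMat h x * Matrix.single (Sum.inr j) q 1 = x j • Matrix.single (pairIdx h j) q 1 := by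
  rw [aMat, Finset.sum_mul]
  simp only [Matrix.smul_mul, add_mul, single_mul_single_one]
  simp

lemma aMat_mul_single_inl (x : Fin n → ℂ) (j : Fin n) (q : Fin m ⊕ Fin n) :
    aMat h x * Matrix.single (pairIdx h j) q 1 = x j • Matrix.single (Sum.inr j) q 1 := by
  rw [aMat, Finset.sum_mul]
  simp only [Matrix.smul_mul, add_mul, single_mul_single_one]
  simp

lemma aMat_mul_single_of_le (x : Fin n → ℂ) {l : Fin m} (hl : n ≤ l) (q : Fin m ⊕ Fin n) :
    aMat h x * Matrix.single (Sum.inl l) q 1 = 0 := by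
  rw [aMat, Finset.sum_mul]
  simp only [Matrix.smul_mul, add_mul, single_mul_single_one]
  simp [pairIdx_ne_of_le h hl]

lemma coe_expA (x : Fin n → ℂ) :
    (expA h x).val = NormedSpace.exp (aMat h x) := rfl

/-- The sum and the difference of the two paired basis vectors are eigenvectors of `a(x)` for `x j`
and `-x j`; this is the source of the hyperbolic rotations below. -/
lemma expA_mul_single_add (x : Fin n → ℂ) (j : Fin n) (q : Fin m ⊕ Fin n) :
    (expA h x).val * (Matrix.single (pairIdx h j) q 1 + Matrix.single (Sum.inr j) q 1) =
      Complex.exp (x j) •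
        (Matrix.single (pairIdx h j) q 1 + Matrix.single (Sum.inr j) q 1) := by
  refine exp_mul_eq_smul ?_
  rw [mul_add, aMat_mul_single_inl, aMat_mul_single_inr, ← smul_add, add_comm]

lemma expA_mul_single_sub (x : Fin n → ℂ) (j : Fin n) (q : Fin m ⊕ Fin n) :
    (expA h x).val * (Matrix.single (pairIdx h j) q 1 - Matrix.single (Sum.inr j) q 1) =
      Complex.exp (-x j) •
        (Matrix.single (pairIdx h j) q 1 - Matrix.single (Sum.inr j) q 1) := by
  refine exp_mul_eq_smul ?_
  rw [mul_sub, aMat_mul_single_inl, aMat_mul_single_inr, ← smul_sub, neg_smul, ← smul_neg,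
    neg_sub]

lemma expA_mul_single_inl (x : Fin n → ℂ) (j : Fin n) (q : Fin m ⊕ Fin n) :
    (expA h x).val * Matrix.single (pairIdx h j) q 1 =
      Complex.cosh (x j) • Matrix.single (pairIdx h j) q 1 +
        Complex.sinh (x j) • Matrix.single (Sum.inr j) q 1 := by
  have h1 := expA_mul_single_add h x j q
  have h2 := expA_mul_single_sub h x j q
  have h3 : (Matrix.single (pairIdx h j) q 1 : Matrix (Fin m ⊕ Fin n) (Fin m ⊕ Fin n) ℂ) =
      (1 / 2 : ℂ) • ((Matrix.single (pairIdx h j) q 1 + Matrix.single (Sum.inr j) q 1) +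
        (Matrix.single (pairIdx h j) q 1 - Matrix.single (Sum.inr j) q 1)) := by module
  rw [h3, Matrix.mul_smul, mul_add, h1, h2, Complex.cosh, Complex.sinh]
  module

lemma expA_mul_single_inr (x : Fin n → ℂ) (j : Fin n) (q : Fin m ⊕ Fin n) :
    (expA h x).val * Matrix.single (Sum.inr j) q 1 =
      Complex.sinh (x j) • Matrix.single (pairIdx h j) q 1 +
        Complex.cosh (x j) • Matrix.single (Sum.inr j) q 1 := by
  have h1 := expA_mul_single_add h x j q
  have h2 := expA_mul_single_sub h x j q
  have h3 : (Matrix.single (Sum.inr j) q 1 : Matrix (Fin m ⊕ Fin n) (Fin m ⊕ Fin n) ℂ) =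
      (1 / 2 : ℂ) • ((Matrix.single (pairIdx h j) q 1 + Matrix.single (Sum.inr j) q 1) -
        (Matrix.single (pairIdx h j) q 1 - Matrix.single (Sum.inr j) q 1)) := by module
  rw [h3, Matrix.mul_smul, mul_sub, h1, h2, Complex.cosh, Complex.sinh]
  module

lemma expA_mul_single_of_le (x : Fin n → ℂ) {l : Fin m} (hl : n ≤ l) (q : Fin m ⊕ Fin n) :
    (expA h x).val * Matrix.single (Sum.inl l) q 1 = Matrix.single (Sum.inl l) q 1 := by
  have := exp_mul_eq_smul (H := aMat h x) (N := Matrix.single (Sum.inl l) q 1) (z := 0)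
    (by rw [aMat_mul_single_of_le h x hl, zero_smul])
  rwa [Complex.exp_zero, one_smul] at this

lemma transpose_aMat (x : Fin n → ℂ) : (aMat h x)ᵀ = aMat h x := by
  simp only [aMat, Matrix.transpose_sum, Matrix.transpose_smul, Matrix.transpose_add,
    Matrix.transpose_single, add_comm]

lemma transpose_expA (x : Fin n → ℂ) :
    (expA h x).valᵀ = (expA h x).val := by
  rw [coe_expA, ← Matrix.exp_transpose, transpose_aMat]

lemma single_inl_mul_expA (x : Fin n → ℂ) (j : Fin n) (q : Fin m ⊕ Fin n) :
    Matrix.single q (pairIdx h j) 1 * (expA h x).val =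
      Complex.cosh (x j) • Matrix.single q (pairIdx h j) 1 +
        Complex.sinh (x j) • Matrix.single q (Sum.inr j) 1 := by
  have := congrArg Matrix.transpose (expA_mul_single_inl h x j q)
  simpa [Matrix.transpose_mul, transpose_expA] using this

lemma single_inr_mul_expA (x : Fin n → ℂ) (j : Fin n) (q : Fin m ⊕ Fin n) :
    Matrix.single q (Sum.inr j) 1 * (expA h x).val =
      Complex.sinh (x j) • Matrix.single q (pairIdx h j) 1 +
        Complex.cosh (x j) • Matrix.single q (Sum.inr j) 1 := by
  have := congrArg Matrix.transpose (expA_mul_single_inr h x j q)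
  simpa [Matrix.transpose_mul, transpose_expA] using this

lemma single_mul_expA_of_le (x : Fin n → ℂ) {l : Fin m} (hl : n ≤ l) (q : Fin m ⊕ Fin n) :
    Matrix.single q (Sum.inl l) 1 * (expA h x).val = Matrix.single q (Sum.inl l) 1 := by
  have := congrArg Matrix.transpose (expA_mul_single_of_le h x hl q)
  simpa [Matrix.transpose_mul, transpose_expA] using this

lemma expA_apply_inl_inl (x : Fin n → ℂ) (i : Fin m) (j : Fin n) :
    (expA h x).val (Sum.inl i) (pairIdx h j) =
      if i = Fin.castLE h j then Complex.cosh (x j) else 0 := by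
  have := congrFun (congrFun (expA_mul_single_inl h x j (Sum.inr j)) (Sum.inl i)) (Sum.inr j)
  simpa [Matrix.single_apply, eq_comm] using this

lemma expA_apply_inr_inl (x : Fin n → ℂ) (i : Fin n) (j : Fin n) :
    (expA h x).val (Sum.inr i) (pairIdx h j) =
      if i = j then Complex.sinh (x j) else 0 := by
  have := congrFun (congrFun (expA_mul_single_inl h x j (Sum.inr j)) (Sum.inr i)) (Sum.inr j)
  simpa [Matrix.single_apply, eq_comm] using this

lemma expA_apply_inl_inr (x : Fin n → ℂ) (i : Fin m) (j : Fin n) :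
    (expA h x).val (Sum.inl i) (Sum.inr j) =
      if i = Fin.castLE h j then Complex.sinh (x j) else 0 := by
  have := congrFun (congrFun (expA_mul_single_inr h x j (Sum.inr j)) (Sum.inl i)) (Sum.inr j)
  simpa [Matrix.single_apply, eq_comm] using this

lemma expA_apply_inr_inr (x : Fin n → ℂ) (i : Fin n) (j : Fin n) :
    (expA h x).val (Sum.inr i) (Sum.inr j) =
      if i = j then Complex.cosh (x j) else 0 := by
  have := congrFun (congrFun (expA_mul_single_inr h x j (Sum.inr j)) (Sum.inr i)) (Sum.inr j)
  simpa [Matrix.single_apply, eq_comm] using this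

lemma expA_apply_inl_of_le (x : Fin n → ℂ) (i : Fin m) {l : Fin m} (hl : n ≤ l) :
    (expA h x).val (Sum.inl i) (Sum.inl l) = if i = l then 1 else 0 := by
  have := congrFun (congrFun (expA_mul_single_of_le h x hl (Sum.inl l)) (Sum.inl i)) (Sum.inl l)
  simpa [Matrix.single_apply, eq_comm] using this

/-- The generator `E_{m+i,i} + E_{i,m+i}` of the torus. -/
def aGen (i : Fin n) : Matrix (Fin m ⊕ Fin n) (Fin m ⊕ Fin n) ℂ :=
  Matrix.single (Sum.inr i) (pairIdx h i) 1 + Matrix.single (pairIdx h i) (Sum.inr i) 1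

lemma aMat_single (i : Fin n) (t : ℂ) : aMat h (Pi.single i t) = t • aGen h i := by
  rw [aMat, Finset.sum_eq_single i]
  · simp [aGen]
  · intro j _ hj
    simp [hj]
  · simp

lemma aMat_add (x y : Fin n → ℂ) : aMat h (x + y) = aMat h x + aMat h y := by
  simp only [aMat, Pi.add_apply, add_smul, Finset.sum_add_distrib]

lemma aGen_mul_aGen_comm (i j : Fin n) : aGen h i * aGen h j = aGen h j * aGen h i := by
  rcases eq_or_ne i j with rfl | hij
  · rfl
  · have hij' : Fin.castLE h i ≠ Fin.castLE h j := fun e => hij (castLE_injective' h e)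
    simp only [aGen, add_mul, mul_add, single_mul_single_one]
    simp [hij, hij.symm, hij', hij'.symm]

lemma aMat_commute (x y : Fin n → ℂ) : Commute (aMat h x) (aMat h y) := by
  have key : ∀ x, aMat h x = ∑ i, x i • aGen h i := fun _ => rfl
  rw [key, key]
  refine Commute.sum_left _ _ _ fun i _ => Commute.sum_right _ _ _ fun j _ => ?_
  exact ((show Commute (aGen h i) (aGen h j) from aGen_mul_aGen_comm h i j).smul_left _).smul_right _

lemma expA_add (x y : Fin n → ℂ) : expA h (x + y) = expA h x * expA h y := by
  rw [expA, aMat_add]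
  exact expGL_add_of_commute (aMat_commute h x y)

lemma kEmb_mul (k₁ l₁ : GL (Fin m) ℂ) (k₂ l₂ : GL (Fin n) ℂ) :
    kEmb (k₁ * l₁) (k₂ * l₂) = kEmb k₁ k₂ * kEmb l₁ l₂ := by
  ext1
  simp [kEmb, Matrix.fromBlocks_multiply]

lemma exp_fromBlocks (Y₁ : Matrix (Fin m) (Fin m) ℂ) (Y₂ : Matrix (Fin n) (Fin n) ℂ) :
    expGL (Matrix.fromBlocks Y₁ 0 0 Y₂) = kEmb (expGL Y₁) (expGL Y₂) := by
  ext1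
  simp only [coe_expGL, kEmb]
  open scoped Norms.Operator in
  have h1 := NormedSpace.exp_series_hasSum_exp' (𝕂 := ℂ) Y₁
  have h2 := NormedSpace.exp_series_hasSum_exp' (𝕂 := ℂ) Y₂
  have h0 := NormedSpace.exp_series_hasSum_exp' (𝕂 := ℂ) (Matrix.fromBlocks Y₁ 0 0 Y₂)
  have hpow : ∀ k : ℕ, Matrix.fromBlocks Y₁ 0 0 Y₂ ^ k =
      Matrix.fromBlocks (Y₁ ^ k) 0 0 (Y₂ ^ k) := by
    intro k
    induction k with
    | zero => simp
    | succ k ih => simp [pow_succ, ih, Matrix.fromBlocks_multiply]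
  refine h0.unique ?_
  have h3 : ∀ p q, HasSum (fun k : ℕ => ((k.factorial : ℂ)⁻¹ •
      Matrix.fromBlocks Y₁ 0 0 Y₂ ^ k) p q)
      (Matrix.fromBlocks (NormedSpace.exp Y₁) 0 0 (NormedSpace.exp Y₂) p q) := by
    rintro (i | i) (j | j)
    · simp only [hpow, Matrix.smul_apply, Matrix.fromBlocks_apply₁₁]
      exact Pi.hasSum.1 (Pi.hasSum.1 h1 i) j
    · simp [hpow]
    · simp [hpow]
    · simp only [hpow, Matrix.smul_apply, Matrix.fromBlocks_apply₂₂]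
      exact Pi.hasSum.1 (Pi.hasSum.1 h2 i) j
  exact Pi.hasSum.2 fun p => Pi.hasSum.2 fun q => h3 p q

end KEmbedding

/-! ### The radial part of the Casimir operator -/

section Radial

variable {m n : ℕ} (h : n ≤ m)

lemma fromBlocks_single_left (i j : Fin m) :
    Matrix.fromBlocks (Matrix.single i j (1 : ℂ)) 0 0 (0 : Matrix (Fin n) (Fin n) ℂ) =
      Matrix.single (Sum.inl i) (Sum.inl j) 1 := by
  ext (p | p) (q | q) <;> simp [Matrix.single_apply]

lemma fromBlocks_single_right (i j : Fin n) :
    Matrix.fromBlocks (0 : Matrix (Fin m) (Fin m) ℂ) 0 0 (Matrix.single i j (1 : ℂ)) =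
      Matrix.single (Sum.inr i) (Sum.inr j) 1 := by
  ext (p | p) (q | q) <;> simp [Matrix.single_apply]

lemma expA_zero : expA h 0 = 1 := by
  ext1
  simp [coe_expA, aMat]

lemma expA_mul_neg (x : Fin n → ℂ) : (expA h x).val * (expA h (-x)).val = 1 := by
  rw [← Units.val_mul, ← expA_add, add_neg_cancel, expA_zero, Units.val_one]

/-- The adjoint action of `e^{-a(x)}`. -/
def adA (x : Fin n → ℂ) (Y : Matrix (Fin m ⊕ Fin n) (Fin m ⊕ Fin n) ℂ) :
    Matrix (Fin m ⊕ Fin n) (Fin m ⊕ Fin n) ℂ :=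
  (expA h (-x)).val * Y * (expA h x).val

lemma expA_mul_adA (x : Fin n → ℂ) (Y : Matrix (Fin m ⊕ Fin n) (Fin m ⊕ Fin n) ℂ) :
    (expA h x).val * adA h x Y = Y * (expA h x).val := by
  rw [adA, ← mul_assoc, ← mul_assoc, expA_mul_neg, one_mul]

lemma adA_single_inl (x : Fin n → ℂ) (i j : Fin n) :
    adA h x (Matrix.single (pairIdx h i) (pairIdx h j) 1) =
      (Complex.cosh (x i) * Complex.cosh (x j)) • Matrix.single (pairIdx h i) (pairIdx h j) 1 -
      (Complex.sinh (x i) * Complex.sinh (x j)) • Matrix.single (Sum.inr i) (Sum.inr j) 1 +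
      (Complex.cosh (x i) * Complex.sinh (x j)) • Matrix.single (pairIdx h i) (Sum.inr j) 1 -
      (Complex.sinh (x i) * Complex.cosh (x j)) • Matrix.single (Sum.inr i) (pairIdx h j) 1 := by
  rw [adA, expA_mul_single_inl, add_mul, Matrix.smul_mul, Matrix.smul_mul, single_inl_mul_expA,
    single_inl_mul_expA, Pi.neg_apply, Complex.cosh_neg, Complex.sinh_neg]
  module

lemma adA_single_inr (x : Fin n → ℂ) (i j : Fin n) :
    adA h x (Matrix.single (Sum.inr i) (Sum.inr j) 1) =
      (Complex.cosh (x i) * Complex.cosh (x j)) • Matrix.single (Sum.inr i) (Sum.inr j) 1 -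
      (Complex.sinh (x i) * Complex.sinh (x j)) • Matrix.single (pairIdx h i) (pairIdx h j) 1 -
      (Complex.sinh (x i) * Complex.cosh (x j)) • Matrix.single (pairIdx h i) (Sum.inr j) 1 +
      (Complex.cosh (x i) * Complex.sinh (x j)) • Matrix.single (Sum.inr i) (pairIdx h j) 1 := by
  rw [adA, expA_mul_single_inr, add_mul, Matrix.smul_mul, Matrix.smul_mul, single_inr_mul_expA,
    single_inr_mul_expA, Pi.neg_apply, Complex.cosh_neg, Complex.sinh_neg]
  module

lemma adA_single_row (x : Fin n → ℂ) {l : Fin m} (hl : n ≤ l) (j : Fin n) :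
    adA h x (Matrix.single (Sum.inl l) (pairIdx h j) 1) =
      Complex.cosh (x j) • Matrix.single (Sum.inl l) (pairIdx h j) 1 +
      Complex.sinh (x j) • Matrix.single (Sum.inl l) (Sum.inr j) 1 := by
  rw [adA, expA_mul_single_of_le h _ hl, single_inl_mul_expA]

lemma adA_single_col (x : Fin n → ℂ) {l : Fin m} (hl : n ≤ l) (j : Fin n) :
    adA h x (Matrix.single (pairIdx h j) (Sum.inl l) 1) =
      Complex.cosh (x j) • Matrix.single (pairIdx h j) (Sum.inl l) 1 -
      Complex.sinh (x j) • Matrix.single (Sum.inr j) (Sum.inl l) 1 := by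
  rw [adA, expA_mul_single_inl, add_mul, Matrix.smul_mul, Matrix.smul_mul,
    single_mul_expA_of_le h _ hl, single_mul_expA_of_le h _ hl, Pi.neg_apply, Complex.cosh_neg,
    Complex.sinh_neg]
  module

/-- `F'` is the left-invariant derivative of the function `F` on `K = GL(m) × GL(n)` along
`(Y₁, Y₂)`. -/
def HasKDeriv (Y₁ : Matrix (Fin m) (Fin m) ℂ) (Y₂ : Matrix (Fin n) (Fin n) ℂ)
    (F F' : GL (Fin m) ℂ → GL (Fin n) ℂ → ℂ) : Prop :=
  ∀ p q, HasDerivAt (fun t : ℂ => F (p * expGL (t • Y₁)) (q * expGL (t • Y₂))) (F' p q) 0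

/-- The infinitesimal properties of the matrix coefficients of the `M`-semi-invariant vector of
`U`: here `V i j` and `S l j` are the derivatives of `F` along `E_ij ∈ 𝔤𝔩_n` and `E_lj ∈ 𝔤𝔩_m`. -/
structure IsSemiInvariantCoeff (wt N v : ℂ) (F : GL (Fin m) ℂ → GL (Fin n) ℂ → ℂ)
    (V : Fin n → Fin n → GL (Fin m) ℂ → GL (Fin n) ℂ → ℂ)
    (S : Fin m → Fin n → GL (Fin m) ℂ → GL (Fin n) ℂ → ℂ) : Prop where
  pair : ∀ i j, i ≠ j →
    HasKDeriv (Matrix.single (Fin.castLE h i) (Fin.castLE h j) 1) 0 F 0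
  pair_V : ∀ i j, i ≠ j →
    HasKDeriv (Matrix.single (Fin.castLE h i) (Fin.castLE h j) 1) 0 (V j i) 0
  deriv_V : ∀ i j, i ≠ j → HasKDeriv 0 (Matrix.single i j 1) F (V i j)
  deriv_deriv_V : ∀ i j, i ≠ j →
    HasKDeriv 0 (Matrix.single i j 1) (V j i) ((v * (v + 1)) • F)
  diag : ∀ i, HasKDeriv (Matrix.single (Fin.castLE h i) (Fin.castLE h i) 1) 0 F (wt • F)
  short : ∀ (l : Fin m) (j : Fin n), n ≤ l →
    HasKDeriv (Matrix.single (Fin.castLE h j) l 1) 0 F 0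
  deriv_S : ∀ (l : Fin m) (j : Fin n), n ≤ l →
    HasKDeriv (Matrix.single l (Fin.castLE h j) 1) 0 F (S l j)
  short_S : ∀ (l : Fin m) (j : Fin n), n ≤ l →
    HasKDeriv (Matrix.single (Fin.castLE h j) l 1) 0 (S l j) (N • F)

/-- The mechanism of the radial part: `e^{a}` conjugates the direction into the Lie algebra of `K`,
and along `K e^{a}` the function is a known multiple of `F`. Only the values of `φ` on `K e^{a(x)}`
are needed, so the lemma can be applied again to a derivative of `φ`. -/
lemma leftInvDeriv_adA (x : Fin n → ℂ) {Y₁ : Matrix (Fin m) (Fin m) ℂ}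
    {Y₂ : Matrix (Fin n) (Fin n) ℂ} {F F' : GL (Fin m) ℂ → GL (Fin n) ℂ → ℂ}
    (hF : HasKDeriv Y₁ Y₂ F F') {φ : GL (Fin m ⊕ Fin n) ℂ → ℂ} {s : ℂ}
    (hφ : ∀ p q, φ (kEmb p q * expA h x) = s * F p q) (p : GL (Fin m) ℂ) (q : GL (Fin n) ℂ) :
    leftInvDeriv (adA h x (Matrix.fromBlocks Y₁ 0 0 Y₂)) φ (kEmb p q * expA h x) = s * F' p q := by
  rw [leftInvDeriv_mul_right φ (expA_mul_adA h x _)]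
  have : (fun t : ℂ => φ (kEmb p q * expGL (t • Matrix.fromBlocks Y₁ 0 0 Y₂) * expA h x)) =
      fun t : ℂ => s * F (p * expGL (t • Y₁)) (q * expGL (t • Y₂)) := by
    ext t
    rw [Matrix.fromBlocks_smul, smul_zero, smul_zero, exp_fromBlocks, ← kEmb_mul, hφ]
  rw [this]
  exact ((hF p q).const_mul s).deriv

/-- Scalar functions on `G` with the right equivariance of spherical functions. -/
structure IsRightEquivariant (a b : ℤ) (φ : GL (Fin m ⊕ Fin n) ℂ → ℂ) : Prop where
  polynomial : IsPolynomialFunction φ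
  right : ∀ g k₁ k₂, φ (g * kEmb k₁ k₂) =
    ((k₁ : Matrix (Fin m) (Fin m) ℂ).det ^ a * (k₂ : Matrix (Fin n) (Fin n) ℂ).det ^ b) * φ g

variable {h} {a b : ℤ} {φ : GL (Fin m ⊕ Fin n) ℂ → ℂ}

lemma IsRightEquivariant.leftInvDeriv_fromBlocks (hφ : IsRightEquivariant a b φ)
    (Y₁ : Matrix (Fin m) (Fin m) ℂ) (Y₂ : Matrix (Fin n) (Fin n) ℂ) :
    leftInvDeriv (Matrix.fromBlocks Y₁ 0 0 Y₂) φ = (a * Y₁.trace + b * Y₂.trace) • φ := by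
  ext g
  have h1 : ∀ {r : ℕ} (Y : Matrix (Fin r) (Fin r) ℂ) (z : ℤ), HasDerivAt
      (fun t : ℂ => (NormedSpace.exp (t • Y)).det ^ z) (z * Y.trace) 0 := by
    intro r Y z
    have h3 := (hasDerivAt_zpow z (NormedSpace.exp ((0 : ℂ) • Y)).det (Or.inl (by simp))).comp
      (0 : ℂ) (hasDerivAt_det_exp Y)
    refine (h3.congr_deriv ?_)
    simp
  have h2 := ((h1 Y₁ a).mul (h1 Y₂ b)).mul_const (φ g)
  have h4 : (fun t : ℂ => φ (g * expGL (t • Matrix.fromBlocks Y₁ 0 0 Y₂))) = fun t : ℂ =>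
      ((NormedSpace.exp (t • Y₁)).det ^ a * (NormedSpace.exp (t • Y₂)).det ^ b) * φ g := by
    ext t
    rw [Matrix.fromBlocks_smul, smul_zero, smul_zero, exp_fromBlocks, hφ.right]
    rfl
  rw [leftInvDeriv, h4]
  refine h2.deriv.trans ?_
  simp

lemma IsRightEquivariant.leftInvDeriv_inl (hφ : IsRightEquivariant a b φ) (i : Fin m) :
    leftInvDeriv (Matrix.single (Sum.inl i) (Sum.inl i) 1) φ = (a : ℂ) • φ := by
  rw [← fromBlocks_single_left, hφ.leftInvDeriv_fromBlocks]
  simp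

lemma IsRightEquivariant.leftInvDeriv_inl_of_ne (hφ : IsRightEquivariant a b φ) {i j : Fin m}
    (hij : i ≠ j) : leftInvDeriv (Matrix.single (Sum.inl i) (Sum.inl j) 1) φ = (0 : ℂ) • φ := by
  rw [← fromBlocks_single_left, hφ.leftInvDeriv_fromBlocks]
  simp [Matrix.trace_single_eq_of_ne _ _ _ hij]

lemma IsRightEquivariant.leftInvDeriv_inr (hφ : IsRightEquivariant a b φ) (i : Fin n) :
    leftInvDeriv (Matrix.single (Sum.inr i) (Sum.inr i) 1) φ = (b : ℂ) • φ := by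
  rw [← fromBlocks_single_right, hφ.leftInvDeriv_fromBlocks]
  simp

lemma IsRightEquivariant.leftInvDeriv_inr_of_ne (hφ : IsRightEquivariant a b φ) {i j : Fin n}
    (hij : i ≠ j) : leftInvDeriv (Matrix.single (Sum.inr i) (Sum.inr j) 1) φ = (0 : ℂ) • φ := by
  rw [← fromBlocks_single_right, hφ.leftInvDeriv_fromBlocks]
  simp [Matrix.trace_single_eq_of_ne _ _ _ hij]

/-- Moving a right derivative along `K` past another derivative. -/
lemma IsRightEquivariant.leftInvDeriv_comm (hφ : IsRightEquivariant a b φ)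
    {Y : Matrix (Fin m ⊕ Fin n) (Fin m ⊕ Fin n) ℂ} {z : ℂ} (hY : leftInvDeriv Y φ = z • φ)
    (X : Matrix (Fin m ⊕ Fin n) (Fin m ⊕ Fin n) ℂ) (g : GL (Fin m ⊕ Fin n) ℂ) :
    leftInvDeriv Y (leftInvDeriv X φ) g =
      z * leftInvDeriv X φ g + leftInvDeriv (Y * X - X * Y) φ g := by
  rw [hφ.polynomial.leftInvDeriv_comm, hY, leftInvDeriv_smul hφ.polynomial]
  rfl

/-- The sum of the second order derivatives along `E_{ij}` and `E_{ji}` in both orders. -/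
def pairOp (φ : GL (Fin m ⊕ Fin n) ℂ → ℂ) (l : Fin m) (j : Fin n) (g : GL (Fin m ⊕ Fin n) ℂ) : ℂ :=
  leftInvDeriv (Matrix.single (Sum.inl l) (Sum.inr j) 1)
      (leftInvDeriv (Matrix.single (Sum.inr j) (Sum.inl l) 1) φ) g +
    leftInvDeriv (Matrix.single (Sum.inr j) (Sum.inl l) 1)
      (leftInvDeriv (Matrix.single (Sum.inl l) (Sum.inr j) 1) φ) g

/-- On the right the Lie algebra of `K` acts through traces: the diagonal matrix units give the
scalars `a` and `b`, the others give `0`. -/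
lemma IsRightEquivariant.casimirOp_eq (hφ : IsRightEquivariant a b φ)
    (g : GL (Fin m ⊕ Fin n) ℂ) :
    casimirOp φ g = (m * a ^ 2 + n * b ^ 2) * φ g + ∑ l, ∑ j, pairOp φ l j g := by
  have h1 : ∀ i j : Fin m, leftInvDeriv (Matrix.single (Sum.inl i) (Sum.inl j) 1)
      (leftInvDeriv (Matrix.single (Sum.inl j) (Sum.inl i) 1) φ) g =
        if i = j then (a : ℂ) ^ 2 * φ g else 0 := by
    intro i j
    split_ifs with hij
    · subst hij
      rw [hφ.leftInvDeriv_inl, leftInvDeriv_smul hφ.polynomial, hφ.leftInvDeriv_inl]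
      simp [sq, mul_assoc]
    · rw [hφ.leftInvDeriv_inl_of_ne (Ne.symm hij), leftInvDeriv_smul hφ.polynomial]
      simp
  have h2 : ∀ i j : Fin n, leftInvDeriv (Matrix.single (Sum.inr i) (Sum.inr j) 1)
      (leftInvDeriv (Matrix.single (Sum.inr j) (Sum.inr i) 1) φ) g =
        if i = j then (b : ℂ) ^ 2 * φ g else 0 := by
    intro i j
    split_ifs with hij
    · subst hij
      rw [hφ.leftInvDeriv_inr, leftInvDeriv_smul hφ.polynomial, hφ.leftInvDeriv_inr]
      simp [sq, mul_assoc]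
    · rw [hφ.leftInvDeriv_inr_of_ne (Ne.symm hij), leftInvDeriv_smul hφ.polynomial]
      simp
  simp only [casimirOp, Fintype.sum_sum_type, h1, h2, pairOp, Finset.sum_add_distrib]
  rw [Finset.sum_comm (s := (Finset.univ : Finset (Fin n)))]
  simp
  ring

variable {wt N v : ℂ} {F : GL (Fin m) ℂ → GL (Fin n) ℂ → ℂ}
  {V : Fin n → Fin n → GL (Fin m) ℂ → GL (Fin n) ℂ → ℂ}
  {S : Fin m → Fin n → GL (Fin m) ℂ → GL (Fin n) ℂ → ℂ} {x : Fin n → ℂ} {s : ℂ}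

/-- One of the `m - n` equal contributions to the root `ε_j`. Conjugating `E_lj` and `E_jl` by
`e^{-a}` adds a multiple `± sinh x_j` of a noncompact root vector, while the compact term acts on
the right by zero. -/
lemma pairOp_short (hF : IsSemiInvariantCoeff h wt N v F V S) (hφ : IsRightEquivariant a b φ)
    (hs : ∀ p q, φ (kEmb p q * expA h x) = s * F p q) {l : Fin m} (hl : n ≤ l) (j : Fin n)
    (hx : Complex.sinh (x j) ≠ 0) (p : GL (Fin m) ℂ) (q : GL (Fin n) ℂ) :
    pairOp φ l j (kEmb p q * expA h x) =
      Complex.cosh (x j) / Complex.sinh (x j) * leftInvDeriv (aGen h j) φ (kEmb p q * expA h x) -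
        N / Complex.sinh (x j) ^ 2 * (s * F p q) := by
  have hlj : Fin.castLE h j ≠ l := pairIdx_ne_of_le h hl j
  have hPφ := hφ.polynomial.leftInvDeriv (Matrix.single (Sum.inl l) (Sum.inr j) 1)
  have hQφ := hφ.polynomial.leftInvDeriv (Matrix.single (Sum.inr j) (Sum.inl l) 1)
  have e1 : ∀ p q, leftInvDeriv (Matrix.single (Sum.inl l) (Sum.inr j) 1) φ
      (kEmb p q * expA h x) = s / Complex.sinh (x j) * S l j p q := by
    intro p q
    have := leftInvDeriv_adA h x (hF.deriv_S l j hl) hs p q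
    rw [fromBlocks_single_left, adA_single_row h x hl, hφ.polynomial.leftInvDeriv_add_left,
      hφ.polynomial.leftInvDeriv_smul_left, hφ.polynomial.leftInvDeriv_smul_left,
      hφ.leftInvDeriv_inl_of_ne hlj.symm] at this
    simp only [Pi.smul_apply, zero_smul, mul_zero, zero_add] at this
    field_simp
    linear_combination this
  -- The value zero is written as `0 * F p q` to have the shape required by `leftInvDeriv_adA`.
  have e2 : ∀ p q, leftInvDeriv (Matrix.single (Sum.inr j) (Sum.inl l) 1) φ
      (kEmb p q * expA h x) = 0 * F p q := by
    intro p q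
    have := leftInvDeriv_adA h x (hF.short l j hl) hs p q
    rw [fromBlocks_single_left, adA_single_col h x hl, hφ.polynomial.leftInvDeriv_sub_left,
      hφ.polynomial.leftInvDeriv_smul_left, hφ.polynomial.leftInvDeriv_smul_left,
      hφ.leftInvDeriv_inl_of_ne hlj] at this
    simp only [Pi.smul_apply, zero_smul, mul_zero, zero_sub, Pi.zero_apply] at this
    rw [zero_mul]
    simpa [hx] using this
  -- The same conjugations applied to the first derivatives. Moving the compact term past them
  -- leaves the commutators `-E_{m+j,j}` and `E_{j,m+j}`, which assemble to `aGen h j`.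
  have f1 := leftInvDeriv_adA h x (hF.deriv_S l j hl) e2 p q
  rw [fromBlocks_single_left, adA_single_row h x hl, hQφ.leftInvDeriv_add_left,
    hQφ.leftInvDeriv_smul_left, hQφ.leftInvDeriv_smul_left,
    hφ.leftInvDeriv_comm (hφ.leftInvDeriv_inl_of_ne hlj.symm)] at f1
  have f2 := leftInvDeriv_adA h x (hF.short_S l j hl) e1 p q
  rw [fromBlocks_single_left, adA_single_col h x hl, hPφ.leftInvDeriv_sub_left,
    hPφ.leftInvDeriv_smul_left, hPφ.leftInvDeriv_smul_left,
    hφ.leftInvDeriv_comm (hφ.leftInvDeriv_inl_of_ne hlj)] at f2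
  simp only [single_mul_single_one, if_true, reduceCtorEq, if_false, zero_sub, sub_zero,
    ← neg_one_smul ℂ (Matrix.single (Sum.inr j) _ (1 : ℂ))] at f1 f2
  rw [hφ.polynomial.leftInvDeriv_smul_left] at f1
  rw [aGen, hφ.polynomial.leftInvDeriv_add_left, pairOp]
  simp only [Pi.smul_apply, smul_eq_mul] at f2
  field_simp
  field_simp at f2
  linear_combination Complex.sinh (x j) * f1 - f2

/-- The contribution of `ε_i ± ε_j`. The conjugates of the two compact vectors `E_ij`, one in each
block, give a `2 × 2` linear system for the noncompact derivatives with determinant `sinh² x_j -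
sinh² x_i`. -/
lemma pairOp_pair (hF : IsSemiInvariantCoeff h wt N v F V S) (hφ : IsRightEquivariant a b φ)
    (hs : ∀ p q, φ (kEmb p q * expA h x) = s * F p q) {i j : Fin n} (hij : i ≠ j)
    (hx : Complex.sinh (x i) ^ 2 - Complex.sinh (x j) ^ 2 ≠ 0)
    (p : GL (Fin m) ℂ) (q : GL (Fin n) ℂ) :
    pairOp φ (Fin.castLE h i) j (kEmb p q * expA h x) =
      (Complex.cosh (x i) * Complex.sinh (x i) * leftInvDeriv (aGen h i) φ (kEmb p q * expA h x) -
      Complex.cosh (x j) * Complex.sinh (x j) * leftInvDeriv (aGen h j) φ (kEmb p q * expA h x)) /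
        (Complex.sinh (x i) ^ 2 - Complex.sinh (x j) ^ 2) -
      2 * (v * (v + 1)) * Complex.sinh (x i) ^ 2 * Complex.cosh (x j) ^ 2 /
        (Complex.sinh (x i) ^ 2 - Complex.sinh (x j) ^ 2) ^ 2 * (s * F p q) := by
  have hij' : Fin.castLE h i ≠ Fin.castLE h j := fun e => hij (castLE_injective' h e)
  have ci := Complex.cosh_sq (x i)
  have cj := Complex.cosh_sq (x j)
  -- first order derivatives along the non-compact part
  have first : ∀ i j : Fin n, i ≠ j → Complex.sinh (x i) ^ 2 - Complex.sinh (x j) ^ 2 ≠ 0 →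
      ∀ p q, leftInvDeriv (Matrix.single (pairIdx h i) (Sum.inr j) 1) φ (kEmb p q * expA h x) =
          -(s * Complex.sinh (x i) * Complex.cosh (x j)) /
            (Complex.sinh (x i) ^ 2 - Complex.sinh (x j) ^ 2) * V i j p q ∧
        leftInvDeriv (Matrix.single (Sum.inr i) (pairIdx h j) 1) φ (kEmb p q * expA h x) =
          -(s * Complex.cosh (x i) * Complex.sinh (x j)) /
            (Complex.sinh (x i) ^ 2 - Complex.sinh (x j) ^ 2) * V i j p q := by
    intro i j hij hx p q
    have hij' : Fin.castLE h i ≠ Fin.castLE h j := fun e => hij (castLE_injective' h e)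
    have ci := Complex.cosh_sq (x i)
    have cj := Complex.cosh_sq (x j)
    have t1 := leftInvDeriv_adA h x (hF.pair i j hij) hs p q
    have t2 := leftInvDeriv_adA h x (hF.deriv_V i j hij) hs p q
    rw [fromBlocks_single_left, adA_single_inl, hφ.polynomial.leftInvDeriv_sub_left,
      hφ.polynomial.leftInvDeriv_add_left, hφ.polynomial.leftInvDeriv_sub_left] at t1
    rw [fromBlocks_single_right, adA_single_inr, hφ.polynomial.leftInvDeriv_add_left,
      hφ.polynomial.leftInvDeriv_sub_left, hφ.polynomial.leftInvDeriv_sub_left] at t2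
    simp only [hφ.polynomial.leftInvDeriv_smul_left, hφ.leftInvDeriv_inl_of_ne hij',
      hφ.leftInvDeriv_inr_of_ne hij, zero_smul, Pi.zero_apply, mul_zero, zero_add,
      zero_sub, sub_self] at t1 t2
    generalize leftInvDeriv (Matrix.single (pairIdx h i) (Sum.inr j) 1) φ
      (kEmb p q * expA h x) = P at *
    generalize leftInvDeriv (Matrix.single (Sum.inr i) (pairIdx h j) 1) φ
      (kEmb p q * expA h x) = Q at *
    generalize Complex.cosh (x i) = ci' at *
    generalize Complex.cosh (x j) = cj' at *
    generalize Complex.sinh (x i) = si at *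
    generalize Complex.sinh (x j) = sj at *
    -- Cramer's rule, with `cosh² = sinh² + 1` used to simplify the determinant.
    constructor
    · rw [div_mul_eq_mul_div, eq_div_iff hx]
      linear_combination (-ci' * sj) * t1 - si * cj' * t2 + P * sj ^ 2 * ci - P * si ^ 2 * cj
    · rw [div_mul_eq_mul_div, eq_div_iff hx]
      linear_combination (-si * cj') * t1 - ci' * sj * t2 - Q * si ^ 2 * cj + Q * sj ^ 2 * ci
  have hx' : Complex.sinh (x j) ^ 2 - Complex.sinh (x i) ^ 2 ≠ 0 := by
    rw [← neg_ne_zero, neg_sub]; exact hx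
  have hPφ := hφ.polynomial.leftInvDeriv (Matrix.single (pairIdx h i) (Sum.inr j) 1)
  have hQφ := hφ.polynomial.leftInvDeriv (Matrix.single (Sum.inr j) (pairIdx h i) 1)
  have eQ := fun p q => (first j i hij.symm hx' p q).2
  have eP := fun p q => (first i j hij hx p q).1
  -- Four relations for the four second order derivatives. The unwanted ones, named `QQ` and `PP`
  -- below, occur once in each pair of relations and are eliminated in `key`.
  have u1 := leftInvDeriv_adA h x (hF.pair_V i j hij) eQ p q
  have u2 := leftInvDeriv_adA h x (hF.deriv_deriv_V i j hij) eQ p q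
  have w1 := leftInvDeriv_adA h x (hF.pair_V j i hij.symm) eP p q
  have w2 := leftInvDeriv_adA h x (hF.deriv_deriv_V j i hij.symm) eP p q
  rw [fromBlocks_single_left, adA_single_inl, hQφ.leftInvDeriv_sub_left,
    hQφ.leftInvDeriv_add_left, hQφ.leftInvDeriv_sub_left] at u1
  rw [fromBlocks_single_right, adA_single_inr, hQφ.leftInvDeriv_add_left,
    hQφ.leftInvDeriv_sub_left, hQφ.leftInvDeriv_sub_left] at u2
  rw [fromBlocks_single_left, adA_single_inl, hPφ.leftInvDeriv_sub_left,
    hPφ.leftInvDeriv_add_left, hPφ.leftInvDeriv_sub_left] at w1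
  rw [fromBlocks_single_right, adA_single_inr, hPφ.leftInvDeriv_add_left,
    hPφ.leftInvDeriv_sub_left, hPφ.leftInvDeriv_sub_left] at w2
  simp only [hQφ.leftInvDeriv_smul_left, hφ.leftInvDeriv_comm (hφ.leftInvDeriv_inl_of_ne hij'),
    hφ.leftInvDeriv_comm (hφ.leftInvDeriv_inr_of_ne hij)] at u1 u2
  simp only [hPφ.leftInvDeriv_smul_left,
    hφ.leftInvDeriv_comm (hφ.leftInvDeriv_inl_of_ne hij'.symm),
    hφ.leftInvDeriv_comm (hφ.leftInvDeriv_inr_of_ne hij.symm)] at w1 w2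
  simp only [single_mul_single_one, if_true, reduceCtorEq, if_false, zero_sub, sub_zero,
    zero_mul, zero_add, ← neg_one_smul ℂ (Matrix.single _ _ (1 : ℂ)),
    hφ.polynomial.leftInvDeriv_smul_left, Pi.zero_apply, Pi.smul_apply, smul_eq_mul,
    mul_zero] at u1 u2 w1 w2
  rw [aGen, aGen, hφ.polynomial.leftInvDeriv_add_left, hφ.polynomial.leftInvDeriv_add_left, pairOp]
  generalize leftInvDeriv (Matrix.single (pairIdx h i) (Sum.inr j) 1) (leftInvDeriv
    (Matrix.single (Sum.inr j) (pairIdx h i) 1) φ) (kEmb p q * expA h x) = PQ at *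
  generalize leftInvDeriv (Matrix.single (Sum.inr j) (pairIdx h i) 1) (leftInvDeriv
    (Matrix.single (pairIdx h i) (Sum.inr j) 1) φ) (kEmb p q * expA h x) = QP at *
  generalize leftInvDeriv (Matrix.single (Sum.inr i) (pairIdx h j) 1) (leftInvDeriv
    (Matrix.single (Sum.inr j) (pairIdx h i) 1) φ) (kEmb p q * expA h x) = QQ at *
  generalize leftInvDeriv (Matrix.single (pairIdx h j) (Sum.inr i) 1) (leftInvDeriv
    (Matrix.single (pairIdx h i) (Sum.inr j) 1) φ) (kEmb p q * expA h x) = PP at *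
  generalize leftInvDeriv (Matrix.single (Sum.inr i) (pairIdx h i) 1) φ
    (kEmb p q * expA h x) = Qi at *
  generalize leftInvDeriv (Matrix.single (Sum.inr j) (pairIdx h j) 1) φ
    (kEmb p q * expA h x) = Qj at *
  generalize leftInvDeriv (Matrix.single (pairIdx h i) (Sum.inr i) 1) φ
    (kEmb p q * expA h x) = Pi at *
  generalize leftInvDeriv (Matrix.single (pairIdx h j) (Sum.inr j) 1) φ
    (kEmb p q * expA h x) = Pj at *
  generalize Complex.cosh (x i) = c1 at *
  generalize Complex.cosh (x j) = c2 at *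
  generalize Complex.sinh (x i) = s1 at *
  generalize Complex.sinh (x j) = s2 at *
  generalize F p q = F0 at *
  have hd : s2 ^ 2 - s1 ^ 2 = -(s1 ^ 2 - s2 ^ 2) := by ring
  rw [hd, div_neg, neg_div, neg_neg] at u2
  rw [neg_div] at w2
  have key : (s1 ^ 2 - s2 ^ 2) * (PQ + QP) = c1 * s1 * (Qi + Pi) - c2 * s2 * (Qj + Pj) -
      2 * s1 * c2 * (s * c2 * s1 / (s1 ^ 2 - s2 ^ 2) * (v * (v + 1) * F0)) := by
    linear_combination (-c1 * s2) * u1 - s1 * c2 * u2 + s2 * c1 * w1 + c2 * s1 * w2 +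
      ((PQ + QP) * s2 ^ 2 - c2 * s2 * (Qj + Pj)) * ci +
      (-(PQ + QP) * s1 ^ 2 + c1 * s1 * (Qi + Pi)) * cj
  rw [← mul_right_inj' hx, key]
  field_simp

/-- The contribution of `2 ε_i`, a computation in one copy of `𝔤𝔩₂`. With `H = aGen h i` and `J =
E_{i,m+i} - E_{m+i,i}` the symmetrized product equals `(H² - J²) / 2`. The derivative along `J` is
determined by the weight, and the first order term in `H` comes from commuting `J` with the diagonal
units. -/
lemma pairOp_diag (hF : IsSemiInvariantCoeff h wt N v F V S) (hφ : IsRightEquivariant a b φ)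
    (hs : ∀ p q, φ (kEmb p q * expA h x) = s * F p q) (i : Fin n)
    (hx : Complex.sinh (x i) ≠ 0) (hx' : Complex.cosh (x i) ≠ 0)
    (p : GL (Fin m) ℂ) (q : GL (Fin n) ℂ) :
    pairOp φ (Fin.castLE h i) i (kEmb p q * expA h x) =
      1 / 2 * leftInvDeriv (aGen h i) (leftInvDeriv (aGen h i) φ) (kEmb p q * expA h x) +
      (Complex.cosh (x i) ^ 2 + Complex.sinh (x i) ^ 2) /
        (2 * Complex.cosh (x i) * Complex.sinh (x i)) *
          leftInvDeriv (aGen h i) φ (kEmb p q * expA h x) -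
      (wt - a * Complex.cosh (x i) ^ 2 + b * Complex.sinh (x i) ^ 2) ^ 2 /
        (2 * Complex.cosh (x i) ^ 2 * Complex.sinh (x i) ^ 2) * (s * F p q) := by
  -- `J` is the compact generator orthogonal to `aGen`
  have hJ : adA h x (Matrix.single (pairIdx h i) (pairIdx h i) 1) =
      Complex.cosh (x i) ^ 2 • Matrix.single (pairIdx h i) (pairIdx h i) 1 -
      Complex.sinh (x i) ^ 2 • Matrix.single (Sum.inr i) (Sum.inr i) 1 +
      (Complex.cosh (x i) * Complex.sinh (x i)) •
        (Matrix.single (pairIdx h i) (Sum.inr i) 1 - Matrix.single (Sum.inr i) (pairIdx h i) 1) := by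
    rw [adA_single_inl]
    module
  have e : ∀ p q, leftInvDeriv (Matrix.single (pairIdx h i) (Sum.inr i) 1 -
      Matrix.single (Sum.inr i) (pairIdx h i) 1) φ (kEmb p q * expA h x) =
        s * (wt - a * Complex.cosh (x i) ^ 2 + b * Complex.sinh (x i) ^ 2) /
          (Complex.cosh (x i) * Complex.sinh (x i)) * F p q := by
    intro p q
    have t := leftInvDeriv_adA h x (hF.diag i) hs p q
    rw [fromBlocks_single_left, hJ, hφ.polynomial.leftInvDeriv_add_left,
      hφ.polynomial.leftInvDeriv_sub_left, hφ.polynomial.leftInvDeriv_smul_left,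
      hφ.polynomial.leftInvDeriv_smul_left, hφ.polynomial.leftInvDeriv_smul_left,
      hφ.leftInvDeriv_inl, hφ.leftInvDeriv_inr] at t
    simp only [Pi.smul_apply, smul_eq_mul, hs] at t
    rw [div_mul_eq_mul_div, eq_div_iff (mul_ne_zero hx' hx)]
    linear_combination t
  have hJφ := hφ.polynomial.leftInvDeriv (Matrix.single (pairIdx h i) (Sum.inr i) 1 -
      Matrix.single (Sum.inr i) (pairIdx h i) 1)
  have hPφ := hφ.polynomial.leftInvDeriv (Matrix.single (pairIdx h i) (Sum.inr i) 1)
  have hQφ := hφ.polynomial.leftInvDeriv (Matrix.single (Sum.inr i) (pairIdx h i) 1)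
  have hHφ := hφ.polynomial.leftInvDeriv (aGen h i)
  have u := leftInvDeriv_adA h x (hF.diag i) e p q
  rw [fromBlocks_single_left, hJ, hJφ.leftInvDeriv_add_left,
      hJφ.leftInvDeriv_sub_left, hJφ.leftInvDeriv_smul_left,
      hJφ.leftInvDeriv_smul_left, hJφ.leftInvDeriv_smul_left,
      hφ.leftInvDeriv_comm (hφ.leftInvDeriv_inl _),
      hφ.leftInvDeriv_comm (hφ.leftInvDeriv_inr _), e] at u
  have b1 : (Matrix.single (pairIdx h i) (pairIdx h i) 1 : Matrix (Fin m ⊕ Fin n) _ ℂ) *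
      (Matrix.single (pairIdx h i) (Sum.inr i) 1 - Matrix.single (Sum.inr i) (pairIdx h i) 1) -
      (Matrix.single (pairIdx h i) (Sum.inr i) 1 - Matrix.single (Sum.inr i) (pairIdx h i) 1) *
      Matrix.single (pairIdx h i) (pairIdx h i) 1 = aGen h i := by
    simp only [mul_sub, sub_mul, single_mul_single_one, if_true, reduceCtorEq, if_false, aGen]
    abel
  have b2 : (Matrix.single (Sum.inr i) (Sum.inr i) 1 : Matrix (Fin m ⊕ Fin n) _ ℂ) *
      (Matrix.single (pairIdx h i) (Sum.inr i) 1 - Matrix.single (Sum.inr i) (pairIdx h i) 1) -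
      (Matrix.single (pairIdx h i) (Sum.inr i) 1 - Matrix.single (Sum.inr i) (pairIdx h i) 1) *
      Matrix.single (Sum.inr i) (Sum.inr i) 1 = (-1 : ℂ) • aGen h i := by
    simp only [mul_sub, sub_mul, single_mul_single_one, if_true, reduceCtorEq, if_false, aGen]
    module
  rw [b1, b2, hφ.polynomial.leftInvDeriv_smul_left] at u
  have w : ∀ g, pairOp φ (Fin.castLE h i) i g =
      1 / 2 * leftInvDeriv (aGen h i) (leftInvDeriv (aGen h i) φ) g -
      1 / 2 * leftInvDeriv (Matrix.single (pairIdx h i) (Sum.inr i) 1 -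
        Matrix.single (Sum.inr i) (pairIdx h i) 1) (leftInvDeriv
        (Matrix.single (pairIdx h i) (Sum.inr i) 1 -
          Matrix.single (Sum.inr i) (pairIdx h i) 1) φ) g := by
    intro g
    have k1 : leftInvDeriv (aGen h i) φ = leftInvDeriv (Matrix.single (Sum.inr i) (pairIdx h i) 1) φ
        + leftInvDeriv (Matrix.single (pairIdx h i) (Sum.inr i) 1) φ := by
      ext g
      exact hφ.polynomial.leftInvDeriv_add_left _ _ g
    have k2 : leftInvDeriv (Matrix.single (pairIdx h i) (Sum.inr i) 1 -
        Matrix.single (Sum.inr i) (pairIdx h i) 1) φ =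
        leftInvDeriv (Matrix.single (pairIdx h i) (Sum.inr i) 1) φ +
          (-1 : ℂ) • leftInvDeriv (Matrix.single (Sum.inr i) (pairIdx h i) 1) φ := by
      ext g
      rw [hφ.polynomial.leftInvDeriv_sub_left]
      simp [sub_eq_add_neg]
    have k0 : leftInvDeriv (aGen h i) (leftInvDeriv (aGen h i) φ) g = _ :=
      hHφ.leftInvDeriv_add_left _ _ g
    rw [k0, hJφ.leftInvDeriv_sub_left, k1, k2, leftInvDeriv_add hQφ hPφ,
      leftInvDeriv_add hQφ hPφ, leftInvDeriv_add hPφ (hQφ.smul _),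
      leftInvDeriv_add hPφ (hQφ.smul _), leftInvDeriv_smul hQφ, leftInvDeriv_smul hQφ, pairOp]
    simp only [Pi.add_apply, Pi.smul_apply, smul_eq_mul]
    ring
  rw [w]
  simp only [Pi.smul_apply, smul_eq_mul] at u
  generalize leftInvDeriv (Matrix.single (pairIdx h i) (Sum.inr i) 1 -
        Matrix.single (Sum.inr i) (pairIdx h i) 1) (leftInvDeriv
        (Matrix.single (pairIdx h i) (Sum.inr i) 1 -
          Matrix.single (Sum.inr i) (pairIdx h i) 1) φ) (kEmb p q * expA h x) = JJ at *
  have hcs := mul_ne_zero hx' hx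
  have key : Complex.cosh (x i) * Complex.sinh (x i) * JJ = (wt - a * Complex.cosh (x i) ^ 2 +
      b * Complex.sinh (x i) ^ 2) * (s * (wt - a * Complex.cosh (x i) ^ 2 +
        b * Complex.sinh (x i) ^ 2) / (Complex.cosh (x i) * Complex.sinh (x i)) * F p q) -
        (Complex.cosh (x i) ^ 2 + Complex.sinh (x i) ^ 2) *
          leftInvDeriv (aGen h i) φ (kEmb p q * expA h x) := by
    linear_combination u
  have key' : JJ = (Complex.cosh (x i) * Complex.sinh (x i) * JJ) /
      (Complex.cosh (x i) * Complex.sinh (x i)) := by field_simp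
  rw [key', key]
  field_simp
  ring

end Radial

/-! ### Assembling the root contributions into the radial operator -/

section RadialSum

variable {m n : ℕ} {h : n ≤ m}

/-- This identifies the determinant met in `pairOp_pair`, up to sign, with the product of `sinh`
over the two roots `ε_i ± ε_j`. -/
lemma sinh_sq_sub_sinh_sq (x y : ℂ) :
    Complex.sinh x ^ 2 - Complex.sinh y ^ 2 = Complex.sinh (x - y) * Complex.sinh (x + y) := by
  rw [Complex.sinh_sub, Complex.sinh_add]
  have h1 := Complex.cosh_sq x
  have h2 := Complex.cosh_sq y
  linear_combination Complex.sinh y ^ 2 * h1 - Complex.sinh x ^ 2 * h2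

lemma eval_short (x : Fin n → ℂ) (i : Fin n) : (PosRoot.short i).eval x = x i := by
  simp [PosRoot.eval, PosRoot.vec]

lemma eval_long (x : Fin n → ℂ) (i : Fin n) : (PosRoot.long i).eval x = 2 * x i := by
  simp [PosRoot.eval, PosRoot.vec]

lemma eval_minus (x : Fin n → ℂ) {i j : Fin n} (hij : i < j) :
    (PosRoot.minus i j hij).eval x = x i - x j := by
  simp [PosRoot.eval, PosRoot.vec, sub_dotProduct]

lemma eval_plus (x : Fin n → ℂ) {i j : Fin n} (hij : i < j) :
    (PosRoot.plus i j hij).eval x = x i + x j := by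
  simp [PosRoot.eval, PosRoot.vec, add_dotProduct]

lemma sinh_ne_zero_of_regular {x : Fin n → ℂ} (hx : x ∈ regularSet n) (i : Fin n) :
    Complex.sinh (x i) ≠ 0 := by
  simpa [eval_short] using hx (.short i)

lemma cosh_ne_zero_of_regular {x : Fin n → ℂ} (hx : x ∈ regularSet n) (i : Fin n) :
    Complex.cosh (x i) ≠ 0 := by
  have := hx (.long i)
  rw [eval_long, Complex.sinh_two_mul] at this
  exact right_ne_zero_of_mul this

lemma sinh_sq_sub_ne_zero_of_regular {x : Fin n → ℂ} (hx : x ∈ regularSet n) {i j : Fin n}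
    (hij : i ≠ j) : Complex.sinh (x i) ^ 2 - Complex.sinh (x j) ^ 2 ≠ 0 := by
  have key : ∀ i j : Fin n, i < j → Complex.sinh (x i) ^ 2 - Complex.sinh (x j) ^ 2 ≠ 0 := by
    intro i j hij
    rw [sinh_sq_sub_sinh_sq]
    have h1 := hx (.minus i j hij)
    have h2 := hx (.plus i j hij)
    rw [eval_minus] at h1
    rw [eval_plus] at h2
    exact mul_ne_zero h1 h2
  rcases lt_or_gt_of_ne hij with hlt | hlt
  · exact key i j hlt
  · rw [← neg_ne_zero, neg_sub]
    exact key j i hlt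

lemma isOpen_regularSet (n : ℕ) : IsOpen (regularSet n) := by
  have : regularSet n = ⋂ α : PosRoot n, {x | Complex.sinh (α.eval x) ≠ 0} := by
    ext x; simp [regularSet]
  rw [this]
  refine isOpen_iInter_of_finite fun α => isOpen_ne_fun ?_ continuous_const
  unfold PosRoot.eval dotProduct
  fun_prop

/-- The coefficient of `∂_i` in the radial part of the Casimir operator. -/
def radCoeff (m n : ℕ) (i : Fin n) (x : Fin n → ℂ) : ℂ :=
  (Complex.cosh (x i) ^ 2 + Complex.sinh (x i) ^ 2) /
      (2 * Complex.cosh (x i) * Complex.sinh (x i)) +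
    ((m : ℂ) - n) * (Complex.cosh (x i) / Complex.sinh (x i)) +
    ∑ j, if i = j then 0 else 2 * (Complex.cosh (x i) * Complex.sinh (x i)) /
      (Complex.sinh (x i) ^ 2 - Complex.sinh (x j) ^ 2)

/-- The zeroth order coefficient of the radial part of the Casimir operator. -/
def radPotential (m n : ℕ) (a b wt N v : ℂ) (x : Fin n → ℂ) : ℂ :=
  m * a ^ 2 + n * b ^ 2 -
    (∑ i, ((wt - a * Complex.cosh (x i) ^ 2 + b * Complex.sinh (x i) ^ 2) ^ 2 /
        (2 * Complex.cosh (x i) ^ 2 * Complex.sinh (x i) ^ 2) +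
      ((m : ℂ) - n) * (N / Complex.sinh (x i) ^ 2))) -
    ∑ i, ∑ j, if i = j then 0 else
      2 * (v * (v + 1)) * Complex.sinh (x i) ^ 2 * Complex.cosh (x j) ^ 2 /
        (Complex.sinh (x i) ^ 2 - Complex.sinh (x j) ^ 2) ^ 2

lemma sum_castLE_add (h : n ≤ m) (f : Fin m → ℂ) {z : ℂ} (hf : ∀ l : Fin m, n ≤ l → f l = z) :
    ∑ l, f l = (∑ i : Fin n, f (Fin.castLE h i)) + ((m : ℂ) - n) * z := by
  obtain ⟨d, rfl⟩ := Nat.exists_eq_add_of_le h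
  rw [Fin.sum_univ_add]
  congr 1
  rw [Finset.sum_congr rfl fun i _ => hf (Fin.natAdd n i) (by simp)]
  simp

/-- Pure reordering of double sums. The terms `B i j * D i` and `B j i * D j` have the same total,
which produces the factor `2` in the first order coefficient. -/
lemma sum_pair_rearrange (B G : Fin n → Fin n → ℂ) (D D2 H P C Q : Fin n → ℂ) (z k w : ℂ) :
    z * w + ∑ j, (∑ i, ((if i = j then 1 / 2 * D2 i + H i * D i - P i * w else 0) +
        B i j * D i + B j i * D j - G i j * w) + k * (C j * D j - Q j * w)) =
      ∑ i, (1 / 2 * D2 i + (H i + k * C i + 2 * ∑ j, B i j) * D i) +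
        (z - ∑ i, (P i + k * Q i) - ∑ i, ∑ j, G i j) * w := by
  have e1 : ∑ j, ∑ i, B i j * D i = ∑ i, (∑ j, B i j) * D i := by
    rw [Finset.sum_comm]
    exact Finset.sum_congr rfl fun i _ => (Finset.sum_mul _ _ _).symm
  have e2 : ∑ j, ∑ i, B j i * D j = ∑ i, (∑ j, B i j) * D i :=
    Finset.sum_congr rfl fun i _ => (Finset.sum_mul _ _ _).symm
  have e3 : ∑ j, ∑ i, G i j * w = (∑ i, ∑ j, G i j) * w := by
    rw [Finset.sum_comm, Finset.sum_mul]
    exact Finset.sum_congr rfl fun i _ => (Finset.sum_mul _ _ _).symm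
  have e4 : ∑ j, (1 / 2 * D2 j + H j * D j - P j * w) + ∑ j, k * (C j * D j - Q j * w) +
      2 * ∑ i, (∑ j, B i j) * D i =
      ∑ i, (1 / 2 * D2 i + (H i + k * C i + 2 * ∑ j, B i j) * D i) -
        (∑ i, (P i + k * Q i)) * w := by
    rw [Finset.mul_sum, Finset.sum_mul, ← Finset.sum_add_distrib, ← Finset.sum_add_distrib,
      ← Finset.sum_sub_distrib]
    exact Finset.sum_congr rfl fun i _ => by ring
  have inner : ∀ j, ∑ i, ((if i = j then 1 / 2 * D2 i + H i * D i - P i * w else 0) +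
        B i j * D i + B j i * D j - G i j * w) = (1 / 2 * D2 j + H j * D j - P j * w) +
      ∑ i, B i j * D i + ∑ i, B j i * D j - ∑ i, G i j * w := by
    intro j
    rw [Finset.sum_sub_distrib, Finset.sum_add_distrib, Finset.sum_add_distrib,
      Finset.sum_ite_eq', if_pos (Finset.mem_univ _)]
  simp only [inner]
  rw [Finset.sum_add_distrib, Finset.sum_sub_distrib, Finset.sum_add_distrib,
    Finset.sum_add_distrib, e1, e2, e3]
  linear_combination e4

variable {a b : ℤ} {φ : GL (Fin m ⊕ Fin n) ℂ → ℂ}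
  {wt N v : ℂ} {F : GL (Fin m) ℂ → GL (Fin n) ℂ → ℂ}
  {V : Fin n → Fin n → GL (Fin m) ℂ → GL (Fin n) ℂ → ℂ}
  {S : Fin m → Fin n → GL (Fin m) ℂ → GL (Fin n) ℂ → ℂ} {x : Fin n → ℂ} {s : ℂ}

/-- For each column the rows paired with the second block give the medium and long roots, and the
remaining `m - n` rows give equal copies of the short root term. -/
lemma casimirOp_radial (hF : IsSemiInvariantCoeff h wt N v F V S)
    (hφ : IsRightEquivariant a b φ) (hx : x ∈ regularSet n)
    (hs : ∀ p q, φ (kEmb p q * expA h x) = s * F p q) (p : GL (Fin m) ℂ) (q : GL (Fin n) ℂ) :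
    casimirOp φ (kEmb p q * expA h x) =
      ∑ i, (1 / 2 * leftInvDeriv (aGen h i) (leftInvDeriv (aGen h i) φ) (kEmb p q * expA h x) +
        radCoeff m n i x * leftInvDeriv (aGen h i) φ (kEmb p q * expA h x)) +
      radPotential m n a b wt N v x * (s * F p q) := by
  set g := kEmb p q * expA h x with hg
  rw [hφ.casimirOp_eq, hs, Finset.sum_comm]
  have h1 : ∀ j : Fin n, ∑ l, pairOp φ l j g = ∑ i : Fin n, pairOp φ (Fin.castLE h i) j g +
      ((m : ℂ) - n) * (Complex.cosh (x j) / Complex.sinh (x j) * leftInvDeriv (aGen h j) φ g -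
        N / Complex.sinh (x j) ^ 2 * (s * F p q)) := fun j =>
    sum_castLE_add h _ fun l hl =>
      pairOp_short hF hφ hs hl j (sinh_ne_zero_of_regular hx j) p q
  have h2 : ∀ i j : Fin n, pairOp φ (Fin.castLE h i) j g =
      (if i = j then 1 / 2 * leftInvDeriv (aGen h i) (leftInvDeriv (aGen h i) φ) g +
      (Complex.cosh (x i) ^ 2 + Complex.sinh (x i) ^ 2) /
        (2 * Complex.cosh (x i) * Complex.sinh (x i)) * leftInvDeriv (aGen h i) φ g -
      (wt - a * Complex.cosh (x i) ^ 2 + b * Complex.sinh (x i) ^ 2) ^ 2 /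
        (2 * Complex.cosh (x i) ^ 2 * Complex.sinh (x i) ^ 2) * (s * F p q) else 0) +
      (if i = j then 0 else (Complex.cosh (x i) * Complex.sinh (x i)) /
        (Complex.sinh (x i) ^ 2 - Complex.sinh (x j) ^ 2)) * leftInvDeriv (aGen h i) φ g +
      (if j = i then 0 else (Complex.cosh (x j) * Complex.sinh (x j)) /
        (Complex.sinh (x j) ^ 2 - Complex.sinh (x i) ^ 2)) * leftInvDeriv (aGen h j) φ g -
      (if i = j then 0 else
        2 * (v * (v + 1)) * Complex.sinh (x i) ^ 2 * Complex.cosh (x j) ^ 2 /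
        (Complex.sinh (x i) ^ 2 - Complex.sinh (x j) ^ 2) ^ 2) * (s * F p q) := by
    intro i j
    rcases eq_or_ne i j with rfl | hij
    · simp only [if_true]
      rw [pairOp_diag hF hφ hs i (sinh_ne_zero_of_regular hx i) (cosh_ne_zero_of_regular hx i)]
      ring
    · simp only [if_neg hij, if_neg hij.symm]
      rw [pairOp_pair hF hφ hs hij (sinh_sq_sub_ne_zero_of_regular hx hij),
        ← neg_sub (Complex.sinh (x i) ^ 2) (Complex.sinh (x j) ^ 2), div_neg]
      ring
  simp only [h1, h2]
  -- Opaque names keep the conditional terms intact for `sum_pair_rearrange`.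
  obtain ⟨B, hB⟩ : ∃ B : Fin n → Fin n → ℂ, B = fun i j => if i = j then 0 else
    (Complex.cosh (x i) * Complex.sinh (x i)) /
      (Complex.sinh (x i) ^ 2 - Complex.sinh (x j) ^ 2) := ⟨_, rfl⟩
  obtain ⟨G, hG⟩ : ∃ G : Fin n → Fin n → ℂ, G = fun i j => if i = j then 0 else
      2 * (v * (v + 1)) * Complex.sinh (x i) ^ 2 * Complex.cosh (x j) ^ 2 /
        (Complex.sinh (x i) ^ 2 - Complex.sinh (x j) ^ 2) ^ 2 := ⟨_, rfl⟩
  have hB' : ∀ i, ∑ j, (if i = j then 0 else 2 * (Complex.cosh (x i) * Complex.sinh (x i)) /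
      (Complex.sinh (x i) ^ 2 - Complex.sinh (x j) ^ 2)) = 2 * ∑ j, B i j := by
    intro i
    rw [Finset.mul_sum, hB]
    refine Finset.sum_congr rfl fun j _ => ?_
    dsimp only
    split_ifs <;> ring
  have hB2 : ∀ i j, (if i = j then 0 else (Complex.cosh (x i) * Complex.sinh (x i)) /
      (Complex.sinh (x i) ^ 2 - Complex.sinh (x j) ^ 2)) = B i j := fun i j => by rw [hB]
  have hG2 : ∀ i j, (if i = j then 0 else
      2 * (v * (v + 1)) * Complex.sinh (x i) ^ 2 * Complex.cosh (x j) ^ 2 /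
        (Complex.sinh (x i) ^ 2 - Complex.sinh (x j) ^ 2) ^ 2) = G i j := fun i j => by rw [hG]
  simp only [radCoeff, radPotential, hB', hB2, hG2]
  exact sum_pair_rearrange B G _ _ _ _ _ _ _ _ _

/-! ### The radial part as a differential operator -/

lemma differentiableAt_radCoeff (m n : ℕ) (i : Fin n) {x : Fin n → ℂ} (hx : x ∈ regularSet n) :
    DifferentiableAt ℂ (radCoeff m n i) x := by
  have h0 := sinh_ne_zero_of_regular hx i
  have h1 := mul_ne_zero (mul_ne_zero two_ne_zero (cosh_ne_zero_of_regular hx i)) h0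
  unfold radCoeff
  refine DifferentiableAt.fun_add (DifferentiableAt.fun_add ?_ ?_)
    (DifferentiableAt.fun_sum fun j _ => ?_)
  · fun_prop (disch := assumption)
  · fun_prop (disch := assumption)
  · split_ifs with hij
    · exact differentiableAt_const _
    · have h2 := sinh_sq_sub_ne_zero_of_regular hx hij
      fun_prop (disch := assumption)

lemma differentiableOn_radCoeff (m n : ℕ) (i : Fin n) :
    DifferentiableOn ℂ (radCoeff m n i) (regularSet n) :=
  fun _ hx => (differentiableAt_radCoeff m n i hx).differentiableWithinAt

lemma differentiableOn_radPotential (m n : ℕ) (a b wt N v : ℂ) :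
    DifferentiableOn ℂ (radPotential m n a b wt N v) (regularSet n) := by
  intro x hx
  refine DifferentiableAt.differentiableWithinAt ?_
  unfold radPotential
  refine DifferentiableAt.fun_sub (DifferentiableAt.fun_sub (differentiableAt_const _)
    (DifferentiableAt.fun_sum fun i _ => DifferentiableAt.fun_add ?_ ?_))
    (DifferentiableAt.fun_sum fun i _ => DifferentiableAt.fun_sum fun j _ => ?_)
  · have h1 := mul_ne_zero (mul_ne_zero two_ne_zero (pow_ne_zero 2 (cosh_ne_zero_of_regular hx i)))
      (pow_ne_zero 2 (sinh_ne_zero_of_regular hx i))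
    fun_prop (disch := assumption)
  · have h0 := pow_ne_zero 2 (sinh_ne_zero_of_regular hx i)
    fun_prop (disch := assumption)
  · split_ifs with hij
    · exact differentiableAt_const _
    · have h2 := pow_ne_zero 2 (sinh_sq_sub_ne_zero_of_regular hx hij)
      fun_prop (disch := assumption)

/-- The second order differential operator `½ ∑ ∂_i² + ∑ radCoeff_i ∂_i + radPotential`. -/
def radialOp (m n : ℕ) (a b wt N v : ℂ) : DiffOp n where
  order := 2
  coeff k I := match k, I with
    | 0, _ => radPotential m n a b wt N v
    | 1, I => radCoeff m n (I 0)
    | 2, I => fun _ => if I 0 = I 1 then 1 / 2 else 0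
    | _ + 3, _ => fun _ => 0
  holomorphic k I := by
    match k, I with
    | 0, _ => exact differentiableOn_radPotential m n a b wt N v
    | 1, I => exact differentiableOn_radCoeff m n (I 0)
    | 2, I => exact differentiableOn_const _
    | _ + 3, _ => exact differentiableOn_const _

lemma radialOp_apply (m n : ℕ) (a b wt N v : ℂ) (ψ : (Fin n → ℂ) → ℂ) (x : Fin n → ℂ) :
    (radialOp m n a b wt N v).apply ψ x =
      ∑ i, (1 / 2 * iteratedFDeriv ℂ 2 ψ x (fun _ => Pi.single i 1) +
        radCoeff m n i x * fderiv ℂ ψ x (Pi.single i 1)) +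
      radPotential m n a b wt N v x * ψ x := by
  have e1 : ∑ I : Fin 1 → Fin n, (radialOp m n a b wt N v).coeff 1 I x *
      iteratedFDeriv ℂ 1 ψ x (fun j => Pi.single (I j) 1) =
      ∑ i, radCoeff m n i x * fderiv ℂ ψ x (Pi.single i 1) := by
    refine Fintype.sum_equiv (Equiv.funUnique (Fin 1) (Fin n)) _ _ fun I => ?_
    rw [iteratedFDeriv_one_apply]
    rfl
  have e2 : ∑ I : Fin 2 → Fin n, (radialOp m n a b wt N v).coeff 2 I x *
      iteratedFDeriv ℂ 2 ψ x (fun j => Pi.single (I j) 1) =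
      ∑ i, 1 / 2 * iteratedFDeriv ℂ 2 ψ x (fun _ => Pi.single i 1) := by
    have : ∑ I : Fin 2 → Fin n, (radialOp m n a b wt N v).coeff 2 I x *
      iteratedFDeriv ℂ 2 ψ x (fun j => Pi.single (I j) 1) = ∑ ij : Fin n × Fin n,
        (if ij.1 = ij.2 then 1 / 2 * iteratedFDeriv ℂ 2 ψ x (fun _ => Pi.single ij.1 1)
          else 0) := by
      refine Fintype.sum_equiv (finTwoArrowEquiv (Fin n)) _ _ fun I => ?_
      change (if I 0 = I 1 then (1 / 2 : ℂ) else 0) * _ = if I 0 = I 1 then _ else _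
      split_ifs with hI
      · congr 2
        ext j : 1
        fin_cases j
        · rfl
        · exact congrArg (fun i => (Pi.single i 1 : Fin n → ℂ)) hI.symm
      · rw [zero_mul]
    rw [this, Fintype.sum_prod_type]
    simp
  rw [DiffOp.apply, show (radialOp m n a b wt N v).order + 1 = 3 from rfl,
    Finset.sum_range_succ, Finset.sum_range_succ, Finset.sum_range_one, e1, e2,
    Finset.sum_add_distrib, Fintype.sum_unique, iteratedFDeriv_zero_apply]
  change radPotential m n a b wt N v x * ψ x + _ + _ = _
  ring

end RadialSum

/-! ### Restriction of polynomial functions to the torus -/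

section Restriction

variable {m n : ℕ} {h : n ≤ m}

lemma analyticAt_expA_apply (h : n ≤ m) (p q : Fin m ⊕ Fin n) (x : Fin n → ℂ) :
    AnalyticAt ℂ (fun y => (expA h y).val p q) x := by
  have hcoord : ∀ j : Fin n, AnalyticAt ℂ (fun y : Fin n → ℂ => y j) x := fun j =>
    (ContinuousLinearMap.proj (R := ℂ) (φ := fun _ : Fin n => ℂ) j).analyticAt x
  have hc : ∀ j : Fin n, AnalyticAt ℂ (fun y : Fin n → ℂ => Complex.cosh (y j)) x := fun j =>
    (Complex.differentiable_cosh.analyticAt _).comp (hcoord j)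
  have hs : ∀ j : Fin n, AnalyticAt ℂ (fun y : Fin n → ℂ => Complex.sinh (y j)) x := fun j =>
    (Complex.differentiable_sinh.analyticAt _).comp (hcoord j)
  have hl : ∀ l : Fin m, (∃ j : Fin n, l = Fin.castLE h j) ∨ n ≤ l := fun l => by
    rcases lt_or_ge (l : ℕ) n with hl | hl
    · exact Or.inl ⟨⟨l, hl⟩, rfl⟩
    · exact Or.inr hl
  have hite : ∀ (P : Prop) [Decidable P] (f : (Fin n → ℂ) → ℂ), AnalyticAt ℂ f x →
      AnalyticAt ℂ (fun y => if P then f y else 0) x := by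
    intro P _ f hf
    split_ifs
    · exact hf
    · exact analyticAt_const
  rcases q with q | q
  · rcases hl q with ⟨j, rfl⟩ | hq
    · rcases p with p | p
      · simp only [expA_apply_inl_inl]
        exact hite _ _ (hc j)
      · simp only [expA_apply_inr_inl]
        exact hite _ _ (hs j)
    · rcases p with p | p
      · simp only [expA_apply_inl_of_le h _ _ hq]
        exact analyticAt_const
      · have : ∀ y, (expA h y).val (Sum.inr p) (Sum.inl q) = 0 := by
          intro y
          have := congrFun (congrFun (expA_mul_single_of_le h y hq (Sum.inl q)) (Sum.inr p))
            (Sum.inl q)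
          simpa using this
        simp only [this]
        exact analyticAt_const
  · rcases p with p | p
    · simp only [expA_apply_inl_inr]
      exact hite _ _ (hs q)
    · simp only [expA_apply_inr_inr]
      exact hite _ _ (hc q)

lemma IsPolynomialFunction.analyticAt_expA {φ : GL (Fin m ⊕ Fin n) ℂ → ℂ}
    (hφ : IsPolynomialFunction φ) (h : n ≤ m) (x : Fin n → ℂ) :
    AnalyticAt ℂ (fun y => φ (expA h y)) x := by
  obtain ⟨p, k, hp⟩ := hφ.exists_evalMat
  have hev : ∀ p : MvPolynomial ((Fin m ⊕ Fin n) × (Fin m ⊕ Fin n)) ℂ,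
      AnalyticAt ℂ (fun y => evalMat (expA h y).val p) x := by
    intro p
    induction p using MvPolynomial.induction_on with
    | C c => simpa only [evalMat_C] using analyticAt_const
    | add p q hp hq =>
      simp only [evalMat_add]
      exact hp.add hq
    | mul_X p q hp =>
      have : ∀ A : Matrix (Fin m ⊕ Fin n) (Fin m ⊕ Fin n) ℂ,
        evalMat A (MvPolynomial.X q) = A q.1 q.2 := fun A => MvPolynomial.eval_X _
      simp only [evalMat_mul, this]
      exact hp.mul (analyticAt_expA_apply h q.1 q.2 x)
  have hdet := hev (detPoly _)
  simp only [evalMat_detPoly] at hdet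
  simp only [hp]
  refine (hev p).div (hdet.pow k) (pow_ne_zero _ ?_)
  exact (expA h x).isUnit.map Matrix.detMonoidHom |>.ne_zero

/-- `A` is commutative, so right multiplication by `e^{t aGen}` translates the `i`-th coordinate by
`t`. The constant `z` allows iteration at a fixed point of `K`. -/
lemma leftInvDeriv_aGen {φ : GL (Fin m ⊕ Fin n) ℂ → ℂ} {ψ : (Fin n → ℂ) → ℂ}
    {g : GL (Fin m ⊕ Fin n) ℂ} {z : ℂ} (hφ : ∀ y, φ (g * expA h y) = ψ y * z) {x : Fin n → ℂ}
    (hψ : DifferentiableAt ℂ ψ x) (i : Fin n) :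
    leftInvDeriv (aGen h i) φ (g * expA h x) = fderiv ℂ ψ x (Pi.single i 1) * z := by
  have h1 : (fun t : ℂ => φ (g * expA h x * expGL (t • aGen h i))) =
      fun t : ℂ => ψ (x + t • Pi.single i 1) * z := by
    ext t
    rw [← hφ, expA_add, mul_assoc, ← Pi.single_smul, smul_eq_mul, mul_one]
    congr 2
    rw [expA, expA, aMat_single]
  rw [leftInvDeriv, h1]
  have h2 : HasDerivAt (fun t : ℂ => x + t • (Pi.single i 1 : Fin n → ℂ)) (Pi.single i 1) 0 := by
    simpa using ((hasDerivAt_id (0 : ℂ)).smul_const (Pi.single i 1 : Fin n → ℂ)).const_add x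
  have h3 : HasFDerivAt ψ (fderiv ℂ ψ x) (x + (0 : ℂ) • (Pi.single i 1 : Fin n → ℂ)) := by
    simpa using hψ.hasFDerivAt
  exact ((h3.comp_hasDerivAt (0 : ℂ) h2).mul_const z).deriv

lemma iteratedFDeriv_two_eq {ψ : (Fin n → ℂ) → ℂ} {x : Fin n → ℂ} (hψ : AnalyticAt ℂ ψ x)
    (e : Fin n → ℂ) :
    iteratedFDeriv ℂ 2 ψ x (fun _ => e) = fderiv ℂ (fun y => fderiv ℂ ψ y e) x e := by
  rw [iteratedFDeriv_two_apply, fderiv_clm_apply hψ.fderiv.differentiableAt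
    (differentiableAt_const e)]
  simp

variable {a b : ℤ} {φ : GL (Fin m ⊕ Fin n) ℂ → ℂ}
  {wt N v : ℂ} {F : GL (Fin m) ℂ → GL (Fin n) ℂ → ℂ}
  {V : Fin n → Fin n → GL (Fin m) ℂ → GL (Fin n) ℂ → ℂ}
  {S : Fin m → Fin n → GL (Fin m) ℂ → GL (Fin n) ℂ → ℂ}

theorem casimirOp_eq_radialOp_apply (hF : IsSemiInvariantCoeff h wt N v F V S)
    (hφ : IsRightEquivariant a b φ) {ψ : (Fin n → ℂ) → ℂ} (hψ : ∀ y, AnalyticAt ℂ ψ y)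
    (hs : ∀ y p q, φ (kEmb p q * expA h y) = ψ y * F p q) {x : Fin n → ℂ}
    (hx : x ∈ regularSet n) (p : GL (Fin m) ℂ) (q : GL (Fin n) ℂ) :
    casimirOp φ (kEmb p q * expA h x) =
      (radialOp m n a b wt N v).apply ψ x * F p q := by
  have d1 : ∀ y i, leftInvDeriv (aGen h i) φ (kEmb p q * expA h y) =
      fderiv ℂ ψ y (Pi.single i 1) * F p q := fun y i =>
    leftInvDeriv_aGen (fun y => hs y p q) (hψ y).differentiableAt i
  have d2 : ∀ i, leftInvDeriv (aGen h i) (leftInvDeriv (aGen h i) φ) (kEmb p q * expA h x) =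
      iteratedFDeriv ℂ 2 ψ x (fun _ => Pi.single i 1) * F p q := by
    intro i
    rw [iteratedFDeriv_two_eq (hψ x)]
    refine leftInvDeriv_aGen (fun y => d1 y i) ?_ i
    exact (hψ x).fderiv.differentiableAt.clm_apply (differentiableAt_const _)
  rw [casimirOp_radial hF hφ hx (hs x) p q, radialOp_apply, add_mul, Finset.sum_mul]
  simp only [d1, d2]
  congr 1
  · exact Finset.sum_congr rfl fun i _ => by ring
  · ring

end Restriction

/-! ### The matrix coefficients of the semi-invariant vector -/

section Coefficients

/-- The matrix unit has square zero, so the series stops after the linear term. -/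
lemma exp_smul_single {ι : Type*} [Fintype ι] [DecidableEq ι] {i j : ι} (hij : i ≠ j) (t : ℂ) :
    NormedSpace.exp (t • Matrix.single i j (1 : ℂ)) = Matrix.transvection i j t := by
  have hsq : (t • Matrix.single i j (1 : ℂ)) ^ 2 = 0 := by
    rw [sq, Matrix.smul_mul, Matrix.mul_smul, single_mul_single_one, if_neg hij.symm, smul_zero,
      smul_zero]
  rw [NormedSpace.exp_eq_tsum ℂ]
  have : ∀ k ∉ Finset.range 2, ((k.factorial : ℂ)⁻¹) • (t • Matrix.single i j (1 : ℂ)) ^ k = 0 := by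
    intro k hk
    obtain ⟨d, rfl⟩ := Nat.exists_eq_add_of_le (not_lt.1 (Finset.mem_range.not.1 hk))
    rw [pow_add, hsq, zero_mul, smul_zero]
  dsimp only
  rw [tsum_eq_sum this, Finset.sum_range_succ, Finset.sum_range_one]
  simp [Matrix.transvection, Matrix.smul_single]

lemma exp_mul_rect {r k : ℕ} {Y : Matrix (Fin r) (Fin r) ℂ} {Y' : Matrix (Fin k) (Fin k) ℂ}
    {B : Matrix (Fin r) (Fin k) ℂ} (hY : Y * B = B * Y') :
    NormedSpace.exp Y * B = B * NormedSpace.exp Y' := by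
  open scoped Norms.Operator in
  have h1 := (NormedSpace.exp_series_hasSum_exp' (𝕂 := ℂ) Y).map
    (⟨⟨fun M => M * B, Matrix.zero_mul B⟩, fun M M' => Matrix.add_mul M M' B⟩ :
      Matrix (Fin r) (Fin r) ℂ →+ Matrix (Fin r) (Fin k) ℂ)
    (continuous_id.matrix_mul continuous_const)
  have h2 := (NormedSpace.exp_series_hasSum_exp' (𝕂 := ℂ) Y').map
    (⟨⟨fun M => B * M, Matrix.mul_zero B⟩, fun M M' => Matrix.mul_add B M M'⟩ :
      Matrix (Fin k) (Fin k) ℂ →+ Matrix (Fin r) (Fin k) ℂ)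
    (continuous_const.matrix_mul continuous_id)
  have hpow : ∀ d : ℕ, Y ^ d * B = B * Y' ^ d := by
    intro d
    induction d with
    | zero => simp
    | succ d ih => rw [pow_succ', Matrix.mul_assoc, ih, ← Matrix.mul_assoc, hY, Matrix.mul_assoc,
        pow_succ']
  refine h1.unique (HasSum.congr_fun h2 fun d => ?_)
  change ((d.factorial : ℂ)⁻¹ • Y ^ d) * B = B * ((d.factorial : ℂ)⁻¹ • Y' ^ d)
  rw [Matrix.smul_mul, Matrix.mul_smul, hpow]

variable {m n : ℕ} (h : n ≤ m)

/-- The determinant of the first `n` rows. -/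
def topDet (X : Matrix (Fin m) (Fin n) ℂ) : ℂ := (X.submatrix (Fin.castLE h) id).det

/-- The matrix of the standard embedding `ℂⁿ → ℂᵐ`. -/
def incl : Matrix (Fin m) (Fin n) ℂ := Matrix.of fun i j => if i = Fin.castLE h j then 1 else 0

lemma topDet_mul (X : Matrix (Fin m) (Fin n) ℂ) (Y : Matrix (Fin n) (Fin n) ℂ) :
    topDet h (X * Y) = topDet h X * Y.det := by
  rw [topDet, topDet, ← Matrix.det_mul]
  congr 1

lemma mul_incl (p : Matrix (Fin m) (Fin m) ℂ) : p * incl h = p.submatrix id (Fin.castLE h) := by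
  ext i j
  simp [Matrix.mul_apply, incl]

lemma single_mul_incl_of_le {i l : Fin m} (hl : n ≤ l) :
    Matrix.single i l (1 : ℂ) * incl h = 0 := by
  rw [mul_incl]
  ext p q
  simp [(pairIdx_ne_of_le h hl q).symm]

lemma single_mul_incl (i j : Fin n) :
    Matrix.single (Fin.castLE h i) (Fin.castLE h j) (1 : ℂ) * incl h =
      incl h * Matrix.single i j (1 : ℂ) := by
  rw [mul_incl]
  ext p q
  by_cases hq : j = q
  · subst hq
    simp [Matrix.single_apply, incl, eq_comm]
  · simp [hq, (castLE_injective' h).eq_iff,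
      Matrix.mul_single_apply_of_ne _ _ _ _ _ (Ne.symm hq)]

/-- The first row, as a function on the column indices. -/
def firstRow (q : Matrix (Fin n) (Fin n) ℂ) : Fin n → ℂ := fun i => q ⟨0, i.pos⟩ i

/-- The matrix coefficients of the semi-invariant vector of `U`. -/
def coeffFun (a e : ℤ) (N v : ℕ) (p : GL (Fin m) ℂ) (q : GL (Fin n) ℂ) : ℂ :=
  p.val.det ^ a * topDet h (p.val * incl h) ^ N *
    (q.val.det ^ e * ∏ i, firstRow q.val i ^ v)

/-- The derivative of `coeffFun` along `E_ij ∈ 𝔤𝔩_n`. -/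
def coeffFunV (a e : ℤ) (N v : ℕ) (i j : Fin n) (p : GL (Fin m) ℂ) (q : GL (Fin n) ℂ) : ℂ :=
  p.val.det ^ a * topDet h (p.val * incl h) ^ N *
    (q.val.det ^ e * (v * firstRow q.val i ^ (v + 1) * firstRow q.val j ^ (v - 1) *
      ∏ l ∈ (Finset.univ.erase i).erase j, firstRow q.val l ^ v))

/-- The derivative of `coeffFun` along `E_lj ∈ 𝔤𝔩_m`, where `l ≥ n`. -/
def coeffFunS (a e : ℤ) (N v : ℕ) (l : Fin m) (j : Fin n) (p : GL (Fin m) ℂ)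
    (q : GL (Fin n) ℂ) : ℂ :=
  p.val.det ^ a * (N * topDet h (p.val * incl h) ^ (N - 1) *
    topDet h ((p.val * incl h).updateCol j fun i => p.val i l)) *
    (q.val.det ^ e * ∏ i, firstRow q.val i ^ v)

variable {h}

lemma hasDerivAt_topDet_exp {Y : Matrix (Fin m) (Fin m) ℂ} {Y' : Matrix (Fin n) (Fin n) ℂ}
    (hY : Y * incl h = incl h * Y') (p : Matrix (Fin m) (Fin m) ℂ) :
    HasDerivAt (fun t : ℂ => topDet h (p * NormedSpace.exp (t • Y) * incl h))
      (topDet h (p * incl h) * Y'.trace) 0 := by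
  have : ∀ t : ℂ, topDet h (p * NormedSpace.exp (t • Y) * incl h) =
      topDet h (p * incl h) * (NormedSpace.exp (t • Y')).det := by
    intro t
    rw [Matrix.mul_assoc, exp_mul_rect (Y := t • Y) (Y' := t • Y')
      (by rw [Matrix.smul_mul, Matrix.mul_smul, hY]), ← Matrix.mul_assoc, topDet_mul]
  simp only [this]
  exact (hasDerivAt_det_exp Y').const_mul _

/-- The transvection adds `t` times column `l` to column `j`; the determinant is linear in that
column. -/
lemma mul_transvection_incl {l : Fin m} {j : Fin n} (p : Matrix (Fin m) (Fin m) ℂ) (t : ℂ) :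
    topDet h (p * Matrix.transvection l (Fin.castLE h j) t * incl h) =
      topDet h (p * incl h) +
        t * topDet h ((p * incl h).updateCol j fun i => p i l) := by
  have e : (p * Matrix.transvection l (Fin.castLE h j) t * incl h).submatrix (Fin.castLE h) id =
      ((p * incl h).submatrix (Fin.castLE h) id).updateCol j
        ((fun i => (p * incl h) (Fin.castLE h i) j) + t • fun i => p (Fin.castLE h i) l) := by
    ext i k
    rw [mul_incl, mul_incl]
    by_cases hk : k = j
    · subst hk
      simp [Matrix.mul_transvection_apply_same]
    · have : Fin.castLE h k ≠ Fin.castLE h j := fun e => hk (castLE_injective' h e)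
      simp [hk, Matrix.mul_transvection_apply_of_ne _ _ _ _ this]
  have e2 : ∀ w : Fin m → ℂ, ((p * incl h).updateCol j w).submatrix (Fin.castLE h) id =
      ((p * incl h).submatrix (Fin.castLE h) id).updateCol j fun i => w (Fin.castLE h i) := by
    intro w
    ext i k
    by_cases hk : k = j
    · subst hk; simp
    · simp [hk]
  rw [topDet, e, Matrix.det_updateCol_add, Matrix.det_updateCol_smul, topDet, topDet, e2]
  congr 2
  exact Matrix.updateCol_eq_self _ _

lemma firstRow_mul_transvection {i j : Fin n} (q : Matrix (Fin n) (Fin n) ℂ) (t : ℂ) (l : Fin n) :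
    firstRow (q * Matrix.transvection i j t) l =
      firstRow q l + if l = j then t * firstRow q i else 0 := by
  split_ifs with hl
  · subst hl
    simp [firstRow, Matrix.mul_transvection_apply_same]
  · simp [firstRow, Matrix.mul_transvection_apply_of_ne _ _ _ _ hl]

lemma prod_firstRow {i j : Fin n} (hij : i ≠ j) (f : Fin n → ℂ) :
    ∏ l, f l = f i * f j * ∏ l ∈ (Finset.univ.erase i).erase j, f l := by
  rw [← Finset.mul_prod_erase Finset.univ f (Finset.mem_univ i),
    ← Finset.mul_prod_erase (Finset.univ.erase i) f (by simpa using hij.symm), mul_assoc]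

/-- On the first row `r` of `q`, the unit `E_ij` acts as `r_i ∂/∂r_j`, so two steps on `∏ r_i^v`
give `v (v + 1)`. On the minor power, traceless units within the first `n` indices act by zero and a
diagonal one adds `N` to the weight; `E_lj` with `l ≥ n` exchanges a column of one minor factor, and
`E_jl` restores it with total factor `N`. -/
theorem isSemiInvariantCoeff_coeffFun (h : n ≤ m) (a e : ℤ) (N v : ℕ) :
    IsSemiInvariantCoeff h (a + N) N v (coeffFun h a e N v) (coeffFunV h a e N v)
      (coeffFunS h a e N v) := by
  have hne : ∀ {i j : Fin n}, i ≠ j → Fin.castLE h i ≠ Fin.castLE h j :=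
    fun hij e => hij (castLE_injective' h e)
  have top_pair : ∀ {i j : Fin n}, i ≠ j → ∀ (p : Matrix (Fin m) (Fin m) ℂ) (t : ℂ),
      topDet h (p * Matrix.transvection (Fin.castLE h i) (Fin.castLE h j) t * incl h) =
        topDet h (p * incl h) := by
    intro i j hij p t
    rw [← exp_smul_single (hne hij), Matrix.mul_assoc, exp_mul_rect
      (Y' := t • Matrix.single i j (1 : ℂ))
      (by rw [Matrix.smul_mul, Matrix.mul_smul, single_mul_incl]), ← Matrix.mul_assoc, topDet_mul,
      exp_smul_single hij, Matrix.det_transvection_of_ne _ _ hij, mul_one]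
  have top_short : ∀ {l : Fin m} {j : Fin n}, n ≤ l → ∀ (p : Matrix (Fin m) (Fin m) ℂ) (t : ℂ),
      p * Matrix.transvection (Fin.castLE h j) l t * incl h = p * incl h := by
    intro l j hl p t
    rw [Matrix.transvection, Matrix.mul_add, Matrix.mul_one, Matrix.add_mul, Matrix.mul_assoc p,
      ← mul_one t, ← smul_eq_mul, ← Matrix.smul_single, Matrix.smul_mul,
      single_mul_incl_of_le h hl, smul_zero, Matrix.mul_zero, add_zero]
  constructor
  · intro i j hij p q
    simp only [coeffFun, Units.val_mul, coe_expGL, smul_zero, NormedSpace.exp_zero, mul_one,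
      exp_smul_single (hne hij), Matrix.det_mul, Matrix.det_transvection_of_ne _ _ (hne hij),
      top_pair hij, Pi.zero_apply]
    exact hasDerivAt_const _ _
  · intro i j hij p q
    simp only [coeffFunV, Units.val_mul, coe_expGL, smul_zero, NormedSpace.exp_zero, mul_one,
      exp_smul_single (hne hij), Matrix.det_mul, Matrix.det_transvection_of_ne _ _ (hne hij),
      top_pair hij, Pi.zero_apply]
    exact hasDerivAt_const _ _
  · intro i j hij p q
    simp only [coeffFun, Units.val_mul, coe_expGL, smul_zero, NormedSpace.exp_zero, mul_one,
      exp_smul_single hij, Matrix.det_mul, Matrix.det_transvection_of_ne _ _ hij,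
      prod_firstRow hij, firstRow_mul_transvection, if_neg hij, if_true, add_zero, coeffFunV]
    refine HasDerivAt.const_mul _ (HasDerivAt.const_mul _ ?_)
    have e1 : ∀ t : ℂ, ∏ l ∈ (Finset.univ.erase i).erase j,
        (firstRow q.val l + if l = j then t * firstRow q.val i else 0) ^ v =
        ∏ l ∈ (Finset.univ.erase i).erase j, firstRow q.val l ^ v := fun t =>
      Finset.prod_congr rfl fun l hl => by
        rw [if_neg (Finset.ne_of_mem_erase hl), add_zero]
    simp only [e1]
    have d := ((((hasDerivAt_id (0 : ℂ)).mul_const (firstRow q.val i)).const_add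
      (firstRow q.val j)).fun_pow v).const_mul (firstRow q.val i ^ v) |>.mul_const
      (∏ l ∈ (Finset.univ.erase i).erase j, firstRow q.val l ^ v)
    refine d.congr_deriv ?_
    simp only [id, zero_mul, add_zero]
    ring
  · intro i j hij p q
    simp only [coeffFunV, Units.val_mul, coe_expGL, smul_zero, NormedSpace.exp_zero, mul_one,
      exp_smul_single hij, Matrix.det_mul, Matrix.det_transvection_of_ne _ _ hij,
      firstRow_mul_transvection, if_neg hij, if_true, add_zero, coeffFun, Pi.smul_apply,
      smul_eq_mul]
    have e1 : ∀ t : ℂ, ∏ l ∈ (Finset.univ.erase j).erase i,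
        (firstRow q.val l + if l = j then t * firstRow q.val i else 0) ^ v =
        ∏ l ∈ (Finset.univ.erase j).erase i, firstRow q.val l ^ v := fun t =>
      Finset.prod_congr rfl fun l hl => by
        rw [if_neg (Finset.ne_of_mem_erase (Finset.mem_of_mem_erase hl)), add_zero]
    simp only [e1]
    have d := (((((((hasDerivAt_id (0 : ℂ)).mul_const (firstRow q.val i)).const_add
      (firstRow q.val j)).fun_pow (v + 1)).const_mul (v : ℂ)).mul_const
      (firstRow q.val i ^ (v - 1))).mul_const
      (∏ l ∈ (Finset.univ.erase j).erase i, firstRow q.val l ^ v)).const_mul (q.val.det ^ e)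
      |>.const_mul (p.val.det ^ a * topDet h (p.val * incl h) ^ N)
    refine d.congr_deriv ?_
    rw [prod_firstRow hij.symm]
    -- For `v = 0` the exponent `v - 1` is truncated, but the prefactor `v` vanishes.
    rcases v with _ | v
    · simp
    · simp only [id, zero_mul, add_zero, Nat.add_sub_cancel, Nat.cast_add, Nat.cast_one]
      ring
  · intro i p q
    have d1 := hasDerivAt_topDet_exp (single_mul_incl h i i) p.val
    have d2 := hasDerivAt_det_exp (Matrix.single (Fin.castLE h i) (Fin.castLE h i) (1 : ℂ))
    have d3 := (hasDerivAt_zpow a (NormedSpace.exp ((0 : ℂ) •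
      Matrix.single (Fin.castLE h i) (Fin.castLE h i) (1 : ℂ))).det (Or.inl (by simp))).comp
      (0 : ℂ) d2
    simp only [coeffFun, Units.val_mul, coe_expGL, smul_zero, NormedSpace.exp_zero, mul_one,
      Matrix.det_mul, mul_zpow, Pi.smul_apply, smul_eq_mul]
    refine (((d3.const_mul (p.val.det ^ a)).mul (d1.fun_pow N)).mul_const
      (q.val.det ^ e * ∏ i, firstRow q.val i ^ v)).congr_deriv ?_
    simp only [zero_smul, NormedSpace.exp_zero, Matrix.det_one, _root_.one_zpow,
      Matrix.trace_single_eq_same, Function.comp_apply, mul_one]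
    rcases N with _ | N
    · simp
      ring
    · simp only [Nat.add_sub_cancel]
      ring
  · intro l j hl p q
    have hjl : Fin.castLE h j ≠ l := pairIdx_ne_of_le h hl j
    simp only [coeffFun, Units.val_mul, coe_expGL, smul_zero, NormedSpace.exp_zero, mul_one,
      exp_smul_single hjl, Matrix.det_mul, Matrix.det_transvection_of_ne _ _ hjl,
      top_short hl, Pi.zero_apply]
    exact hasDerivAt_const _ _
  · intro l j hl p q
    have hjl : l ≠ Fin.castLE h j := (pairIdx_ne_of_le h hl j).symm
    simp only [coeffFun, Units.val_mul, coe_expGL, smul_zero, NormedSpace.exp_zero, mul_one,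
      exp_smul_single hjl, Matrix.det_mul, Matrix.det_transvection_of_ne _ _ hjl,
      mul_transvection_incl, coeffFunS]
    have d := ((((hasDerivAt_id (0 : ℂ)).mul_const (topDet h ((p.val * incl h).updateCol j
      fun i => p.val i l))).const_add (topDet h (p.val * incl h))).fun_pow N).const_mul
      (p.val.det ^ a) |>.mul_const (q.val.det ^ e * ∏ i, firstRow q.val i ^ v)
    refine d.congr_deriv ?_
    simp only [id, zero_mul, add_zero]
    ring
  · intro l j hl p q
    have hjl : Fin.castLE h j ≠ l := pairIdx_ne_of_le h hl j
    simp only [coeffFun, Units.val_mul, coe_expGL, smul_zero, NormedSpace.exp_zero, mul_one,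
      exp_smul_single hjl, Matrix.det_mul, Matrix.det_transvection_of_ne _ _ hjl,
      top_short hl, coeffFunS, Pi.smul_apply, smul_eq_mul]
    have e1 : ∀ t : ℂ, topDet h ((p.val * incl h).updateCol j fun i =>
        (p.val * Matrix.transvection (Fin.castLE h j) l t) i l) =
        topDet h ((p.val * incl h).updateCol j fun i => p.val i l) +
          t * topDet h (p.val * incl h) := by
      intro t
      have e2 : ∀ w : Fin m → ℂ, ((p.val * incl h).updateCol j w).submatrix (Fin.castLE h) id =
          ((p.val * incl h).submatrix (Fin.castLE h) id).updateCol j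
            fun i => w (Fin.castLE h i) := by
        intro w
        ext i k
        by_cases hk : k = j
        · subst hk; simp
        · simp [hk]
      rw [topDet, e2, topDet, e2, topDet]
      have e3 : (fun i => (p.val * Matrix.transvection (Fin.castLE h j) l t) (Fin.castLE h i) l) =
          (fun i => p.val (Fin.castLE h i) l) + t • fun i =>
            (p.val * incl h).submatrix (Fin.castLE h) id i j := by
        ext i
        rw [mul_incl]
        simp [Matrix.mul_transvection_apply_same]
      rw [e3, Matrix.det_updateCol_add, Matrix.det_updateCol_smul]
      congr 3
      exact Matrix.updateCol_eq_self _ _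
    simp only [e1]
    have d := ((((hasDerivAt_id (0 : ℂ)).mul_const (topDet h (p.val * incl h))).const_add
      (topDet h ((p.val * incl h).updateCol j fun i => p.val i l))).const_mul
      (N * topDet h (p.val * incl h) ^ (N - 1))).const_mul
      (p.val.det ^ a) |>.mul_const (q.val.det ^ e * ∏ i, firstRow q.val i ^ v)
    refine d.congr_deriv ?_
    -- For `N = 0` the truncated exponent `N - 1` is harmless because of the prefactor `N`.
    rcases N with _ | N
    · simp
    · simp only [Nat.add_sub_cancel]
      ring

end Coefficients

/-! ### The big cell and highest weight vectors -/

section BigCell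

/-- Upper unitriangular matrices, without the invertibility being bundled. -/
def IsUpperUni {r : ℕ} (U : Matrix (Fin r) (Fin r) ℂ) : Prop :=
  (∀ i, U i i = 1) ∧ ∀ i j, j < i → U i j = 0

lemma IsUpperUni.det {r : ℕ} {U : Matrix (Fin r) (Fin r) ℂ} (hU : IsUpperUni U) : U.det = 1 := by
  rw [Matrix.det_of_isUpperTriangular (fun i j hij => hU.2 i j hij)]
  exact Finset.prod_eq_one fun i _ => hU.1 i

lemma IsUpperUni.det_transpose {r : ℕ} {L : Matrix (Fin r) (Fin r) ℂ} (hL : IsUpperUni Lᵀ) :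
    L.det = 1 := by
  rw [← Matrix.det_transpose, hL.det]

/-- The matrix with given first row, first column and lower right block. -/
def borderMat {r : ℕ} (x : ℂ) (y z : Fin r → ℂ) (A : Matrix (Fin r) (Fin r) ℂ) :
    Matrix (Fin (r + 1)) (Fin (r + 1)) ℂ :=
  Matrix.of (Fin.cons (Fin.cons x y) fun i => Fin.cons (z i) (A i))

@[simp] lemma borderMat_zero_zero {r : ℕ} (x : ℂ) (y z : Fin r → ℂ) (A : Matrix _ _ ℂ) :
    borderMat x y z A 0 0 = x := rfl

@[simp] lemma borderMat_zero_succ {r : ℕ} (x : ℂ) (y z : Fin r → ℂ) (A : Matrix _ _ ℂ)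
    (j : Fin r) : borderMat x y z A 0 j.succ = y j := rfl

@[simp] lemma borderMat_succ_zero {r : ℕ} (x : ℂ) (y z : Fin r → ℂ) (A : Matrix _ _ ℂ)
    (i : Fin r) : borderMat x y z A i.succ 0 = z i := rfl

@[simp] lemma borderMat_succ_succ {r : ℕ} (x : ℂ) (y z : Fin r → ℂ) (A : Matrix _ _ ℂ)
    (i j : Fin r) : borderMat x y z A i.succ j.succ = A i j := rfl

lemma borderMat_mul {r : ℕ} (x x' : ℂ) (y z y' z' : Fin r → ℂ) (A A' : Matrix (Fin r) (Fin r) ℂ) :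
    borderMat x y z A * borderMat x' y' z' A' =
      borderMat (x * x' + y ⬝ᵥ z') (x • y' + y ᵥ* A') (x' • z + A *ᵥ z')
        (Matrix.vecMulVec z y' + A * A') := by
  ext i j
  refine Fin.cases ?_ (fun i => ?_) i <;> refine Fin.cases ?_ (fun j => ?_) j <;>
    simp [Matrix.mul_apply, Fin.sum_univ_succ, dotProduct, Matrix.vecMul, Matrix.mulVec,
      Matrix.vecMulVec_apply, mul_comm]

lemma diagonal_cons {r : ℕ} (x : ℂ) (d : Fin r → ℂ) :
    Matrix.diagonal (Fin.cons x d : Fin (r + 1) → ℂ) = borderMat x 0 0 (Matrix.diagonal d) := by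
  ext i j
  refine Fin.cases ?_ (fun i => ?_) i <;> refine Fin.cases ?_ (fun j => ?_) j <;>
    simp [Matrix.diagonal_apply, Fin.succ_ne_zero, (Fin.succ_ne_zero _).symm]

lemma IsUpperUni.border {r : ℕ} {U : Matrix (Fin r) (Fin r) ℂ} (hU : IsUpperUni U)
    (y : Fin r → ℂ) : IsUpperUni (borderMat 1 y 0 U) := by
  constructor
  · intro i
    refine Fin.cases ?_ (fun i => ?_) i
    · simp
    · simp [hU.1]
  · intro i j
    refine Fin.cases ?_ (fun i => ?_) i
    · intro hj
      exact absurd hj (Fin.not_lt_zero j)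
    · refine Fin.cases ?_ (fun j => ?_) j
      · simp
      · intro hij
        simp [hU.2 i j (Fin.succ_lt_succ_iff.1 hij)]

lemma transpose_borderMat {r : ℕ} (x : ℂ) (y z : Fin r → ℂ) (A : Matrix (Fin r) (Fin r) ℂ) :
    (borderMat x y z A)ᵀ = borderMat x z y Aᵀ := by
  ext i j
  refine Fin.cases ?_ (fun i => ?_) i <;> refine Fin.cases ?_ (fun j => ?_) j <;> simp

/-- A continuous function which vanishes on the big cell vanishes. -/
theorem eq_zero_of_bigCell : ∀ {r : ℕ} {f : Matrix (Fin r) (Fin r) ℂ → ℂ}, Continuous f →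
    (∀ (L U : Matrix (Fin r) (Fin r) ℂ) (d : Fin r → ℂ), IsUpperUni Lᵀ → IsUpperUni U →
      (∀ i, d i ≠ 0) → f (L * Matrix.diagonal d * U) = 0) → ∀ A, f A = 0
  | 0, f, _, hf, A => by
    have := hf 1 1 0 ⟨fun i => i.elim0, fun i => i.elim0⟩ ⟨fun i => i.elim0, fun i => i.elim0⟩
      fun i => i.elim0
    rwa [Subsingleton.elim (1 * Matrix.diagonal 0 * 1) A] at this
  | r + 1, f, hc, hf, A => by
    have hborder : ∀ {X : Type} [TopologicalSpace X] {x : X → ℂ} {y z : X → Fin r → ℂ}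
        {B : X → Matrix (Fin r) (Fin r) ℂ}, Continuous x → Continuous y → Continuous z →
        Continuous B → Continuous fun t => borderMat (x t) (y t) (z t) (B t) := by
      intro X _ x y z B hx hy hz hB
      refine continuous_matrix fun i j => ?_
      refine Fin.cases ?_ (fun i => ?_) i <;> refine Fin.cases ?_ (fun j => ?_) j
      · simpa using hx
      · exact (continuous_apply j).comp hy
      · exact (continuous_apply i).comp hz
      · simpa using hB.matrix_elem i j
    have h1 : ∀ (x : ℂ) (y z : Fin r → ℂ) (B : Matrix (Fin r) (Fin r) ℂ), x ≠ 0 →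
        f (borderMat x y z B) = 0 := by
      intro x y z B hx
      -- Induction on the Schur complement `B - x⁻¹ z y`: a triangular factorization of it borders
      -- to one of the whole matrix when the corner `x` is not zero.
      have := eq_zero_of_bigCell (f := fun A' => f (borderMat x y z (A' + x⁻¹ • Matrix.vecMulVec z y)))
        (hc.comp (hborder continuous_const continuous_const continuous_const
          (continuous_id.add continuous_const))) ?_ (B - x⁻¹ • Matrix.vecMulVec z y)
      · simpa using this
      · intro L U d hL hU hd
        have key : borderMat x y z (L * Matrix.diagonal d * U + x⁻¹ • Matrix.vecMulVec z y) =
            borderMat 1 0 (x⁻¹ • z) L * Matrix.diagonal (Fin.cons x d : Fin (r + 1) → ℂ) *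
              borderMat 1 (x⁻¹ • y) 0 U := by
          rw [diagonal_cons, borderMat_mul, borderMat_mul]
          congr 1
          · simp
          · simp [smul_smul, mul_inv_cancel₀ hx]
          · simp [smul_smul, mul_inv_cancel₀ hx]
          · ext i j
            simp [Matrix.vecMulVec_apply]
            field_simp
            ring
        rw [key]
        refine hf _ _ _ ?_ (hU.border _) ?_
        · rw [transpose_borderMat]
          exact hL.border _
        · intro i
          refine Fin.cases ?_ (fun i => ?_) i
          · simpa using hx
          · simpa using hd i
    obtain ⟨x, y, z, B, rfl⟩ : ∃ x y z B, A = borderMat x y z B := by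
      refine ⟨A 0 0, fun j => A 0 j.succ, fun i => A i.succ 0, A.submatrix Fin.succ Fin.succ, ?_⟩
      ext i j
      refine Fin.cases ?_ (fun i => ?_) i <;> refine Fin.cases ?_ (fun j => ?_) j <;> simp
    have hcx : Continuous fun t : ℂ => f (borderMat t y z B) :=
      hc.comp (hborder continuous_id continuous_const continuous_const continuous_const)
    -- The case of corner zero follows by letting the corner vary with the other entries fixed.
    have heq : (fun t : ℂ => f (borderMat t y z B)) = fun _ => 0 :=
      Continuous.ext_on (dense_compl_singleton (0 : ℂ)) hcx continuous_const
        fun t ht => h1 t y z B ht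
    exact congrFun heq x

/-- A continuous function which vanishes on invertible matrices vanishes. -/
lemma eq_zero_of_det_ne_zero {r : ℕ} {f : Matrix (Fin r) (Fin r) ℂ → ℂ} (hc : Continuous f)
    (hf : ∀ A, A.det ≠ 0 → f A = 0) (A : Matrix (Fin r) (Fin r) ℂ) : f A = 0 := by
  refine eq_zero_of_bigCell hc (fun L U d hL hU hd => hf _ ?_) A
  rw [Matrix.det_mul, Matrix.det_mul, hL.det_transpose, hU.det, Matrix.det_diagonal, one_mul,
    mul_one]
  exact Finset.prod_ne_zero_iff.2 fun i _ => hd i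

/-- A matrix of non-zero determinant as an element of `GL`. -/
def mkGL {ι : Type*} [Fintype ι] [DecidableEq ι] (A : Matrix ι ι ℂ) (hA : A.det ≠ 0) : GL ι ℂ :=
  Matrix.GeneralLinearGroup.mkOfDetNeZero A hA

@[simp] lemma coe_mkGL {ι : Type*} [Fintype ι] [DecidableEq ι] (A : Matrix ι ι ℂ)
    (hA : A.det ≠ 0) : (mkGL A hA).val = A := rfl

lemma det_coe_ne_zero {ι : Type*} [Fintype ι] [DecidableEq ι] (g : GL ι ℂ) : g.val.det ≠ 0 :=
  g.isUnit.map Matrix.detMonoidHom |>.ne_zero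

lemma continuous_evalMat {ι : Type*} [Fintype ι] [DecidableEq ι] (p : MvPolynomial (ι × ι) ℂ) :
    Continuous fun A : Matrix ι ι ℂ => evalMat A p := by
  refine (MvPolynomial.continuous_eval p).comp ?_
  exact continuous_pi fun q => continuous_id.matrix_elem q.1 q.2

/-- After clearing the powers of the determinant, the difference is a continuous function on all
matrices, to which `eq_zero_of_bigCell` applies. -/
lemma IsPolynomialFunction.ext_bigCell {r : ℕ} {φ φ' : GL (Fin r) ℂ → ℂ}
    (h : IsPolynomialFunction φ) (h' : IsPolynomialFunction φ')
    (heq : ∀ (l u : GL (Fin r) ℂ) (t : Fin r → ℂˣ), IsUpperUni l.valᵀ →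
      IsUpperUnitriangular u → φ (l * diagGL t * u) = φ' (l * diagGL t * u)) : φ = φ' := by
  obtain ⟨p, k, hp⟩ := h.exists_evalMat
  obtain ⟨p', k', hp'⟩ := h'.exists_evalMat
  have key : ∀ A : Matrix (Fin r) (Fin r) ℂ,
      evalMat A p * A.det ^ k' - evalMat A p' * A.det ^ k = 0 := by
    refine eq_zero_of_bigCell ?_ ?_
    · have hdet : Continuous fun A : Matrix (Fin r) (Fin r) ℂ => A.det := continuous_id.matrix_det
      exact ((continuous_evalMat p).mul (hdet.pow _)).sub ((continuous_evalMat p').mul (hdet.pow _))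
    · intro L U d hL hU hd
      have e := heq (mkGL L (by rw [hL.det_transpose]; exact one_ne_zero))
        (mkGL U (by rw [hU.det]; exact one_ne_zero)) (fun i => Units.mk0 (d i) (hd i)) hL hU
      have hM : ((mkGL L (by rw [hL.det_transpose]; exact one_ne_zero)) *
          diagGL (fun i => Units.mk0 (d i) (hd i)) *
          (mkGL U (by rw [hU.det]; exact one_ne_zero))).val = L * Matrix.diagonal d * U := rfl
      have hD := det_coe_ne_zero ((mkGL L (by rw [hL.det_transpose]; exact one_ne_zero)) *
          diagGL (fun i => Units.mk0 (d i) (hd i)) *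
          (mkGL U (by rw [hU.det]; exact one_ne_zero)))
      rw [hp, hp', div_eq_div_iff (pow_ne_zero _ hD) (pow_ne_zero _ hD), hM] at e
      rw [e, sub_self]
  ext g
  rw [hp, hp', div_eq_div_iff (pow_ne_zero _ (det_coe_ne_zero g))
    (pow_ne_zero _ (det_coe_ne_zero g))]
  exact sub_eq_zero.1 (key g.val)

lemma coe_diagGL {r : ℕ} (t : Fin r → ℂˣ) :
    (diagGL t).val = Matrix.diagonal fun i => (t i : ℂ) := rfl

variable {r : ℕ} {V : Type*} [AddCommGroup V] [Module ℂ V]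
  {ρ : Representation ℂ (GL (Fin r) ℂ) V}

lemma IsPolynomialFunction.continuous_extension {φ : GL (Fin r) ℂ → ℂ}
    (h : IsPolynomialFunction φ) {A : ℂ → Matrix (Fin r) (Fin r) ℂ} (hA : Continuous A)
    (hdet : ∀ s, (A s).det = 1) :
    Continuous fun s => φ (mkGL (A s) (by rw [hdet]; exact one_ne_zero)) := by
  obtain ⟨p, k, hp⟩ := h.exists_evalMat
  simp only [hp, coe_mkGL, hdet, one_pow, div_one]
  exact (continuous_evalMat p).comp hA

/-- The contraction of a lower unitriangular matrix to the identity. -/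
def contract (L : Matrix (Fin r) (Fin r) ℂ) (s : ℂ) : Matrix (Fin r) (Fin r) ℂ :=
  Matrix.of fun i j => s ^ ((i : ℕ) - j) * L i j

lemma isUpperUni_contract {L : Matrix (Fin r) (Fin r) ℂ} (hL : IsUpperUni Lᵀ) (s : ℂ) :
    IsUpperUni (contract L s)ᵀ := by
  constructor
  · intro i
    have := hL.1 i
    simp only [Matrix.transpose_apply] at this
    simp [contract, this]
  · intro i j hij
    have := hL.2 i j hij
    simp only [Matrix.transpose_apply] at this
    simp [contract, this]

/-- There is a linear functional which is `1` on the orbit of the highest weight vector under the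
lower unitriangular group. -/
theorem exists_functional (hpoly : ∀ (v : V) (l : Module.Dual ℂ V),
    IsPolynomialFunction fun g => l (ρ g v)) {w : Fin r → ℤ} {v₀ : V} (hv₀ : v₀ ≠ 0)
    (ht : ∀ t : Fin r → ℂˣ, ρ (diagGL t) v₀ = (∏ i, (t i : ℂ) ^ w i) • v₀) :
    ∃ l : Module.Dual ℂ V, ∀ u : GL (Fin r) ℂ, IsUpperUni u.valᵀ → l (ρ u v₀) = 1 := by
  obtain ⟨μ, hμ⟩ : ∃ μ : Module.Dual ℂ V, μ v₀ = 1 := by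
    obtain ⟨μ, hμ⟩ := Submodule.exists_le_ker_of_notMem (p := (⊥ : Submodule ℂ V)) (v := v₀)
      (by simpa using hv₀)
    exact ⟨(μ v₀)⁻¹ • μ, by simp [inv_mul_cancel₀ hμ.1]⟩
  -- Conjugation by this one-parameter torus multiplies the entry `(i, j)` by `s^(i - j)`, so it
  -- contracts the lower unitriangular group to the identity as `s` tends to `0`. The scalar `z s`
  -- is its character on `v₀`.
  set tor : ℂˣ → GL (Fin r) ℂ := fun s => diagGL fun i : Fin r => s ^ (i : ℕ) with htor
  set z : ℂˣ → ℂ := fun s => ∏ i : Fin r, ((s ^ (i : ℕ) : ℂˣ) : ℂ) ^ w i with hz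
  have hz0 : ∀ s, z s ≠ 0 := fun s =>
    Finset.prod_ne_zero_iff.2 fun i _ => zpow_ne_zero _ (Units.ne_zero _)
  -- vectors contracted to zero by the torus
  set E : ℂ → V → ℂ := fun s v => if hs : s ≠ 0 then
    (z (Units.mk0 s hs))⁻¹ * μ (ρ (tor (Units.mk0 s hs)) v) else 0 with hE
  have hEadd : ∀ s v v', E s (v + v') = E s v + E s v' := by
    intro s v v'
    simp only [hE]
    split_ifs <;> simp [mul_add]
  have hEsmul : ∀ s (c : ℂ) v, E s (c • v) = c * E s v := by
    intro s c v
    simp only [hE]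
    split_ifs
    · simp; ring
    · simp
  let P : Submodule ℂ V :=
    { carrier := {v | Filter.Tendsto (fun s => E s v) (𝓝[≠] 0) (𝓝 0)}
      zero_mem' := by
        have : ∀ s, E s 0 = 0 := fun s => by simpa using hEsmul s 0 0
        simp [this]
      add_mem' := by
        intro v v' hv hv'
        simp only [Set.mem_ofPred_eq, hEadd] at *
        simpa using hv.add hv'
      smul_mem' := by
        intro c v hv
        simp only [Set.mem_ofPred_eq, hEsmul] at *
        simpa using hv.const_mul c }
  have hEv₀ : ∀ s, s ≠ 0 → E s v₀ = 1 := by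
    intro s hs
    simp only [hE, dif_pos hs, htor, ht, map_smul, hμ, smul_eq_mul, mul_one]
    exact inv_mul_cancel₀ (hz0 (Units.mk0 s hs))
  -- Normalized by `z s`, the torus moves `ρ u v₀` to `ρ (contract u s) v₀`, whose `μ`-coefficient
  -- tends to `μ v₀ = 1`.
  have hlow : ∀ u : GL (Fin r) ℂ, IsUpperUni u.valᵀ → ρ u v₀ - v₀ ∈ P := by
    intro u hu
    have hdet := fun s => (isUpperUni_contract hu s).det_transpose
    have hcont := (hpoly v₀ μ).continuous_extension (A := contract u.val)
      (continuous_matrix fun i j => (continuous_pow _).mul continuous_const) hdet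
    have h0 : contract u.val 0 = 1 := by
      ext i j
      rcases lt_trichotomy i j with hij | rfl | hij
      · have := hu.2 j i hij
        simp only [Matrix.transpose_apply] at this
        simp [contract, this, hij.ne]
      · have := hu.1 i
        simp only [Matrix.transpose_apply] at this
        simp [contract, this]
      · have : (i : ℕ) - j ≠ 0 := by
          have : (j : ℕ) < i := hij
          omega
        simp [contract, this, hij.ne']
    have hlim := hcont.tendsto 0
    have h1 : mkGL (contract u.val 0) (by rw [hdet]; exact one_ne_zero) = 1 := Units.ext h0
    rw [h1, map_one, Module.End.one_apply, hμ] at hlim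
    have hEu : ∀ s, s ≠ 0 → E s (ρ u v₀) =
        μ (ρ (mkGL (contract u.val s) (by rw [hdet]; exact one_ne_zero)) v₀) := by
      intro s hs
      have hconj : tor (Units.mk0 s hs) * u =
          mkGL (contract u.val s) (by rw [hdet]; exact one_ne_zero) * tor (Units.mk0 s hs) := by
        ext i j
        simp only [htor, Units.val_mul, coe_diagGL, coe_mkGL, Matrix.diagonal_mul,
          Matrix.mul_diagonal, contract, Matrix.of_apply, Units.val_pow_eq_pow_val, Units.val_mk0]
        rcases lt_or_ge i j with hij | hij
        · have := hu.2 j i hij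
          simp only [Matrix.transpose_apply] at this
          simp [this]
        · have hij' : (j : ℕ) ≤ i := hij
          rw [mul_right_comm, ← pow_add, Nat.sub_add_cancel hij']
      simp only [hE, dif_pos hs]
      rw [← Module.End.mul_apply, ← map_mul, hconj, map_mul, Module.End.mul_apply]
      simp only [htor, ht, map_smul, smul_eq_mul]
      exact inv_mul_cancel_left₀ (hz0 (Units.mk0 s hs)) _
    have hlim' : Filter.Tendsto (fun s => E s (ρ u v₀)) (𝓝[≠] 0) (𝓝 1) := by
      refine (hlim.mono_left nhdsWithin_le_nhds).congr' ?_
      filter_upwards [self_mem_nhdsWithin] with s hs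
      exact (hEu s hs).symm
    have hlim0 : Filter.Tendsto (fun s => E s v₀) (𝓝[≠] 0) (𝓝 1) := by
      refine tendsto_const_nhds.congr' ?_
      filter_upwards [self_mem_nhdsWithin] with s hs
      exact (hEv₀ s hs).symm
    have hsub : ∀ s, E s (ρ u v₀ - v₀) = E s (ρ u v₀) - E s v₀ := by
      intro s
      rw [sub_eq_add_neg, hEadd, ← neg_one_smul ℂ v₀, hEsmul]
      ring
    change Filter.Tendsto _ _ _
    simp only [hsub]
    simpa using hlim'.sub hlim0
  have hv₀P : v₀ ∉ P := by
    intro hv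
    have hlim0 : Filter.Tendsto (fun s => E s v₀) (𝓝[≠] 0) (𝓝 1) := by
      refine tendsto_const_nhds.congr' ?_
      filter_upwards [self_mem_nhdsWithin] with s hs
      exact (hEv₀ s hs).symm
    exact one_ne_zero (tendsto_nhds_unique hlim0 hv)
  -- A functional killing `P` but not `v₀` is constant on the orbit; it is rescaled to the value
  -- `1`.
  obtain ⟨l, hl, hP⟩ := Submodule.exists_le_ker_of_notMem hv₀P
  refine ⟨(l v₀)⁻¹ • l, fun u hu => ?_⟩
  have := hP (hlow u hu)
  rw [LinearMap.mem_ker, map_sub, sub_eq_zero] at this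
  simp [this, inv_mul_cancel₀ hl]

lemma eq_bot_or_top_of_invariant (hρ : ρ.IsIrreducible) (P : Submodule ℂ V)
    (hP : ∀ g, ∀ v ∈ P, ρ g v ∈ P) : P = ⊥ ∨ P = ⊤ := by
  rcases hρ.eq_bot_or_eq_top (⟨P, fun g v hv => hP g v hv⟩ : Subrepresentation ρ) with h | h
  · exact Or.inl (congrArg Subrepresentation.toSubmodule h)
  · exact Or.inr (congrArg Subrepresentation.toSubmodule h)

end BigCell

/-! ### Closure properties of polynomial functions -/

section PolynomialFunctions

variable {ι : Type*} [Fintype ι] [DecidableEq ι] {φ φ' : GL ι ℂ → ℂ}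

lemma isPolynomialFunction_const (c : ℂ) : IsPolynomialFunction fun _ : GL ι ℂ => c :=
  ⟨MvPolynomial.C c, 0, fun g => by simp⟩

lemma isPolynomialFunction_entry (i j : ι) :
    IsPolynomialFunction fun g : GL ι ℂ => g.val i j :=
  ⟨MvPolynomial.X (i, j), 0, fun g => by simp⟩

lemma isPolynomialFunction_inv_det :
    IsPolynomialFunction fun g : GL ι ℂ => (g.val.det)⁻¹ :=
  ⟨1, 1, fun g => by simp⟩

lemma IsPolynomialFunction.mul (h : IsPolynomialFunction φ) (h' : IsPolynomialFunction φ') :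
    IsPolynomialFunction fun g => φ g * φ' g := by
  obtain ⟨p, k, hp⟩ := h
  obtain ⟨p', k', hp'⟩ := h'
  refine ⟨p * p', k + k', fun g => ?_⟩
  change φ g * φ' g = _
  rw [hp, hp', map_mul, pow_add, div_mul_div_comm]

lemma IsPolynomialFunction.add (h : IsPolynomialFunction φ) (h' : IsPolynomialFunction φ') :
    IsPolynomialFunction fun g => φ g + φ' g := by
  obtain ⟨p, k, hp⟩ := h.exists_evalMat
  obtain ⟨p', k', hp'⟩ := h'.exists_evalMat
  refine ⟨p * detPoly ι ^ k' + detPoly ι ^ k * p', k + k', fun g => ?_⟩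
  have hd := det_coe_ne_zero g
  change φ g + φ' g = _
  rw [hp, hp', div_add_div _ _ (pow_ne_zero _ hd) (pow_ne_zero _ hd), pow_add]
  congr 1
  have := evalMat_detPoly g.val
  rw [evalMat] at this
  rw [map_add, map_mul, map_mul, map_pow, map_pow, this]
  rfl

lemma IsPolynomialFunction.pow (h : IsPolynomialFunction φ) (k : ℕ) :
    IsPolynomialFunction fun g => φ g ^ k := by
  induction k with
  | zero => simpa using isPolynomialFunction_const 1
  | succ k ih => simpa only [pow_succ] using ih.mul h

lemma isPolynomialFunction_sum {α : Type*} (s : Finset α) {f : α → GL ι ℂ → ℂ}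
    (h : ∀ i, IsPolynomialFunction (f i)) : IsPolynomialFunction fun g => ∑ i ∈ s, f i g := by
  classical
  induction s using Finset.induction_on with
  | empty => simpa using isPolynomialFunction_const 0
  | insert i s hi ih => simpa only [Finset.sum_insert hi] using (h i).add ih

lemma isPolynomialFunction_prod {α : Type*} (s : Finset α) {f : α → GL ι ℂ → ℂ}
    (h : ∀ i, IsPolynomialFunction (f i)) : IsPolynomialFunction fun g => ∏ i ∈ s, f i g := by
  classical
  induction s using Finset.induction_on with
  | empty => simpa using isPolynomialFunction_const 1
  | insert i s hi ih => simpa only [Finset.prod_insert hi] using (h i).mul ih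

/-- A matrix-valued function whose entries are polynomial functions. -/
def IsPolynomialMatrix {α β : Type*} (M : GL ι ℂ → Matrix α β ℂ) : Prop :=
  ∀ i j, IsPolynomialFunction fun g => M g i j

lemma IsPolynomialMatrix.mul {α β γ : Type*} [Fintype β] {M : GL ι ℂ → Matrix α β ℂ}
    {M' : GL ι ℂ → Matrix β γ ℂ} (h : IsPolynomialMatrix M) (h' : IsPolynomialMatrix M') :
    IsPolynomialMatrix fun g => M g * M' g := fun i j => by
  simp only [Matrix.mul_apply]
  exact isPolynomialFunction_sum _ fun l => (h i l).mul (h' l j)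

lemma isPolynomialMatrix_const {α β : Type*} (M : Matrix α β ℂ) :
    IsPolynomialMatrix fun _ : GL ι ℂ => M := fun _ _ => isPolynomialFunction_const _

lemma IsPolynomialMatrix.pow {α : Type*} [Fintype α] [DecidableEq α]
    {M : GL ι ℂ → Matrix α α ℂ} (h : IsPolynomialMatrix M) (k : ℕ) :
    IsPolynomialMatrix fun g => M g ^ k := by
  induction k with
  | zero => simpa only [pow_zero] using isPolynomialMatrix_const 1
  | succ k ih => simpa only [pow_succ] using ih.mul h

lemma IsPolynomialMatrix.det {α : Type*} [Fintype α] [DecidableEq α]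
    {M : GL ι ℂ → Matrix α α ℂ} (h : IsPolynomialMatrix M) :
    IsPolynomialFunction fun g => (M g).det := by
  simp only [Matrix.det_apply']
  exact isPolynomialFunction_sum _ fun σ => (isPolynomialFunction_const _).mul
    (isPolynomialFunction_prod _ fun i => h _ _)

lemma isPolynomialMatrix_val : IsPolynomialMatrix fun g : GL ι ℂ => g.val :=
  isPolynomialFunction_entry

lemma coe_inv_eq (g : GL ι ℂ) : (g⁻¹).val = (g.val.det)⁻¹ • g.val.adjugate := by
  rw [Matrix.coe_units_inv, Matrix.inv_def, Ring.inverse_eq_inv']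

lemma isPolynomialMatrix_inv : IsPolynomialMatrix fun g : GL ι ℂ => (g⁻¹).val := by
  intro i j
  simp only [coe_inv_eq, Matrix.smul_apply, smul_eq_mul, Matrix.adjugate_apply]
  refine isPolynomialFunction_inv_det.mul (IsPolynomialMatrix.det fun k l => ?_)
  by_cases hk : k = j
  · subst hk
    simpa using isPolynomialFunction_const _
  · simpa [hk] using isPolynomialFunction_entry k l

lemma isPolynomialFunction_det_zpow (z : ℤ) :
    IsPolynomialFunction fun g : GL ι ℂ => g.val.det ^ z := by
  rcases z with k | k
  · simpa using isPolynomialMatrix_val.det.pow k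
  · simpa [zpow_negSucc] using (isPolynomialFunction_inv_det (ι := ι)).pow (k + 1)

end PolynomialFunctions

/-! ### Irreducible representations through their matrix coefficients -/

section Irreducible

variable {r : ℕ} {V : Type*} [AddCommGroup V] [Module ℂ V]
  {ρ : Representation ℂ (GL (Fin r) ℂ) V}

lemma diagGL_mul_val (l u : GL (Fin r) ℂ) (t : Fin r → ℂˣ) :
    (l * diagGL t * u).val = l.val * Matrix.diagonal (fun i => (t i : ℂ)) * u.val := rfl

/-- A polynomial function with the transformation law of the highest weight coefficient is a
matrix coefficient of the irreducible representation. -/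
theorem IsIrrepOfHighestWeight.exists_coeff {w : Fin r → ℤ} (hV : IsIrrepOfHighestWeight ρ w)
    {Φ : GL (Fin r) ℂ → ℂ} (hΦ : IsPolynomialFunction Φ)
    (hw : ∀ (l u : GL (Fin r) ℂ) (t : Fin r → ℂˣ), IsUpperUni l.valᵀ →
      IsUpperUnitriangular u → Φ (l * diagGL t * u) = ∏ i, (t i : ℂ) ^ w i) :
    ∃ (l : Module.Dual ℂ V) (v₀ : V), (∀ g, l (ρ g v₀) = Φ g) ∧ l v₀ = 1 := by
  obtain ⟨v₀, hv₀, hu, ht⟩ := hV.highest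
  obtain ⟨l, hl⟩ := exists_functional hV.polynomial hv₀ ht
  refine ⟨l, v₀, fun g => ?_, ?_⟩
  · refine congrFun (IsPolynomialFunction.ext_bigCell (hV.polynomial v₀ l) hΦ ?_) g
    intro x u t hx hu'
    -- On the big cell the upper factor fixes `v₀`, the torus gives the weight, and `l` does not see
    -- the lower factor.
    rw [hw x u t hx hu', map_mul, map_mul, Module.End.mul_apply, Module.End.mul_apply, hu u hu',
      ht, map_smul, map_smul, hl x hx, smul_eq_mul, mul_one]
  · simpa using hl 1 ⟨fun i => by simp, fun i j hij => by simp [hij.ne]⟩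

/-- The vectors with vanishing coefficients form an invariant subspace, which is not the whole space
because `l ≠ 0`. So `l` embeds `V` into functions on the group. -/
lemma IsIrrepOfHighestWeight.separates {w : Fin r → ℤ} (hV : IsIrrepOfHighestWeight ρ w)
    {l : Module.Dual ℂ V} (hl : l ≠ 0) {v : V} (hv : ∀ g, l (ρ g v) = 0) : v = 0 := by
  let P : Submodule ℂ V :=
    { carrier := {v | ∀ g, l (ρ g v) = 0}
      zero_mem' := by simp
      add_mem' := by
        intro v v' hv hv' g
        rw [map_add, map_add, hv g, hv' g, add_zero]
      smul_mem' := by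
        intro c v hv g
        rw [map_smul, map_smul, hv g, smul_zero] }
  have hP : P = ⊥ ∨ P = ⊤ := eq_bot_or_top_of_invariant hV.irreducible P fun g v hv g' => by
    rw [← Module.End.mul_apply, ← map_mul]
    exact hv _
  rcases hP with hP | hP
  · have : v ∈ P := hv
    rwa [hP, Submodule.mem_bot] at this
  · refine absurd (LinearMap.ext fun v' => ?_) hl
    have : v' ∈ P := hP ▸ Submodule.mem_top
    simpa using this 1

/-- By `separates` the common kernel of the translates is zero; in finite dimension the double
annihilator then gives everything. -/
lemma IsIrrepOfHighestWeight.span_dual {w : Fin r → ℤ} (hV : IsIrrepOfHighestWeight ρ w)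
    {l : Module.Dual ℂ V} (hl : l ≠ 0) :
    Submodule.span ℂ (Set.range fun g => l ∘ₗ ρ g) = ⊤ := by
  have := hV.finite
  rw [← Subspace.dualCoannihilator_dualAnnihilator_eq
    (W := Submodule.span ℂ (Set.range fun g => l ∘ₗ ρ g))]
  have : (Submodule.span ℂ (Set.range fun g => l ∘ₗ ρ g)).dualCoannihilator = ⊥ := by
    refine (Submodule.eq_bot_iff _).2 fun v hv => hV.separates hl fun g => ?_
    rw [Submodule.mem_dualCoannihilator] at hv
    exact hv _ (Submodule.subset_span ⟨g, rfl⟩)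
  rw [this, Submodule.dualAnnihilator_bot]

lemma IsIrrepOfHighestWeight.span_orbit {w : Fin r → ℤ} (hV : IsIrrepOfHighestWeight ρ w)
    {v₀ : V} (hv₀ : v₀ ≠ 0) : Submodule.span ℂ (Set.range fun g => ρ g v₀) = ⊤ := by
  refine (eq_bot_or_top_of_invariant hV.irreducible _ fun g v hv => ?_).resolve_left fun hb => ?_
  · induction hv using Submodule.span_induction with
    | mem v hv =>
      obtain ⟨g', rfl⟩ := hv
      exact Submodule.subset_span ⟨g * g', by simp⟩
    | zero => simp
    | add v v' _ _ h h' => simpa using Submodule.add_mem _ h h'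
    | smul c v _ h => simpa using Submodule.smul_mem _ c h
  · have : v₀ ∈ Submodule.span ℂ (Set.range fun g => ρ g v₀) :=
      Submodule.subset_span ⟨1, by simp⟩
    rw [hb, Submodule.mem_bot] at this
    exact hv₀ this

/-- A vector is recovered from finitely many of its matrix coefficients. -/
lemma IsIrrepOfHighestWeight.exists_reconstruction {w : Fin r → ℤ}
    (hV : IsIrrepOfHighestWeight ρ w) {l : Module.Dual ℂ V} (hl : l ≠ 0) :
    ∃ (k : Type) (_ : Fintype k) (g : k → GL (Fin r) ℂ) (e : k → V),
      ∀ v, v = ∑ i, l (ρ (g i) v) • e i := by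
  have := hV.finite
  let b := Module.finBasis ℂ V
  -- Each coordinate functional of a basis is a finite combination of translates of `l`.
  have : ∀ i, ∃ c : GL (Fin r) ℂ →₀ ℂ, (c.sum fun g z => z • (l ∘ₗ ρ g)) = b.coord i := fun i =>
    Finsupp.mem_span_range_iff_exists_finsupp.1 ((hV.span_dual hl).symm ▸ Submodule.mem_top)
  choose c hc using this
  refine ⟨Σ i, (c i).support, inferInstance, fun k => k.2.1, fun k => c k.1 k.2.1 • b k.1,
    fun v => ?_⟩
  conv_lhs => rw [← b.sum_repr v]
  rw [Fintype.sum_sigma]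
  refine Finset.sum_congr rfl fun i _ => ?_
  have := LinearMap.congr_fun (hc i) v
  rw [Module.Basis.coord_apply] at this
  rw [← this, Finsupp.sum, LinearMap.sum_apply, Finset.sum_smul, ← Finset.sum_coe_sort (c i).support]
  refine Finset.sum_congr rfl fun g _ => ?_
  simp [smul_smul, mul_comm]

end Irreducible

/-! ### Matrix coefficients of the representation of `GL_m` -/

section ModelW

variable {m n : ℕ} {h : n ≤ m}

lemma transpose_incl_mul_incl : (incl h)ᵀ * incl h = 1 := by
  ext i j
  simp [Matrix.mul_apply, incl, Matrix.one_apply, eq_comm, (castLE_injective' h).eq_iff]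

lemma topDet_eq (X : Matrix (Fin m) (Fin n) ℂ) : topDet h X = ((incl h)ᵀ * X).det := by
  rw [topDet]
  congr 1
  ext i j
  simp [Matrix.mul_apply, incl]

lemma continuous_topDet : Continuous (topDet h) :=
  (continuous_id.matrix_submatrix _ _).matrix_det

/-- Upper unitriangular matrices preserve the span of the first `n` coordinate vectors. -/
lemma IsUpperUni.mul_incl {U : Matrix (Fin m) (Fin m) ℂ} (hU : IsUpperUni U) :
    U * incl h = incl h * U.submatrix (Fin.castLE h) (Fin.castLE h) ∧
      IsUpperUni (U.submatrix (Fin.castLE h) (Fin.castLE h)) := by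
  refine ⟨?_, fun i => hU.1 _, fun i j hij => hU.2 _ _ hij⟩
  rw [CM.mul_incl]
  ext i j
  by_cases hi : (i : ℕ) < n
  · obtain ⟨i', rfl⟩ : ∃ i', i = Fin.castLE h i' := ⟨⟨i, hi⟩, rfl⟩
    simp [Matrix.mul_apply, incl, (castLE_injective' h).eq_iff]
  · have hne : ∀ k : Fin n, i ≠ Fin.castLE h k := fun k e => hi (e ▸ k.2)
    have hlt : Fin.castLE h j < i := by
      have := j.2
      change (j : ℕ) < i
      omega
    simp [Matrix.mul_apply, incl, hne, hU.2 i _ hlt]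

/-- The top minor sees only the leading `n × n` block of each triangular factor, and the
unitriangular blocks have determinant `1`. -/
lemma topDet_bigCell {L U : Matrix (Fin m) (Fin m) ℂ} (hL : IsUpperUni Lᵀ) (hU : IsUpperUni U)
    (d : Fin m → ℂ) :
    topDet h (L * Matrix.diagonal d * U * incl h) = ∏ i : Fin n, d (Fin.castLE h i) := by
  obtain ⟨hU1, hU2⟩ := hU.mul_incl (h := h)
  obtain ⟨hL1, hL2⟩ := hL.mul_incl (h := h)
  have hL3 : (incl h)ᵀ * L = (Lᵀ.submatrix (Fin.castLE h) (Fin.castLE h))ᵀ * (incl h)ᵀ := by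
    rw [← Matrix.transpose_mul, ← hL1, Matrix.transpose_mul, Matrix.transpose_transpose]
  have hD : (incl h)ᵀ * Matrix.diagonal d * incl h =
      Matrix.diagonal fun i => d (Fin.castLE h i) := by
    ext i j
    simp [Matrix.mul_apply, Matrix.diagonal_apply, incl, (castLE_injective' h).eq_iff, eq_comm]
    split_ifs with hij
    · rw [hij]
    · rfl
  rw [Matrix.mul_assoc, hU1, ← Matrix.mul_assoc, topDet_mul, hU2.det, mul_one, topDet_eq,
    ← Matrix.mul_assoc, ← Matrix.mul_assoc, hL3, Matrix.mul_assoc, Matrix.mul_assoc,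
    Matrix.det_mul, Matrix.det_transpose, hL2.det, one_mul, ← Matrix.mul_assoc, hD, Matrix.det_diagonal]

lemma prod_weightW {a c : ℤ} {N : ℕ} (hN : c - a = N) (t : Fin m → ℂˣ) :
    ∏ i, (t i : ℂ) ^ weightW m n a c i =
      (∏ i, (t i : ℂ)) ^ a * (∏ i : Fin n, (t (Fin.castLE h i) : ℂ)) ^ N := by
  obtain ⟨d, rfl⟩ := Nat.exists_eq_add_of_le h
  have h1 : ∀ i, (t i : ℂ) ^ weightW (n + d) n a c i =
      (t i : ℂ) ^ a * (if (i : ℕ) < n then (t i : ℂ) ^ N else 1) := by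
    intro i
    rw [weightW, zpow_add₀ (Units.ne_zero _), mul_comm, hN]
    split_ifs <;> simp
  rw [Finset.prod_congr rfl fun i _ => h1 i, Finset.prod_mul_distrib, ← Finset.prod_zpow]
  congr 1
  rw [Fin.prod_univ_add, ← Finset.prod_pow]
  simp
  rfl

variable {W : Type*} [AddCommGroup W] [Module ℂ W] {ρ : Representation ℂ (GL (Fin m) ℂ) W}
  {a c : ℤ} {N : ℕ}

lemma IsIrrepOfHighestWeight.exists_coeffW (h : n ≤ m) (hN : c - a = N)
    (hW : IsIrrepOfHighestWeight ρ (weightW m n a c)) :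
    ∃ (l : Module.Dual ℂ W) (w₀ : W),
      (∀ p, l (ρ p w₀) = p.val.det ^ a * topDet h (p.val * incl h) ^ N) ∧ l w₀ = 1 := by
  refine hW.exists_coeff (Φ := fun p => p.val.det ^ a * topDet h (p.val * incl h) ^ N) ?_ ?_
  · refine (isPolynomialFunction_det_zpow a).mul (IsPolynomialFunction.pow ?_ N)
    simp only [topDet_eq]
    exact (isPolynomialMatrix_const _).mul
      (isPolynomialMatrix_val.mul (isPolynomialMatrix_const _)) |>.det
  · intro l u t hl hu
    rw [diagGL_mul_val, topDet_bigCell hl hu, prod_weightW hN, Matrix.det_mul, Matrix.det_mul,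
      hl.det_transpose, IsUpperUni.det hu, Matrix.det_diagonal, one_mul, mul_one]

/-- For `B = M * incl h` with `M` invertible the vector is a rescaled translate of `w₀`. The
reconstruction formula is continuous in `M`, so singular `M` are allowed too; this matters since the
upper right block of `g` may have any rank. -/
lemma IsIrrepOfHighestWeight.exists_vectorW
    (hW : IsIrrepOfHighestWeight ρ (weightW m n a c)) {l : Module.Dual ℂ W} {w₀ : W}
    (hl : ∀ p, l (ρ p w₀) = p.val.det ^ a * topDet h (p.val * incl h) ^ N) (hl0 : l w₀ = 1)
    (B : Matrix (Fin m) (Fin n) ℂ) :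
    ∃ w : W, ∀ p, l (ρ p w) = p.val.det ^ a * topDet h (p.val * B) ^ N := by
  have hl' : l ≠ 0 := by
    rintro rfl
    simp at hl0
  obtain ⟨k, _, g, e, hge⟩ := hW.exists_reconstruction hl'
  set w : Matrix (Fin m) (Fin m) ℂ → W := fun M =>
    ∑ i, ((g i).val.det ^ a * topDet h ((g i).val * (M * incl h)) ^ N) • e i with hw
  have hcontTop : ∀ p : Matrix (Fin m) (Fin m) ℂ,
      Continuous fun M : Matrix (Fin m) (Fin m) ℂ => topDet h (p * (M * incl h)) ^ N := fun p =>
    (continuous_topDet.comp (continuous_const.matrix_mul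
      (continuous_id.matrix_mul continuous_const))).pow N
  have key : ∀ (p : GL (Fin m) ℂ) (M : Matrix (Fin m) (Fin m) ℂ),
      l (ρ p (w M)) - p.val.det ^ a * topDet h (p.val * (M * incl h)) ^ N = 0 := by
    intro p
    refine eq_zero_of_det_ne_zero ?_ fun M hM => ?_
    · simp only [hw, map_sum, map_smul, smul_eq_mul]
      refine Continuous.sub ?_ (continuous_const.mul (hcontTop _))
      exact continuous_finsetSum _ fun i _ =>
        (continuous_const.mul (hcontTop _)).mul continuous_const
    · have h1 : ∀ p : GL (Fin m) ℂ, l (ρ p ((M.det ^ a)⁻¹ • ρ (mkGL M hM) w₀)) =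
          p.val.det ^ a * topDet h (p.val * (M * incl h)) ^ N := by
        intro p
        rw [map_smul, map_smul, ← Module.End.mul_apply, ← map_mul, hl, Units.val_mul, coe_mkGL,
          Matrix.det_mul, mul_zpow, smul_eq_mul, Matrix.mul_assoc]
        have := zpow_ne_zero a hM
        field_simp
      have h2 : w M = (M.det ^ a)⁻¹ • ρ (mkGL M hM) w₀ := by
        rw [hge ((M.det ^ a)⁻¹ • ρ (mkGL M hM) w₀)]
        simp only [hw, h1]
      rw [h2, h1, sub_self]
  -- `B * (incl h)ᵀ` is a square matrix, in general singular, whose product with `incl h` is `B`.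
  refine ⟨w (B * (incl h)ᵀ), fun p => ?_⟩
  have := sub_eq_zero.1 (key p (B * (incl h)ᵀ))
  rwa [Matrix.mul_assoc B, transpose_incl_mul_incl, Matrix.mul_one] at this

end ModelW

/-! ### Matrix coefficients of the representation of `GL_n` -/

section ModelV

variable {n : ℕ}

/-- The first weight exceeds the others by `v (n - 1) + v = n v`. The power of the first entry is
written as a product over `Fin n` to make sense for `n = 0` as well. -/
lemma prod_weightV {a b c e : ℤ} {v : ℕ} (he : e = b + a - c - v) (t : Fin n → ℂˣ) :
    ∏ i, (t i : ℂ) ^ weightV n a b c v i =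
      (∏ i, (t i : ℂ)) ^ e * ∏ i : Fin n, (t ⟨0, i.pos⟩ : ℂ) ^ v := by
  rcases n with _ | n
  · simp
  · have h0 : ∀ hp : 0 < n + 1, (⟨0, hp⟩ : Fin (n + 1)) = 0 := fun _ => rfl
    simp only [h0, Finset.prod_const, Finset.card_univ, Fintype.card_fin]
    rw [Fin.prod_univ_succ, Fin.prod_univ_succ, mul_zpow, ← Finset.prod_zpow, mul_right_comm]
    congr 1
    · rw [← pow_mul, ← zpow_natCast, ← zpow_add₀ (Units.ne_zero _), he]
      congr 1
      simp only [weightV, Fin.val_zero, if_true]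
      push_cast
      ring
    · refine Finset.prod_congr rfl fun i _ => ?_
      congr 1
      simp only [weightV, Fin.val_succ, Nat.succ_ne_zero, if_false, he]
      ring

lemma firstRow_bigCell {L U : Matrix (Fin n) (Fin n) ℂ} (hL : IsUpperUni Lᵀ)
    (hU : IsUpperUni U) (d : Fin n → ℂ) (i : Fin n) :
    firstRow (L * Matrix.diagonal d * U) ⟨0, i.pos⟩ = d ⟨0, i.pos⟩ := by
  rw [firstRow, Matrix.mul_apply, Finset.sum_eq_single ⟨0, i.pos⟩]
  · have := hL.1 ⟨0, i.pos⟩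
    rw [Matrix.transpose_apply] at this
    rw [Matrix.mul_diagonal, hU.1, this, one_mul, mul_one]
  · intro k _ hk
    have : (⟨0, i.pos⟩ : Fin n) < k := by
      rw [Fin.lt_def]
      rw [Ne, Fin.ext_iff] at hk
      exact Nat.pos_of_ne_zero hk
    rw [hU.2 _ _ this, mul_zero]
  · simp

variable {V : Type*} [AddCommGroup V] [Module ℂ V] {ρ : Representation ℂ (GL (Fin n) ℂ) V}
  {a b c e : ℤ} {v : ℕ}

lemma IsIrrepOfHighestWeight.exists_coeffV (he : e = b + a - c - v)
    (hV : IsIrrepOfHighestWeight ρ (weightV n a b c v)) :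
    ∃ (l : Module.Dual ℂ V) (v₀ : V),
      (∀ q, l (ρ q v₀) = q.val.det ^ e * ∏ i : Fin n, firstRow q.val ⟨0, i.pos⟩ ^ v) ∧
        l v₀ = 1 := by
  refine hV.exists_coeff
    (Φ := fun q => q.val.det ^ e * ∏ i : Fin n, firstRow q.val ⟨0, i.pos⟩ ^ v) ?_ ?_
  · refine (isPolynomialFunction_det_zpow e).mul (isPolynomialFunction_prod _ fun i => ?_)
    exact IsPolynomialFunction.pow (isPolynomialFunction_entry _ _) v
  · intro l u t hl hu
    rw [diagGL_mul_val, prod_weightV he, Matrix.det_mul, Matrix.det_mul,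
      hl.det_transpose, IsUpperUni.det hu, Matrix.det_diagonal, one_mul, mul_one]
    exact congrArg _ (Finset.prod_congr rfl fun i _ => by rw [firstRow_bigCell hl hu _ i])

/-- Translates of the highest weight vector give powers of linear forms in the first row, and such
powers span all forms of their degree in characteristic zero. The argument is by duality. -/
lemma IsIrrepOfHighestWeight.exists_vectorV_monomial {l : Module.Dual ℂ V} {v₀ : V}
    (hl : ∀ q, l (ρ q v₀) = q.val.det ^ e * ∏ i : Fin n, firstRow q.val ⟨0, i.pos⟩ ^ v)
    (k : Fin n → ℕ) (hk : ∑ i, k i = n * v) :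
    ∃ w : V, ∀ q, l (ρ q w) = q.val.det ^ e * ∏ i, firstRow q.val i ^ k i := by
  rcases n with _ | n
  · exact ⟨v₀, fun q => by simpa using hl q⟩
  have h0 : ∀ hp : 0 < n + 1, (⟨0, hp⟩ : Fin (n + 1)) = 0 := fun _ => rfl
  simp only [h0, Finset.prod_const, Finset.card_univ, Fintype.card_fin, ← pow_mul,
    mul_comm v] at hl
  let ι : V →ₗ[ℂ] (GL (Fin (n + 1)) ℂ → ℂ) := LinearMap.pi fun q => l ∘ₗ ρ q
  set mono : (Fin (n + 1) → ℕ) → GL (Fin (n + 1)) ℂ → ℂ := fun k q =>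
    q.val.det ^ e * ∏ i, firstRow q.val i ^ k i with hmono
  suffices hmem : mono k ∈ LinearMap.range ι by
    obtain ⟨w, hw⟩ := hmem
    exact ⟨w, fun q => congrFun hw q⟩
  by_contra hnot
  obtain ⟨μ, hμ, hker⟩ := Submodule.exists_le_ker_of_notMem hnot
  -- powers of linear forms lie in the range
  have hpow : ∀ y : Fin (n + 1) → ℂ, y 0 ≠ 0 →
      (fun q : GL (Fin (n + 1)) ℂ => q.val.det ^ e *
        (∑ i, firstRow q.val i * y i) ^ ((n + 1) * v)) ∈ LinearMap.range ι := by
    intro y hy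
    -- Right multiplication by this matrix turns the first entry of a row into its pairing with `y`;
    -- it is invertible only for `y 0 ≠ 0`.
    have hdet : ((1 : Matrix (Fin (n + 1)) (Fin (n + 1)) ℂ).updateCol 0 y).det = y 0 := by
      rw [← Matrix.cramer_apply, Matrix.cramer_one, Module.End.one_apply]
    refine ⟨(y 0 ^ e)⁻¹ • ρ (mkGL _ (hdet.symm ▸ hy)) v₀, funext fun q => ?_⟩
    change l (ρ q _) = _
    rw [map_smul, map_smul, ← Module.End.mul_apply, ← map_mul, hl, Units.val_mul, coe_mkGL,
      Matrix.det_mul, mul_zpow, smul_eq_mul, hdet]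
    have h1 : firstRow (q.val * (1 : Matrix (Fin (n + 1)) (Fin (n + 1)) ℂ).updateCol 0 y) 0 =
        ∑ i, firstRow q.val i * y i := by
      simp [firstRow, Matrix.mul_apply]
    have := zpow_ne_zero e hy
    rw [h1]
    field_simp
  set F : MvPolynomial (Fin (n + 1)) ℂ :=
    ∑ k ∈ Finset.piAntidiag Finset.univ ((n + 1) * v),
      MvPolynomial.monomial (Finsupp.equivFunOnFinite.symm k)
        ((Nat.multinomial Finset.univ k : ℂ) * μ (mono k)) with hF
  -- The value of `F` at `y` is `μ` of a power of a linear form, hence zero when `y 0 ≠ 0`. The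
  -- factor `X 0` takes care of the remaining `y`.
  have hF0 : MvPolynomial.X 0 * F = 0 := by
    refine MvPolynomial.funext fun y => ?_
    rw [map_mul, MvPolynomial.eval_X, map_zero]
    by_cases hy : y 0 = 0
    · rw [hy, zero_mul]
    · have h1 := LinearMap.mem_ker.1 (hker (hpow y hy))
      have h2 : (fun q : GL (Fin (n + 1)) ℂ => q.val.det ^ e *
          (∑ i, firstRow q.val i * y i) ^ ((n + 1) * v)) =
          ∑ k ∈ Finset.piAntidiag Finset.univ ((n + 1) * v),
            ((Nat.multinomial Finset.univ k : ℂ) * ∏ i, y i ^ k i) • mono k := by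
        funext q
        rw [Finset.sum_pow_eq_sum_piAntidiag, Finset.mul_sum, Finset.sum_apply]
        refine Finset.sum_congr rfl fun k _ => ?_
        simp only [hmono, Pi.smul_apply, smul_eq_mul, mul_pow, Finset.prod_mul_distrib]
        ring
      rw [h2, map_sum] at h1
      have h3 : MvPolynomial.eval y F = 0 := by
        rw [← h1, hF, map_sum]
        refine Finset.sum_congr rfl fun k _ => ?_
        rw [MvPolynomial.eval_monomial, map_smul, smul_eq_mul, Finsupp.prod_fintype _ _
          (fun i => pow_zero _)]
        simp only [Finsupp.coe_equivFunOnFinite_symm]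
        ring
      rw [h3, mul_zero]
  have hF1 : F = 0 := (mul_eq_zero.1 hF0).resolve_left (MvPolynomial.X_ne_zero 0)
  -- The coefficient at `k` is a nonzero multinomial number times `μ (mono k)`, which contradicts
  -- the choice of `μ`.
  have hF2 := congrArg (MvPolynomial.coeff (Finsupp.equivFunOnFinite.symm k)) hF1
  rw [hF, MvPolynomial.coeff_sum, Finset.sum_eq_single k] at hF2
  · rw [MvPolynomial.coeff_monomial, if_pos rfl, MvPolynomial.coeff_zero] at hF2
    rcases mul_eq_zero.1 hF2 with h1 | h1
    · exact (Nat.multinomial_pos _ _).ne' (by exact_mod_cast h1)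
    · exact hμ h1
  · intro k' _ hk'
    rw [MvPolynomial.coeff_monomial, if_neg]
    simpa using hk'
  · intro hk'
    simp [hk] at hk'

lemma IsIrrepOfHighestWeight.exists_vectorV {l : Module.Dual ℂ V} {v₀ : V}
    (hl : ∀ q, l (ρ q v₀) = q.val.det ^ e * ∏ i : Fin n, firstRow q.val ⟨0, i.pos⟩ ^ v)
    {P : MvPolynomial (Fin n) ℂ} (hP : P.IsHomogeneous (n * v)) :
    ∃ w : V, ∀ q, l (ρ q w) = q.val.det ^ e * MvPolynomial.eval (firstRow q.val) P := by
  have : ∀ d ∈ P.support, ∃ w : V, ∀ q,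
      l (ρ q w) = q.val.det ^ e * ∏ i, firstRow q.val i ^ d i := by
    intro d hd
    refine IsIrrepOfHighestWeight.exists_vectorV_monomial hl d ?_
    have := hP (MvPolynomial.mem_support_iff.1 hd)
    rw [← this, Finsupp.weight_apply, Finsupp.sum_fintype _ _ (fun i => by simp)]
    simp
  choose! w hw using this
  refine ⟨∑ d ∈ P.support, P.coeff d • w d, fun q => ?_⟩
  rw [map_sum, map_sum, MvPolynomial.eval_eq', Finset.mul_sum]
  refine Finset.sum_congr rfl fun d hd => ?_
  rw [map_smul, map_smul, hw d hd, smul_eq_mul]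
  ring

end ModelV

/-! ### A unipotent matrix without zeros in its first row -/

/-- The unipotent matrix whose first row consists of ones. -/
def onesRow (n : ℕ) : GL (Fin n) ℂ :=
  mkGL (Matrix.of fun i j => if (i : ℕ) = 0 ∨ i = j then 1 else 0) (by
    rw [IsUpperUni.det]
    · exact one_ne_zero
    · refine ⟨fun i => by simp, fun i j hij => ?_⟩
      have h1 : (j : ℕ) < i := hij
      rw [Matrix.of_apply, if_neg]
      rintro (h2 | h2)
      · omega
      · exact hij.ne' h2)

lemma det_onesRow {n : ℕ} : (onesRow n).val.det = 1 := by
  refine IsUpperUni.det ⟨fun i => by simp [onesRow], fun i j hij => ?_⟩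
  have h1 : (j : ℕ) < i := hij
  rw [onesRow, coe_mkGL, Matrix.of_apply, if_neg]
  rintro (h2 | h2)
  · omega
  · exact hij.ne' h2

lemma firstRow_onesRow {n : ℕ} (i : Fin n) : firstRow (onesRow n).val i = 1 := by
  simp [firstRow, onesRow]

/-! ### Test functionals on the tensor product -/

section Tests

variable {m n : ℕ} {h : n ≤ m} {W V : Type*} [AddCommGroup W] [Module ℂ W]
  [AddCommGroup V] [Module ℂ V] {ρW : Representation ℂ (GL (Fin m) ℂ) W}
  {ρV : Representation ℂ (GL (Fin n) ℂ) V} {a b e : ℤ} {N v : ℕ}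

/-- The functionals `lW` and `lV` realize `W` and `V` as spaces of functions on `GL_m` and `GL_n`;
this records which functions occur. -/
structure IsModel (h : n ≤ m) (ρW : Representation ℂ (GL (Fin m) ℂ) W)
    (ρV : Representation ℂ (GL (Fin n) ℂ) V) (a e : ℤ) (N v : ℕ)
    (lW : Module.Dual ℂ W) (lV : Module.Dual ℂ V) : Prop where
  finite_left : Module.Finite ℂ W
  finite_right : Module.Finite ℂ V
  span_left : Submodule.span ℂ (Set.range fun p => lW ∘ₗ ρW p) = ⊤
  span_right : Submodule.span ℂ (Set.range fun q => lV ∘ₗ ρV q) = ⊤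
  orbit_left : ∃ w₀, (∀ p, lW (ρW p w₀) = p.val.det ^ a * topDet h (p.val * incl h) ^ N) ∧
    Submodule.span ℂ (Set.range fun p => ρW p w₀) = ⊤
  orbit_right : ∃ v₀,
    (∀ q, lV (ρV q v₀) = q.val.det ^ e * ∏ i : Fin n, firstRow q.val ⟨0, i.pos⟩ ^ v) ∧
      Submodule.span ℂ (Set.range fun q => ρV q v₀) = ⊤
  vector_left : ∀ B : Matrix (Fin m) (Fin n) ℂ, ∃ w, ∀ p, lW (ρW p w) = p.val.det ^ a * topDet h (p.val * B) ^ N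
  vector_right : ∀ P : MvPolynomial (Fin n) ℂ, P.IsHomogeneous (n * v) →
    ∃ w, ∀ q, lV (ρV q w) = q.val.det ^ e * MvPolynomial.eval (firstRow q.val) P

theorem exists_isModel {c : ℤ} (h : n ≤ m) (hN : c - a = N) (he : e = b + a - c - v)
    (hW : IsIrrepOfHighestWeight ρW (weightW m n a c))
    (hV : IsIrrepOfHighestWeight ρV (weightV n a b c v)) :
    ∃ lW lV, IsModel h ρW ρV a e N v lW lV := by
  obtain ⟨lW, w₀, hl, hl1⟩ := hW.exists_coeffW h hN
  obtain ⟨lV, v₀, hr, hr1⟩ := hV.exists_coeffV he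
  have hlW : lW ≠ 0 := by
    rintro rfl
    simp at hl1
  have hlV : lV ≠ 0 := by
    rintro rfl
    simp at hr1
  have hw₀ : w₀ ≠ 0 := by
    rintro rfl
    simp at hl1
  have hv₀ : v₀ ≠ 0 := by
    rintro rfl
    simp at hr1
  exact ⟨lW, lV, hW.finite, hV.finite, hW.span_dual hlW, hV.span_dual hlV,
    ⟨w₀, hl, hW.span_orbit hw₀⟩, ⟨v₀, hr, hV.span_orbit hv₀⟩, hW.exists_vectorW hl hl1,
    fun P hP => IsIrrepOfHighestWeight.exists_vectorV hr hP⟩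

/-- The functional on `W ⊗ V` given by translates of `lW` and `lV`. -/
def test (ρW : Representation ℂ (GL (Fin m) ℂ) W) (ρV : Representation ℂ (GL (Fin n) ℂ) V)
    (lW : Module.Dual ℂ W) (lV : Module.Dual ℂ V) (p : GL (Fin m) ℂ) (q : GL (Fin n) ℂ) :
    Module.Dual ℂ (W ⊗[ℂ] V) :=
  TensorProduct.dualDistrib ℂ W V ((lW ∘ₗ ρW p) ⊗ₜ (lV ∘ₗ ρV q))

variable {lW : Module.Dual ℂ W} {lV : Module.Dual ℂ V}

@[simp] lemma test_tmul (p : GL (Fin m) ℂ) (q : GL (Fin n) ℂ) (w : W) (v : V) :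
    test ρW ρV lW lV p q (w ⊗ₜ v) = lW (ρW p w) * lV (ρV q v) := rfl

lemma test_map (p k₁ : GL (Fin m) ℂ) (q k₂ : GL (Fin n) ℂ) (T : W ⊗[ℂ] V) :
    test ρW ρV lW lV p q (TensorProduct.map (ρW k₁) (ρV k₂) T) =
      test ρW ρV lW lV (p * k₁) (q * k₂) T := by
  induction T using TensorProduct.induction_on with
  | zero => simp
  | tmul w v => simp
  | add T T' hT hT' => simp [hT, hT']

lemma IsModel.span_test (hM : IsModel h ρW ρV a e N v lW lV) :
    Submodule.span ℂ (Set.range fun k : GL (Fin m) ℂ × GL (Fin n) ℂ =>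
      test ρW ρV lW lV k.1 k.2) = ⊤ := by
  have := hM.finite_left
  have := hM.finite_right
  rw [eq_top_iff]
  rintro l -
  obtain ⟨z, rfl⟩ := (TensorProduct.dualDistribEquiv ℂ W V).surjective l
  induction z using TensorProduct.induction_on with
  | zero => simp
  | add z z' hz hz' => simpa using Submodule.add_mem _ hz hz'
  | tmul f g =>
    have hf : f ∈ Submodule.span ℂ (Set.range fun p => lW ∘ₗ ρW p) :=
      hM.span_left.symm ▸ Submodule.mem_top
    have hg : g ∈ Submodule.span ℂ (Set.range fun p => lV ∘ₗ ρV p) :=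
      hM.span_right.symm ▸ Submodule.mem_top
    induction hf using Submodule.span_induction with
    | zero => simp
    | add f f' _ _ hf hf' => simpa [TensorProduct.add_tmul] using Submodule.add_mem _ hf hf'
    | smul c f _ hf =>
      rw [← TensorProduct.smul_tmul', map_smul]
      exact Submodule.smul_mem _ c hf
    | mem f hf =>
      obtain ⟨p, rfl⟩ := hf
      induction hg using Submodule.span_induction with
      | zero => simp
      | add f f' _ _ hf hf' => simpa [TensorProduct.tmul_add] using Submodule.add_mem _ hf hf'
      | smul c f _ hf => simpa [TensorProduct.tmul_smul] using Submodule.smul_mem _ c hf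
      | mem g hg =>
        obtain ⟨q, rfl⟩ := hg
        exact Submodule.subset_span ⟨(p, q), rfl⟩

/-- Statements linear in the functional need only be checked on translates of `lW ⊗ lV`, where left
equivariance is visible. -/
lemma IsModel.dual_induction (hM : IsModel h ρW ρV a e N v lW lV)
    {C : Module.Dual ℂ (W ⊗[ℂ] V) → Prop} (htest : ∀ p q, C (test ρW ρV lW lV p q)) (h0 : C 0)
    (hadd : ∀ l l', C l → C l' → C (l + l')) (hsmul : ∀ (c : ℂ) l, C l → C (c • l))
    (l : Module.Dual ℂ (W ⊗[ℂ] V)) : C l := by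
  have hl : l ∈ Submodule.span ℂ (Set.range fun k : GL (Fin m) ℂ × GL (Fin n) ℂ =>
      test ρW ρV lW lV k.1 k.2) := hM.span_test.symm ▸ Submodule.mem_top
  induction hl using Submodule.span_induction with
  | zero => exact h0
  | add f f' _ _ hf hf' => exact hadd _ _ hf hf'
  | smul c f _ hf => exact hsmul _ _ hf
  | mem g hg =>
    obtain ⟨q, rfl⟩ := hg
    exact htest _ _

lemma IsModel.ext (hM : IsModel h ρW ρV a e N v lW lV) {T T' : W ⊗[ℂ] V}
    (hT : ∀ p q, test ρW ρV lW lV p q T = test ρW ρV lW lV p q T') : T = T' := by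
  have := hM.finite_left
  have := hM.finite_right
  rw [← sub_eq_zero, ← Module.forall_dual_apply_eq_zero_iff ℂ]
  refine hM.dual_induction (fun p q => ?_) rfl (fun l l' hl hl' => ?_) fun c l hl => ?_
  · rw [map_sub, hT, sub_self]
  · rw [LinearMap.add_apply, hl, hl', add_zero]
  · rw [LinearMap.smul_apply, hl, smul_zero]

/-- Continuity and the normal form of the matrix coefficients of an element of `W ⊗ V`. -/
lemma IsModel.exists_normalForm (hM : IsModel h ρW ρV a e N v lW lV) (T : W ⊗[ℂ] V) :
    ∃ (E : Matrix (Fin m) (Fin m) ℂ → (Fin n → ℂ) → ℂ) (E' : (Fin n → ℂ) → ℂ),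
      (∀ p q, test ρW ρV lW lV p q T =
        p.val.det ^ a * q.val.det ^ e * E p.val (firstRow q.val)) ∧
      (∀ r, Continuous fun p => E p r) ∧ Continuous E' ∧
      ∀ p r, E (p * (incl h * (incl h)ᵀ)) r = topDet h (p * incl h) ^ N * E' r := by
  have hleft : ∀ w : W, ∃ (E : Matrix (Fin m) (Fin m) ℂ → ℂ) (z : ℂ),
      (∀ p, lW (ρW p w) = p.val.det ^ a * E p.val) ∧ Continuous E ∧
      ∀ p, E (p * (incl h * (incl h)ᵀ)) = topDet h (p * incl h) ^ N * z := by
    obtain ⟨w₀, hw₀, hspan⟩ := hM.orbit_left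
    intro w
    have hw : w ∈ Submodule.span ℂ (Set.range fun p => ρW p w₀) :=
      hspan.symm ▸ Submodule.mem_top
    induction hw using Submodule.span_induction with
    | zero => exact ⟨fun _ => 0, 0, by simp, continuous_const, by simp⟩
    | add w w' _ _ hw hw' =>
      obtain ⟨E, z, h1, h2, h3⟩ := hw
      obtain ⟨E', z', h1', h2', h3'⟩ := hw'
      exact ⟨fun p => E p + E' p, z + z', fun p => by rw [map_add, map_add, h1, h1', mul_add],
        h2.add h2', fun p => by simp only [h3, h3', mul_add]⟩
    | smul c w _ hw =>
      obtain ⟨E, z, h1, h2, h3⟩ := hw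
      exact ⟨fun p => c * E p, c * z, fun p => by rw [map_smul, map_smul, h1, smul_eq_mul]; ring,
        continuous_const.mul h2, fun p => by simp only [h3]; ring⟩
    | mem w hw =>
      obtain ⟨M, rfl⟩ := hw
      refine ⟨fun p => M.val.det ^ a * topDet h (p * M.val * incl h) ^ N,
        M.val.det ^ a * ((incl h)ᵀ * (M.val * incl h)).det ^ N, fun p => ?_, ?_, fun p => ?_⟩
      · rw [← Module.End.mul_apply, ← map_mul, hw₀, Units.val_mul, Matrix.det_mul, mul_zpow,
          mul_assoc]
      · exact continuous_const.mul ((continuous_topDet.comp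
          ((continuous_id.matrix_mul continuous_const).matrix_mul continuous_const)).pow N)
      -- After the projection to the first `n` coordinates the top minor is multiplicative, so its
      -- dependence on `p` separates.
      · have : p * (incl h * (incl h)ᵀ) * M.val * incl h =
            (p * incl h) * ((incl h)ᵀ * (M.val * incl h)) := by
          simp only [Matrix.mul_assoc]
        simp only [this, topDet_mul, mul_pow]
        ring
  have hright : ∀ u : V, ∃ E : (Fin n → ℂ) → ℂ,
      (∀ q, lV (ρV q u) = q.val.det ^ e * E (firstRow q.val)) ∧ Continuous E := by
    obtain ⟨v₀, hv₀, hspan⟩ := hM.orbit_right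
    intro u
    have hu : u ∈ Submodule.span ℂ (Set.range fun q => ρV q v₀) :=
      hspan.symm ▸ Submodule.mem_top
    induction hu using Submodule.span_induction with
    | zero => exact ⟨fun _ => 0, by simp, continuous_const⟩
    | add w w' _ _ hw hw' =>
      obtain ⟨E, h1, h2⟩ := hw
      obtain ⟨E', h1', h2'⟩ := hw'
      exact ⟨fun p => E p + E' p, fun p => by rw [map_add, map_add, h1, h1', mul_add],
        h2.add h2'⟩
    | smul c w _ hw =>
      obtain ⟨E, h1, h2⟩ := hw
      exact ⟨fun p => c * E p, fun p => by rw [map_smul, map_smul, h1, smul_eq_mul]; ring,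
        continuous_const.mul h2⟩
    | mem w hw =>
      obtain ⟨M, rfl⟩ := hw
      refine ⟨fun r => M.val.det ^ e * ∏ i : Fin n, (r ᵥ* M.val) ⟨0, i.pos⟩ ^ v,
        fun q => ?_, ?_⟩
      · rw [← Module.End.mul_apply, ← map_mul, hv₀, Units.val_mul, Matrix.det_mul, mul_zpow,
          mul_assoc]
        rfl
      · refine continuous_const.mul (continuous_finsetProd _ fun i _ => Continuous.pow ?_ v)
        exact (continuous_apply _).comp (continuous_id.matrix_vecMul continuous_const)
  induction T using TensorProduct.induction_on with
  | zero => exact ⟨fun _ _ => 0, fun _ => 0, by simp, fun _ => continuous_const,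
      continuous_const, by simp⟩
  | tmul w u =>
    obtain ⟨E, z, h1, h2, h3⟩ := hleft w
    obtain ⟨E', h1', h2'⟩ := hright u
    refine ⟨fun p r => E p * E' r, fun r => z * E' r, fun p q => ?_,
      fun r => h2.mul continuous_const, continuous_const.mul h2', fun p r => ?_⟩
    · rw [test_tmul, h1, h1']
      ring
    · simp only [h3, mul_assoc]
  | add T T' hT hT' =>
    obtain ⟨E, z, h1, h2, h3, h4⟩ := hT
    obtain ⟨E', z', h1', h2', h3', h4'⟩ := hT'
    exact ⟨fun p r => E p r + E' p r, fun r => z r + z' r,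
      fun p q => by rw [map_add, h1, h1', mul_add], fun r => (h2 r).add (h2' r), h3.add h3',
      fun p r => by simp only [h4, h4', mul_add]⟩

lemma topDet_incl : topDet h (incl h) = 1 := by
  rw [topDet_eq, transpose_incl_mul_incl, Matrix.det_one]

lemma coeffFun_one_onesRow : coeffFun h a e N v 1 (onesRow n) = 1 := by
  simp [coeffFun, det_onesRow, firstRow_onesRow, topDet_incl]

/-- `T` transforms by a character under the centralizer of the torus `A` in the diagonal torus. -/
def IsTorusSemiInvariant (h : n ≤ m) (ρW : Representation ℂ (GL (Fin m) ℂ) W)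
    (ρV : Representation ℂ (GL (Fin n) ℂ) V) (a b : ℤ) (T : W ⊗[ℂ] V) : Prop :=
  ∀ (d : Fin m → ℂˣ) (t : Fin n → ℂˣ), (∀ i, d (Fin.castLE h i) = t i) →
    TensorProduct.map (ρW (diagGL d)) (ρV (diagGL t)) T =
      ((∏ i, (d i : ℂ)) ^ a * (∏ i, (t i : ℂ)) ^ b) • T

/-- The diagonal matrix with `t` in the first `n` places and `s` in the remaining ones. -/
def extendDiag (_ : n ≤ m) {α : Type*} (t : Fin n → α) (s : α) (i : Fin m) : α :=
  if hi : (i : ℕ) < n then t ⟨i, hi⟩ else s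

lemma extendDiag_castLE {α : Type*} (t : Fin n → α) (s : α) (i : Fin n) :
    extendDiag h t s (Fin.castLE h i) = t i := by
  simp [extendDiag]

lemma diagonal_extendDiag_zero :
    Matrix.diagonal (extendDiag h (fun _ => (1 : ℂ)) 0) = incl h * (incl h)ᵀ := by
  ext i j
  rw [Matrix.mul_apply, Matrix.diagonal_apply]
  by_cases hi : (i : ℕ) < n
  · obtain ⟨i', rfl⟩ : ∃ i', i = Fin.castLE h i' := ⟨⟨i, hi⟩, rfl⟩
    rw [extendDiag_castLE, Finset.sum_eq_single i']
    · simp [incl, eq_comm]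
    · intro k _ hk
      simp [incl, (castLE_injective' h).eq_iff, hk.symm]
    · simp
  · have hne : ∀ k : Fin n, i ≠ Fin.castLE h k := fun k e => hi (e ▸ k.2)
    simp [extendDiag, hi, incl, hne]

lemma diagonal_mul_incl (t : Fin n → ℂ) (s : ℂ) :
    Matrix.diagonal (extendDiag h t s) * incl h = incl h * Matrix.diagonal t := by
  ext i j
  by_cases hij : i = Fin.castLE h j
  · subst hij
    simp [incl, extendDiag_castLE]
  · simp [incl, hij]

lemma prod_extendDiag_one (t : Fin n → ℂ) : ∏ i, extendDiag h t 1 i = ∏ i, t i := by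
  obtain ⟨d, rfl⟩ := Nat.exists_eq_add_of_le h
  rw [Fin.prod_univ_add]
  simp [extendDiag]

lemma coe_extendDiag (t : Fin n → ℂˣ) (s : ℂˣ) (i : Fin m) :
    ((extendDiag h t s i : ℂˣ) : ℂ) = extendDiag h (fun i => (t i : ℂ)) (s : ℂ) i := by
  unfold extendDiag
  split_ifs <;> rfl

/-- Semi-invariant vectors form at most a line. Two kinds of torus elements determine the
coefficients: those acting on the last `m - n` coordinates fix the dependence on `p`, the others fix
the dependence on the first row of `q`. -/
theorem IsModel.test_eq_mul_coeffFun (hM : IsModel h ρW ρV a e N v lW lV) (hb : b = N + e + v)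
    {T : W ⊗[ℂ] V} (hT : IsTorusSemiInvariant h ρW ρV a b T) (p : GL (Fin m) ℂ)
    (q : GL (Fin n) ℂ) :
    test ρW ρV lW lV p q T = test ρW ρV lW lV 1 (onesRow n) T * coeffFun h a e N v p q := by
  obtain ⟨E, E', h1, h2, h3, h4⟩ := hM.exists_normalForm T
  have hE : ∀ (p : GL (Fin m) ℂ) (q : GL (Fin n) ℂ), E p.val (firstRow q.val) =
      topDet h (p.val * incl h) ^ N * E' (firstRow q.val) := by
    intro p q
    rw [← h4, ← diagonal_extendDiag_zero]
    -- The element `diag(1, …, 1, s, …, s)` leaves the normal form `E` unchanged for `s ≠ 0`; by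
    -- continuity `s = 0` is allowed, and there the diagonal matrix is the projection `incl h *
    -- (incl h)ᵀ`.
    set f : ℂ → ℂ := fun s =>
      E (p.val * Matrix.diagonal (extendDiag h (fun _ => (1 : ℂ)) s)) (firstRow q.val) with hf
    have hcont : Continuous f := by
      refine (h2 _).comp (continuous_const.matrix_mul (Continuous.matrix_diagonal ?_))
      refine continuous_pi fun i => ?_
      unfold extendDiag
      split_ifs
      · exact continuous_const
      · exact continuous_id
    have hconst : f = fun _ => E p.val (firstRow q.val) := by
      refine Continuous.ext_on (dense_compl_singleton (0 : ℂ)) hcont continuous_const fun s hs => ?_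
      have e1 := hT (extendDiag h 1 (Units.mk0 s hs)) 1 (extendDiag_castLE _ _)
      have e2 := congrArg (test ρW ρV lW lV p q) e1
      rw [test_map, map_smul, h1, h1] at e2
      have e3 : (diagGL (extendDiag h 1 (Units.mk0 s hs))).val =
          Matrix.diagonal (extendDiag h (fun _ => (1 : ℂ)) s) := by
        rw [coe_diagGL]
        congr 1
        funext i
        rw [coe_extendDiag]
        rfl
      have e4 : (diagGL (1 : Fin n → ℂˣ)).val = 1 := by
        rw [coe_diagGL]
        simp
      have e5 : (∏ i, ((extendDiag h 1 (Units.mk0 s hs) i : ℂˣ) : ℂ)) =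
          (diagGL (extendDiag h 1 (Units.mk0 s hs))).val.det := by
        rw [coe_diagGL, Matrix.det_diagonal]
      rw [e5, Units.val_mul, Units.val_mul, Matrix.det_mul, Matrix.det_mul, e4, mul_one,
        Matrix.det_one, mul_one, mul_zpow, e3] at e2
      have d1 := zpow_ne_zero a (det_coe_ne_zero p)
      have d2 := zpow_ne_zero e (det_coe_ne_zero q)
      have d3 := zpow_ne_zero a (det_coe_ne_zero (diagGL (extendDiag h 1 (Units.mk0 s hs))))
      rw [e3] at d3
      have d4 : (∏ i, (((1 : Fin n → ℂˣ) i : ℂˣ) : ℂ)) ^ b = 1 := by simp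
      rw [d4, mul_one, smul_eq_mul] at e2
      refine mul_left_cancel₀ (mul_ne_zero (mul_ne_zero d1 d2) d3) ?_
      linear_combination e2
    exact (congrFun hconst 0).symm
  -- Evaluated at `onesRow n`, whose first row times `diag(t)` is `t`. Comparing powers of `∏ t_i`
  -- leaves `b - N - e = v`.
  have hE' : ∀ t : Fin n → ℂ, E' t = (∏ i, t i ^ v) * E' 1 := by
    have hdense : Dense (Set.univ.pi fun _ : Fin n => ({0}ᶜ : Set ℂ)) :=
      dense_pi _ fun _ _ => dense_compl_singleton _
    refine congrFun (g := fun t => (∏ i, t i ^ v) * E' 1) (Continuous.ext_on hdense h3 ?_ ?_)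
    · exact (continuous_finsetProd _ fun i _ => (continuous_apply i).pow v).mul continuous_const
    · intro t ht
      have ht' : ∀ i, t i ≠ 0 := fun i => ht i trivial
      set t' : Fin n → ℂˣ := fun i => Units.mk0 (t i) (ht' i) with htt
      have e1 := hT (extendDiag h t' 1) t' (extendDiag_castLE _ _)
      have e2 := congrArg (test ρW ρV lW lV 1 (onesRow n)) e1
      have e3 : (diagGL (extendDiag h t' 1)).val = Matrix.diagonal (extendDiag h t 1) := by
        rw [coe_diagGL]
        congr 1
        funext i
        rw [coe_extendDiag]
        rfl
      have e4 : (diagGL t').val = Matrix.diagonal t := rfl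
      have e5 : (∏ i, ((extendDiag h t' 1 i : ℂˣ) : ℂ)) = ∏ i, t i := by
        rw [← prod_extendDiag_one (h := h)]
        refine Finset.prod_congr rfl fun i _ => ?_
        rw [coe_extendDiag]
        rfl
      have e6 : firstRow (onesRow n).val = 1 := funext firstRow_onesRow
      have e7 : firstRow ((onesRow n).val * Matrix.diagonal t) = t := by
        funext i
        have := firstRow_onesRow i
        rw [firstRow] at this ⊢
        rw [Matrix.mul_diagonal, this, one_mul]
      have e8 : (∏ i, ((t' i : ℂˣ) : ℂ)) = ∏ i, t i := rfl
      have hP : ∏ i, t i ≠ 0 := Finset.prod_ne_zero_iff.2 fun i _ => ht' i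
      rw [test_map, map_smul, h1, h1, hE, hE, e5, e8] at e2
      simp only [one_mul, Matrix.one_mul, Units.val_mul, Units.val_one, e3, e4, Matrix.det_diagonal,
        prod_extendDiag_one, Matrix.det_mul, det_onesRow, e6, e7, diagonal_mul_incl, topDet_mul,
        topDet_incl, Matrix.det_one, _root_.one_zpow, one_pow, smul_eq_mul, hb,
        zpow_add₀ hP, zpow_natCast] at e2
      have d1 := zpow_ne_zero a hP
      have d2 := zpow_ne_zero e hP
      have d3 := pow_ne_zero N hP
      change E' t = (∏ i, t i ^ v) * E' 1
      rw [Finset.prod_pow]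
      refine mul_left_cancel₀ (mul_ne_zero (mul_ne_zero d1 d2) d3) ?_
      linear_combination e2
  have key : ∀ p q, test ρW ρV lW lV p q T = E' 1 * coeffFun h a e N v p q := by
    intro p q
    rw [h1, hE, hE', coeffFun]
    ring
  rw [key, key 1, coeffFun_one_onesRow, mul_one]

end Tests

/-! ### The radial part on spherical functions: existence -/

section Existence

lemma DiffOp.apply_add {n : ℕ} (R : DiffOp n) {ψ ψ' : (Fin n → ℂ) → ℂ} {x : Fin n → ℂ}
    (hψ : AnalyticAt ℂ ψ x) (hψ' : AnalyticAt ℂ ψ' x) :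
    R.apply (fun y => ψ y + ψ' y) x = R.apply ψ x + R.apply ψ' x := by
  simp only [DiffOp.apply, ← Finset.sum_add_distrib, ← mul_add]
  refine Finset.sum_congr rfl fun k _ => Finset.sum_congr rfl fun I _ => ?_
  have := iteratedFDeriv_add_apply (𝕜 := ℂ) (i := k) (hψ.contDiffAt) (hψ'.contDiffAt)
  change _ * iteratedFDeriv ℂ k (ψ + ψ') x _ = _
  rw [this]
  rfl

lemma DiffOp.apply_const_mul {n : ℕ} (R : DiffOp n) {ψ : (Fin n → ℂ) → ℂ} {x : Fin n → ℂ}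
    (hψ : AnalyticAt ℂ ψ x) (c : ℂ) :
    R.apply (fun y => c * ψ y) x = c * R.apply ψ x := by
  simp only [DiffOp.apply, Finset.mul_sum]
  refine Finset.sum_congr rfl fun k _ => Finset.sum_congr rfl fun I _ => ?_
  have := iteratedFDeriv_const_smul_apply (𝕜 := ℂ) (i := k) (a := c) (hψ.contDiffAt)
  change _ * iteratedFDeriv ℂ k (c • ψ) x _ = _
  rw [this, _root_.smul_apply, smul_eq_mul]
  ring

variable {m n : ℕ} {h : n ≤ m} {W V : Type*} [AddCommGroup W] [Module ℂ W]
  [AddCommGroup V] [Module ℂ V] {ρW : Representation ℂ (GL (Fin m) ℂ) W}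
  {ρV : Representation ℂ (GL (Fin n) ℂ) V} {a b e : ℤ} {N v : ℕ}
  {lW : Module.Dual ℂ W} {lV : Module.Dual ℂ V} {f : GL (Fin m ⊕ Fin n) ℂ → W ⊗[ℂ] V}

lemma kEmb_diagGL_mul_expA {d : Fin m → ℂˣ} {t : Fin n → ℂˣ}
    (hd : ∀ i, d (Fin.castLE h i) = t i) (x : Fin n → ℂ) :
    kEmb (diagGL d) (diagGL t) * expA h x = expA h x * kEmb (diagGL d) (diagGL t) := by
  refine expGL_conj ?_
  have hk : (kEmb (diagGL d) (diagGL t)).val =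
      Matrix.diagonal (Sum.elim (fun i => (d i : ℂ)) fun i => (t i : ℂ)) :=
    Matrix.fromBlocks_diagonal _ _
  rw [hk, aMat, Finset.mul_sum, Finset.sum_mul]
  refine Finset.sum_congr rfl fun i _ => ?_
  rw [Matrix.mul_smul, Matrix.smul_mul]
  congr 1
  ext p q
  simp only [Matrix.diagonal_mul, Matrix.mul_diagonal, Matrix.add_apply, Matrix.single_apply]
  by_cases h1 : Sum.inr i = p ∧ Sum.inl (Fin.castLE h i) = q
  · obtain ⟨rfl, rfl⟩ := h1
    simp [hd]
  · by_cases h2 : Sum.inl (Fin.castLE h i) = p ∧ Sum.inr i = q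
    · obtain ⟨rfl, rfl⟩ := h2
      simp [hd]
    · simp [h1, h2]

lemma IsSphericalFunction.isTorusSemiInvariant (hf : IsSphericalFunction ρW ρV a b f)
    (h : n ≤ m) (x : Fin n → ℂ) : IsTorusSemiInvariant h ρW ρV a b (f (expA h x)) := by
  intro d t hd
  rw [← hf.left, kEmb_diagGL_mul_expA hd, hf.right, coe_diagGL, coe_diagGL, Matrix.det_diagonal,
    Matrix.det_diagonal]

/-- The scalar function on `A` representing a spherical function. -/
def scalarPart (h : n ≤ m) (ρW : Representation ℂ (GL (Fin m) ℂ) W)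
    (ρV : Representation ℂ (GL (Fin n) ℂ) V) (lW : Module.Dual ℂ W) (lV : Module.Dual ℂ V)
    (f : GL (Fin m ⊕ Fin n) ℂ → W ⊗[ℂ] V) (y : Fin n → ℂ) : ℂ :=
  test ρW ρV lW lV 1 (onesRow n) (f (expA h y))

lemma IsSphericalFunction.test_expA (hf : IsSphericalFunction ρW ρV a b f)
    (hM : IsModel h ρW ρV a e N v lW lV) (hb : b = N + e + v) (p : GL (Fin m) ℂ)
    (q : GL (Fin n) ℂ) (y : Fin n → ℂ) :
    test ρW ρV lW lV p q (f (expA h y)) =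
      scalarPart h ρW ρV lW lV f y * coeffFun h a e N v p q :=
  hM.test_eq_mul_coeffFun hb (hf.isTorusSemiInvariant h y) p q

lemma IsSphericalFunction.analyticAt_scalarPart (hf : IsSphericalFunction ρW ρV a b f)
    (y : Fin n → ℂ) : AnalyticAt ℂ (scalarPart h ρW ρV lW lV f) y :=
  (hf.polynomial (test ρW ρV lW lV 1 (onesRow n))).analyticAt_expA h y

/-- Both sides are linear in the functional, so translates of the model functional suffice. Left
equivariance turns such a translate at `e^{a}` into the fixed scalar function `φ` at `k e^{a}`,
where the radial computation applies. -/
theorem isRadialPartOfCasimir_radialOp (hM : IsModel h ρW ρV a e N v lW lV)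
    (hb : b = N + e + v) :
    IsRadialPartOfCasimir h ρW ρV a b (radialOp m n a b ((a : ℂ) + N) N v) := by
  intro f hf l x hx
  refine hM.dual_induction (C := fun l => casimirOp (fun g => l (f g)) (expA h x) =
    (radialOp m n a b ((a : ℂ) + N) N v).apply (fun y => l (f (expA h y))) x) ?_ ?_ ?_ ?_ l
  · intro p q
    set φ : GL (Fin m ⊕ Fin n) ℂ → ℂ := fun g => test ρW ρV lW lV 1 1 (f g) with hφ
    have htr : ∀ p q g, φ (kEmb p q * g) = test ρW ρV lW lV p q (f g) := by
      intro p q g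
      simp only [hφ, hf.left, test_map, one_mul]
    have hright : IsRightEquivariant a b φ := ⟨hf.polynomial _, fun g k₁ k₂ => by
      simp only [hφ, hf.right, map_smul, smul_eq_mul]⟩
    have key := casimirOp_eq_radialOp_apply (isSemiInvariantCoeff_coeffFun h a e N v) hright
      hf.analyticAt_scalarPart (fun y p q => (htr p q _).trans (hf.test_expA hM hb p q y)) hx p q
    have e1 : (fun g => test ρW ρV lW lV p q (f g)) = fun g => φ (kEmb p q * g) :=
      funext fun g => (htr p q g).symm
    rw [e1, casimirOp_translate, key, mul_comm,
      ← DiffOp.apply_const_mul _ (hf.analyticAt_scalarPart x)]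
    congr 1
    funext y
    rw [hf.test_expA hM hb, mul_comm]
  · have h0 := casimirOp_smul (isPolynomialFunction_const (ι := Fin m ⊕ Fin n) 0) 0 (expA h x)
    have h1 := DiffOp.apply_const_mul (radialOp m n a b ((a : ℂ) + N) N v)
      (ψ := fun _ => 0) (x := x) analyticAt_const 0
    simp only [zero_mul, zero_smul] at h0 h1
    exact h0.trans h1.symm
  · intro l l' hl hl'
    have e1 := casimirOp_add (hf.polynomial l) (hf.polynomial l') (expA h x)
    have e2 := DiffOp.apply_add (radialOp m n a b ((a : ℂ) + N) N v)
      ((hf.polynomial l).analyticAt_expA h x) ((hf.polynomial l').analyticAt_expA h x)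
    exact e1.trans ((congrArg₂ _ hl hl').trans e2.symm)
  · intro c l hl
    have e1 := casimirOp_smul (hf.polynomial l) c (expA h x)
    have e2 := DiffOp.apply_const_mul (radialOp m n a b ((a : ℂ) + N) N v)
      ((hf.polynomial l).analyticAt_expA h x) c
    exact e1.trans ((congrArg _ hl).trans e2.symm)

end Existence

/-! ### Construction of spherical functions -/

section Construction

variable {m n : ℕ} {h : n ≤ m}

/-- The matrix with rows `ξ, ξ M, ξ M², …`. -/
def krylov (ξ : Fin n → ℂ) (M : Matrix (Fin n) (Fin n) ℂ) : Matrix (Fin n) (Fin n) ℂ :=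
  Matrix.of fun j => ξ ᵥ* M ^ (j : ℕ)

lemma mul_mul_pow {K K' : Matrix (Fin n) (Fin n) ℂ} (hK : K * K' = 1)
    (M : Matrix (Fin n) (Fin n) ℂ) (j : ℕ) : (K * M * K') ^ j = K * M ^ j * K' := by
  have hK' : K' * K = 1 := mul_eq_one_comm.1 hK
  induction j with
  | zero => simp [hK]
  | succ j ih =>
    have : K * M ^ j * K' * (K * M * K') = K * M ^ j * (K' * K) * M * K' := by
      simp only [Matrix.mul_assoc]
    rw [pow_succ, ih, this, hK', pow_succ, Matrix.mul_one, Matrix.mul_assoc K]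

/-- This makes the determinant of `krylov` equivariant: conjugating the matrix amounts to moving the
row, up to the determinant of `K'`. -/
lemma krylov_conj {K K' : Matrix (Fin n) (Fin n) ℂ} (hK : K * K' = 1) (ξ : Fin n → ℂ)
    (M : Matrix (Fin n) (Fin n) ℂ) : krylov ξ (K * M * K') = krylov (ξ ᵥ* K) M * K' := by
  ext j i
  change (ξ ᵥ* (K * M * K') ^ (j : ℕ)) i = (((ξ ᵥ* K) ᵥ* M ^ (j : ℕ)) ᵥ* K') i
  rw [mul_mul_pow hK, Matrix.vecMul_vecMul, Matrix.vecMul_vecMul,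
    Matrix.mul_assoc]

/-- The determinant of `krylov`, as a polynomial in `ξ`. -/
def krylovPoly (M : Matrix (Fin n) (Fin n) ℂ) : MvPolynomial (Fin n) ℂ :=
  (Matrix.of fun j i : Fin n =>
    ∑ l, MvPolynomial.X l * MvPolynomial.C ((M ^ (j : ℕ)) l i)).det

lemma eval_krylovPoly (M : Matrix (Fin n) (Fin n) ℂ) (ξ : Fin n → ℂ) :
    MvPolynomial.eval ξ (krylovPoly M) = (krylov ξ M).det := by
  rw [krylovPoly, RingHom.map_det]
  congr 1
  ext j i
  simp [krylov, Matrix.vecMul, dotProduct]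

lemma isHomogeneous_krylovPoly (M : Matrix (Fin n) (Fin n) ℂ) :
    (krylovPoly M).IsHomogeneous n := by
  rw [krylovPoly, Matrix.det_apply']
  refine MvPolynomial.IsHomogeneous.sum _ _ _ fun σ _ => ?_
  rw [← map_intCast (MvPolynomial.C : ℂ →+* MvPolynomial (Fin n) ℂ)]
  refine MvPolynomial.IsHomogeneous.C_mul ?_ _
  have := MvPolynomial.IsHomogeneous.prod (Finset.univ : Finset (Fin n))
    (fun i => ∑ l, (MvPolynomial.X l : MvPolynomial (Fin n) ℂ) *
      MvPolynomial.C ((M ^ ((σ i : Fin n) : ℕ)) l i)) (fun _ => 1) fun i _ => by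
    refine MvPolynomial.IsHomogeneous.sum _ _ _ fun l _ => ?_
    rw [mul_comm]
    exact MvPolynomial.IsHomogeneous.C_mul (MvPolynomial.isHomogeneous_X ℂ l) _
  simpa using this

/-- The product `D D'` of the lower right blocks of `g` and `g⁻¹`. -/
def blockProd (g : GL (Fin m ⊕ Fin n) ℂ) : Matrix (Fin n) (Fin n) ℂ :=
  g.val.toBlocks₂₂ * (g⁻¹).val.toBlocks₂₂

lemma coe_kEmb (k₁ : GL (Fin m) ℂ) (k₂ : GL (Fin n) ℂ) :
    (kEmb k₁ k₂).val = Matrix.fromBlocks k₁.val 0 0 k₂.val := rfl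

lemma coe_kEmb_inv (k₁ : GL (Fin m) ℂ) (k₂ : GL (Fin n) ℂ) :
    ((kEmb k₁ k₂)⁻¹).val = Matrix.fromBlocks (k₁⁻¹).val 0 0 (k₂⁻¹).val := rfl

lemma fromBlocks_diag_mul (K₁ : Matrix (Fin m) (Fin m) ℂ) (K₂ : Matrix (Fin n) (Fin n) ℂ)
    (M : Matrix (Fin m ⊕ Fin n) (Fin m ⊕ Fin n) ℂ) :
    Matrix.fromBlocks K₁ 0 0 K₂ * M = Matrix.fromBlocks (K₁ * M.toBlocks₁₁) (K₁ * M.toBlocks₁₂)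
      (K₂ * M.toBlocks₂₁) (K₂ * M.toBlocks₂₂) := by
  conv_lhs => rw [← Matrix.fromBlocks_toBlocks M, Matrix.fromBlocks_multiply]
  simp

lemma mul_fromBlocks_diag (K₁ : Matrix (Fin m) (Fin m) ℂ) (K₂ : Matrix (Fin n) (Fin n) ℂ)
    (M : Matrix (Fin m ⊕ Fin n) (Fin m ⊕ Fin n) ℂ) :
    M * Matrix.fromBlocks K₁ 0 0 K₂ = Matrix.fromBlocks (M.toBlocks₁₁ * K₁) (M.toBlocks₁₂ * K₂)
      (M.toBlocks₂₁ * K₁) (M.toBlocks₂₂ * K₂) := by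
  conv_lhs => rw [← Matrix.fromBlocks_toBlocks M, Matrix.fromBlocks_multiply]
  simp

lemma blockProd_mul_kEmb (g : GL (Fin m ⊕ Fin n) ℂ) (k₁ : GL (Fin m) ℂ) (k₂ : GL (Fin n) ℂ) :
    blockProd (g * kEmb k₁ k₂) = blockProd g := by
  rw [blockProd, blockProd, _root_.mul_inv_rev, Units.val_mul, Units.val_mul, coe_kEmb, coe_kEmb_inv,
    mul_fromBlocks_diag, fromBlocks_diag_mul, Matrix.toBlocks_fromBlocks₂₂,
    Matrix.toBlocks_fromBlocks₂₂, Matrix.mul_assoc, ← Matrix.mul_assoc k₂.val, ← Units.val_mul,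
    mul_inv_cancel, Units.val_one, Matrix.one_mul]

lemma blockProd_kEmb_mul (g : GL (Fin m ⊕ Fin n) ℂ) (k₁ : GL (Fin m) ℂ) (k₂ : GL (Fin n) ℂ) :
    blockProd (kEmb k₁ k₂ * g) = k₂.val * blockProd g * (k₂⁻¹).val := by
  rw [blockProd, blockProd, _root_.mul_inv_rev, Units.val_mul, Units.val_mul, coe_kEmb, coe_kEmb_inv,
    mul_fromBlocks_diag, fromBlocks_diag_mul, Matrix.toBlocks_fromBlocks₂₂,
    Matrix.toBlocks_fromBlocks₂₂]
  simp only [Matrix.mul_assoc]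

lemma isPolynomialMatrix_blockProd :
    IsPolynomialMatrix (blockProd : GL (Fin m ⊕ Fin n) ℂ → _) :=
  IsPolynomialMatrix.mul (fun _ _ => isPolynomialMatrix_val _ _)
    (fun i j => isPolynomialMatrix_inv (Sum.inr i) (Sum.inr j))

lemma isPolynomialMatrix_krylov (ξ : Fin n → ℂ) :
    IsPolynomialMatrix fun g : GL (Fin m ⊕ Fin n) ℂ => krylov ξ (blockProd g) := by
  intro i j
  simp only [krylov, Matrix.of_apply, Matrix.vecMul, dotProduct]
  exact isPolynomialFunction_sum _ fun l =>
    (isPolynomialFunction_const _).mul (isPolynomialMatrix_blockProd.pow _ _ _)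

variable {W V : Type*} [AddCommGroup W] [Module ℂ W]
  [AddCommGroup V] [Module ℂ V] {ρW : Representation ℂ (GL (Fin m) ℂ) W}
  {ρV : Representation ℂ (GL (Fin n) ℂ) V} {a b e z : ℤ} {N v k : ℕ}
  {lW : Module.Dual ℂ W} {lV : Module.Dual ℂ V}

/-- The matrix coefficients of the basic spherical function. -/
def baseCoeff (h : n ≤ m) (a e z : ℤ) (N v k : ℕ) (g : GL (Fin m ⊕ Fin n) ℂ) (p : GL (Fin m) ℂ)
    (q : GL (Fin n) ℂ) : ℂ :=
  g.val.toBlocks₁₁.det ^ k * g.val.det ^ z *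
    ((p.val.det ^ a * topDet h (p.val * g.val.toBlocks₁₂) ^ N) *
      (q.val.det ^ e * (krylov (firstRow q.val) (blockProd g)).det ^ v))

/-- The `W` component is the model vector attached to the upper right block of `g`. The `V`
component is the `v`-th power of the determinant of `krylov`, a form of degree `n v` in the first
row. -/
lemma IsModel.exists_baseFunction (hM : IsModel h ρW ρV a e N v lW lV) (z : ℤ) (k : ℕ) :
    ∃ f : GL (Fin m ⊕ Fin n) ℂ → W ⊗[ℂ] V, ∀ g p q,
      test ρW ρV lW lV p q (f g) = baseCoeff h a e z N v k g p q := by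
  choose w hw using hM.vector_left
  have hP : ∀ M : Matrix (Fin n) (Fin n) ℂ, ∃ u, ∀ q : GL (Fin n) ℂ,
      lV (ρV q u) = q.val.det ^ e * (krylov (firstRow q.val) M).det ^ v := by
    intro M
    obtain ⟨u, hu⟩ := hM.vector_right (krylovPoly M ^ v) ((isHomogeneous_krylovPoly M).pow v)
    exact ⟨u, fun q => by rw [hu, map_pow, eval_krylovPoly]⟩
  choose u hu using hP
  refine ⟨fun g => (g.val.toBlocks₁₁.det ^ k * g.val.det ^ z) •
    (w g.val.toBlocks₁₂ ⊗ₜ u (blockProd g)), fun g p q => ?_⟩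
  rw [map_smul, test_tmul, hw, hu, smul_eq_mul, baseCoeff]

/-- `blockProd` is right invariant. The exponents add up to `k + z` for `k₁` and to `z + N` for
`k₂`, the `N` coming from the minor of the upper right block. -/
lemma baseCoeff_mul_kEmb (hz₁ : k + z = a) (hz₂ : z + N = b) (g : GL (Fin m ⊕ Fin n) ℂ)
    (k₁ p : GL (Fin m) ℂ) (k₂ q : GL (Fin n) ℂ) :
    baseCoeff h a e z N v k (g * kEmb k₁ k₂) p q =
      (k₁.val.det ^ a * k₂.val.det ^ b) * baseCoeff h a e z N v k g p q := by
  have h1 := det_coe_ne_zero k₁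
  have h2 := det_coe_ne_zero k₂
  have e1 : (kEmb k₁ k₂).val.det = k₁.val.det * k₂.val.det := by
    rw [coe_kEmb, Matrix.det_fromBlocks_zero₁₂]
  simp only [baseCoeff, blockProd_mul_kEmb]
  rw [Units.val_mul, Matrix.det_mul, e1, coe_kEmb, mul_fromBlocks_diag,
    Matrix.toBlocks_fromBlocks₁₁, Matrix.toBlocks_fromBlocks₁₂, Matrix.det_mul,
    ← Matrix.mul_assoc, topDet_mul, ← hz₂, zpow_add₀ h2, mul_pow, mul_pow, mul_zpow, mul_zpow]
  have e2 : k₁.val.det ^ a = k₁.val.det ^ k * k₁.val.det ^ z := by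
    rw [← hz₁, zpow_add₀ h1, zpow_natCast]
  rw [e2, zpow_natCast]
  ring

/-- `blockProd` is conjugated by `k₂`, so `krylov_conj` contributes `det(k₂)^(-v)`, which accounts
for `e = z - v`. -/
lemma baseCoeff_kEmb_mul (hz₁ : k + z = a) (he : e = z - v) (g : GL (Fin m ⊕ Fin n) ℂ)
    (k₁ p : GL (Fin m) ℂ) (k₂ q : GL (Fin n) ℂ) :
    baseCoeff h a e z N v k (kEmb k₁ k₂ * g) p q =
      baseCoeff h a e z N v k g (p * k₁) (q * k₂) := by
  have h1 := det_coe_ne_zero k₁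
  have h2 := det_coe_ne_zero k₂
  have e1 : (kEmb k₁ k₂).val.det = k₁.val.det * k₂.val.det := by
    rw [coe_kEmb, Matrix.det_fromBlocks_zero₁₂]
  have e0 : k₂.val * (k₂⁻¹).val = 1 := by rw [← Units.val_mul, mul_inv_cancel, Units.val_one]
  have e3 : (k₂⁻¹).val.det = (k₂.val.det)⁻¹ := by
    refine eq_inv_of_mul_eq_one_right ?_
    rw [← Matrix.det_mul, e0, Matrix.det_one]
  have e4 : firstRow (q.val * k₂.val) = firstRow q.val ᵥ* k₂.val := rfl
  simp only [baseCoeff, blockProd_kEmb_mul]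
  rw [krylov_conj e0, Matrix.det_mul, e3, Units.val_mul, Units.val_mul, Units.val_mul, e4,
    Matrix.det_mul, Matrix.det_mul, Matrix.det_mul, e1, coe_kEmb, fromBlocks_diag_mul,
    Matrix.toBlocks_fromBlocks₁₁, Matrix.toBlocks_fromBlocks₁₂, Matrix.det_mul,
    ← Matrix.mul_assoc, mul_pow, mul_pow, mul_zpow, mul_zpow, mul_zpow, mul_zpow]
  have e2 : k₁.val.det ^ a = k₁.val.det ^ k * k₁.val.det ^ z := by
    rw [← hz₁, zpow_add₀ h1, zpow_natCast]
  have e5 : k₂.val.det ^ e = k₂.val.det ^ z * (k₂.val.det)⁻¹ ^ v := by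
    rw [he, zpow_sub₀ h2, zpow_natCast, inv_pow, div_eq_mul_inv]
  rw [e2, e5]
  ring

lemma isPolynomialFunction_baseCoeff (p : GL (Fin m) ℂ) (q : GL (Fin n) ℂ) :
    IsPolynomialFunction fun g => baseCoeff h a e z N v k g p q := by
  have h1 : IsPolynomialMatrix fun g : GL (Fin m ⊕ Fin n) ℂ => g.val.toBlocks₁₁ :=
    fun i j => isPolynomialMatrix_val _ _
  have h2 : IsPolynomialMatrix fun g : GL (Fin m ⊕ Fin n) ℂ => g.val.toBlocks₁₂ :=
    fun i j => isPolynomialMatrix_val _ _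
  have h3 : IsPolynomialFunction fun g : GL (Fin m ⊕ Fin n) ℂ =>
      topDet h (p.val * g.val.toBlocks₁₂) := by
    simp only [topDet_eq]
    exact ((isPolynomialMatrix_const _).mul ((isPolynomialMatrix_const _).mul h2)).det
  exact ((h1.det.pow k).mul (isPolynomialFunction_det_zpow z)).mul
    (((isPolynomialFunction_const _).mul (h3.pow N)).mul
      ((isPolynomialFunction_const _).mul ((isPolynomialMatrix_krylov _).det.pow v)))

/-- The values of the bi-invariant functions `tr (D D')^{j+1}`. -/
def invariants (g : GL (Fin m ⊕ Fin n) ℂ) (j : Fin n) : ℂ := (blockProd g ^ (j + 1 : ℕ)).trace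

lemma invariants_mul_kEmb (g : GL (Fin m ⊕ Fin n) ℂ) (k₁ : GL (Fin m) ℂ) (k₂ : GL (Fin n) ℂ) :
    invariants (g * kEmb k₁ k₂) = invariants g := by
  funext j
  rw [invariants, invariants, blockProd_mul_kEmb]

lemma invariants_kEmb_mul (g : GL (Fin m ⊕ Fin n) ℂ) (k₁ : GL (Fin m) ℂ) (k₂ : GL (Fin n) ℂ) :
    invariants (kEmb k₁ k₂ * g) = invariants g := by
  funext j
  have e0 : k₂.val * (k₂⁻¹).val = 1 := by rw [← Units.val_mul, mul_inv_cancel, Units.val_one]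
  rw [invariants, invariants, blockProd_kEmb_mul, mul_mul_pow e0, Matrix.trace_mul_comm,
    ← Matrix.mul_assoc, mul_eq_one_comm.1 e0, Matrix.one_mul]

lemma isPolynomialFunction_eval_invariants (Q : MvPolynomial (Fin n) ℂ) :
    IsPolynomialFunction fun g : GL (Fin m ⊕ Fin n) ℂ => MvPolynomial.eval (invariants g) Q := by
  induction Q using MvPolynomial.induction_on with
  | C c => simpa using isPolynomialFunction_const c
  | add P Q hP hQ => simpa using hP.add hQ
  | mul_X P j hP =>
    have : IsPolynomialFunction fun g : GL (Fin m ⊕ Fin n) ℂ => invariants g j :=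
      isPolynomialFunction_sum (f := fun i g => (blockProd g ^ (j + 1 : ℕ)) i i) Finset.univ
        fun i => isPolynomialMatrix_blockProd.pow _ i i
    simpa using hP.mul this

theorem IsModel.isSphericalFunction (hM : IsModel h ρW ρV a e N v lW lV) (hz₁ : k + z = a)
    (hz₂ : z + N = b) (he : e = z - v) {f : GL (Fin m ⊕ Fin n) ℂ → W ⊗[ℂ] V}
    (hf : ∀ g p q, test ρW ρV lW lV p q (f g) = baseCoeff h a e z N v k g p q)
    (Q : MvPolynomial (Fin n) ℂ) :
    IsSphericalFunction ρW ρV a b fun g => MvPolynomial.eval (invariants g) Q • f g := by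
  refine ⟨fun l => ?_, fun g k₁ k₂ => ?_, fun g k₁ k₂ => ?_⟩
  · simp only [map_smul, smul_eq_mul]
    refine (isPolynomialFunction_eval_invariants Q).mul ?_
    refine hM.dual_induction (C := fun l => IsPolynomialFunction fun g => l (f g)) ?_ ?_ ?_ ?_ l
    · intro p q
      simp only [hf]
      exact isPolynomialFunction_baseCoeff p q
    · exact isPolynomialFunction_const 0
    · exact fun l l' hl hl' => hl.add hl'
    · exact fun c l hl => (isPolynomialFunction_const c).mul hl
  · refine hM.ext fun p q => ?_
    rw [invariants_mul_kEmb, map_smul, map_smul, map_smul, hf, hf, baseCoeff_mul_kEmb hz₁ hz₂,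
      smul_eq_mul, smul_eq_mul, smul_eq_mul]
    ring
  · refine hM.ext fun p q => ?_
    rw [test_map, invariants_kEmb_mul, map_smul, map_smul, hf, hf, baseCoeff_kEmb_mul hz₁ he]

end Construction

/-! ### Restriction to the torus -/

section Restriction

variable {m n : ℕ} {h : n ≤ m} {a e z : ℤ} {N v k : ℕ}

lemma toBlocks₂₂_expA (x : Fin n → ℂ) :
    (expA h x).val.toBlocks₂₂ = Matrix.diagonal fun i => Complex.cosh (x i) := by
  ext i j
  rw [Matrix.toBlocks₂₂, Matrix.of_apply, expA_apply_inr_inr, Matrix.diagonal_apply]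
  split_ifs with hij
  · rw [hij]
  · rfl

lemma toBlocks₁₂_expA (x : Fin n → ℂ) :
    (expA h x).val.toBlocks₁₂ = incl h * Matrix.diagonal fun i => Complex.sinh (x i) := by
  ext i j
  rw [Matrix.toBlocks₁₂, Matrix.of_apply, expA_apply_inl_inr, Matrix.mul_diagonal, incl,
    Matrix.of_apply, ite_mul, one_mul, zero_mul]

lemma toBlocks₁₁_expA (x : Fin n → ℂ) :
    (expA h x).val.toBlocks₁₁ = Matrix.diagonal (extendDiag h (fun i => Complex.cosh (x i)) 1) := by
  ext i j
  rw [Matrix.toBlocks₁₁, Matrix.of_apply, Matrix.diagonal_apply]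
  by_cases hj : (j : ℕ) < n
  · obtain ⟨j', rfl⟩ : ∃ j', j = Fin.castLE h j' := ⟨⟨j, hj⟩, rfl⟩
    have := expA_apply_inl_inl (h := h) x i j'
    rw [pairIdx] at this
    rw [this]
    split_ifs with hij
    · rw [hij, extendDiag_castLE]
    · rfl
  · rw [expA_apply_inl_of_le h x i (not_lt.1 hj)]
    split_ifs with hij
    · simp [extendDiag, hij, hj]
    · rfl

lemma blockProd_expA (x : Fin n → ℂ) :
    blockProd (expA h x) = Matrix.diagonal fun i => Complex.cosh (x i) ^ 2 := by
  have : (expA h x)⁻¹ = expA h (-x) := by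
    refine inv_eq_of_mul_eq_one_right ?_
    ext1
    exact expA_mul_neg h x
  rw [blockProd, this, toBlocks₂₂_expA, toBlocks₂₂_expA, Matrix.diagonal_mul_diagonal]
  congr 1
  funext i
  rw [Pi.neg_apply, Complex.cosh_neg, sq]

/-- The power sums of `cosh² x_i`. -/
def powerSums (x : Fin n → ℂ) (j : Fin n) : ℂ := ∑ i, (Complex.cosh (x i) ^ 2) ^ (j + 1 : ℕ)

lemma invariants_expA (x : Fin n → ℂ) : invariants (expA h x) = powerSums x := by
  funext j
  rw [invariants, blockProd_expA, Matrix.diagonal_pow, Matrix.trace_diagonal]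
  rfl

lemma cosh_sq_injective_of_regular {x : Fin n → ℂ} (hx : x ∈ regularSet n) :
    Function.Injective fun i => Complex.cosh (x i) ^ 2 := by
  intro i j hij
  by_contra hne
  refine sinh_sq_sub_ne_zero_of_regular hx hne ?_
  simp only [Complex.cosh_sq] at hij
  linear_combination hij

/-- On `A` the factors are powers of `∏ cosh x_i`, of `∏ sinh x_i`, of the Vandermonde determinant
in `cosh² x_i` and of `det e^{a(x)}`. None vanishes at a regular point. -/
lemma baseCoeff_expA_ne_zero {x : Fin n → ℂ} (hx : x ∈ regularSet n) :
    baseCoeff h a e z N v k (expA h x) 1 (onesRow n) ≠ 0 := by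
  have h1 : (krylov (firstRow (onesRow n).val) (blockProd (expA h x))) =
      (Matrix.vandermonde fun i => Complex.cosh (x i) ^ 2)ᵀ := by
    ext j i
    rw [blockProd_expA, krylov, Matrix.of_apply, Matrix.diagonal_pow, Matrix.vecMul_diagonal,
      firstRow_onesRow, one_mul, Matrix.transpose_apply, Matrix.vandermonde_apply]
    rfl
  rw [baseCoeff, h1, toBlocks₁₁_expA, toBlocks₁₂_expA, Matrix.det_transpose, Matrix.det_diagonal,
    prod_extendDiag_one, Units.val_one, Matrix.one_mul, topDet_mul, topDet_incl, det_onesRow,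
    Matrix.det_one, Matrix.det_diagonal, _root_.one_zpow, _root_.one_zpow]
  have hc : ∏ i, Complex.cosh (x i) ≠ 0 :=
    Finset.prod_ne_zero_iff.2 fun i _ => cosh_ne_zero_of_regular hx i
  have hs : ∏ i, Complex.sinh (x i) ≠ 0 :=
    Finset.prod_ne_zero_iff.2 fun i _ => sinh_ne_zero_of_regular hx i
  have hd := det_coe_ne_zero (expA h x)
  have hv := Matrix.det_vandermonde_ne_zero_iff.2 (cosh_sq_injective_of_regular hx)
  simp only [one_mul]
  exact mul_ne_zero (mul_ne_zero (pow_ne_zero _ hc) (zpow_ne_zero _ hd))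
    (mul_ne_zero (pow_ne_zero _ hs) (pow_ne_zero _ hv))

end Restriction

/-! ### Test functions on which all radial parts must agree -/

section JetFunctions

variable {m n : ℕ} {h : n ≤ m} {W V : Type*} [AddCommGroup W] [Module ℂ W]
  [AddCommGroup V] [Module ℂ V] {ρW : Representation ℂ (GL (Fin m) ℂ) W}
  {ρV : Representation ℂ (GL (Fin n) ℂ) V} {a b e z : ℤ} {N v k : ℕ}
  {lW : Module.Dual ℂ W} {lV : Module.Dual ℂ V}

/-- Two radial parts of the Casimir operator agree on a large class of functions. -/
theorem IsModel.exists_agreement (hM : IsModel h ρW ρV a e N v lW lV) (hz₁ : k + z = a)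
    (hz₂ : z + N = b) (he : e = z - v) :
    ∃ ψ₀ : (Fin n → ℂ) → ℂ, (∀ x, AnalyticAt ℂ ψ₀ x) ∧ (∀ x ∈ regularSet n, ψ₀ x ≠ 0) ∧
      ∀ R R' : DiffOp n, IsRadialPartOfCasimir h ρW ρV a b R →
        IsRadialPartOfCasimir h ρW ρV a b R' → ∀ Q : MvPolynomial (Fin n) ℂ, ∀ x ∈ regularSet n,
          R.apply (fun y => MvPolynomial.eval (powerSums y) Q * ψ₀ y) x =
            R'.apply (fun y => MvPolynomial.eval (powerSums y) Q * ψ₀ y) x := by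
  obtain ⟨f, hf⟩ := hM.exists_baseFunction z k
  refine ⟨fun y => baseCoeff h a e z N v k (expA h y) 1 (onesRow n),
    fun x => (isPolynomialFunction_baseCoeff 1 (onesRow n)).analyticAt_expA h x,
    fun x hx => baseCoeff_expA_ne_zero hx, fun R R' hR hR' Q x hx => ?_⟩
  have hs := hM.isSphericalFunction hz₁ hz₂ he hf Q
  have e1 := hR _ hs (test ρW ρV lW lV 1 (onesRow n)) x hx
  have e2 := hR' _ hs (test ρW ρV lW lV 1 (onesRow n)) x hx
  simp only [map_smul, smul_eq_mul, hf, invariants_expA] at e1 e2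
  exact e1.symm.trans e2

end JetFunctions

/-! ### Vanishing to a given order -/

section Jets

open Asymptotics

variable {E : Type*} [NormedAddCommGroup E] [NormedSpace ℂ E]

/-- An analytic function which is `O(‖y - x‖^k)` has a power series without terms of degree
less than `k`. -/
lemma exists_powerSeries_of_isBigO {f : E → ℂ} {x : E} {k : ℕ} (hf : AnalyticAt ℂ f x)
    (hO : (fun y => f (x + y)) =O[𝓝 0] fun y => ‖y‖ ^ k) :
    ∃ p : FormalMultilinearSeries ℂ E ℂ, HasFPowerSeriesAt f p x ∧ ∀ j < k, p j = 0 := by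
  obtain ⟨p, r, hp⟩ := hf
  -- Once the lower terms vanish on the diagonal, the term of degree `j` is `O(‖y‖^(j+1))`, and a
  -- homogeneous form of degree `j` with this bound is zero.
  have hdiag : ∀ j < k, ∀ y : E, (p j fun _ => y) = 0 := by
    intro j
    refine Nat.strong_induction_on j fun j ih hj => ?_
    have hsum : p.partialSum (j + 1) = fun y => p j fun _ => y := by
      funext y
      refine Finset.sum_eq_single _ (fun i hi hij => ?_) fun hn =>
        absurd (Finset.mem_range.2 (Nat.lt_succ_self j)) hn
      have hi' : i < j := lt_of_le_of_ne (Finset.mem_range_succ_iff.1 hi) hij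
      exact ih i hi' (hi'.trans hj) y
    have h1 := hp.hasFPowerSeriesAt.isBigO_sub_partialSum_pow (j + 1)
    have h2 : (fun y : E => ‖y‖ ^ k) =O[𝓝 0] fun y => ‖y‖ ^ (j + 1) := by
      refine IsBigO.of_bound 1 ?_
      filter_upwards [Metric.ball_mem_nhds (0 : E) one_pos] with y hy
      rw [mem_ball_zero_iff] at hy
      simpa using pow_le_pow_of_le_one (norm_nonneg y) hy.le hj
    have h3 := (hO.trans h2).sub h1
    simp only [sub_sub_cancel, hsum] at h3
    exact h3.continuousMultilinearMap_apply_eq_zero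
  -- The multilinear terms need not be symmetric, so vanishing on the diagonal does not make them
  -- zero. They are replaced by zero, which does not change the sum.
  refine ⟨fun j => if j < k then 0 else p j, ⟨r, ⟨?_, hp.r_pos, fun {y} hy => ?_⟩⟩, fun j hj => ?_⟩
  · refine hp.r_le.trans (FormalMultilinearSeries.radius_le_of_le fun {j} => ?_)
    split_ifs
    · simp
    · exact le_rfl
  · refine (hp.hasSum hy).congr_fun fun j => ?_
    split_ifs with hj
    · simp [hdiag j hj y]
    · rfl
  · exact if_pos hj

lemma iteratedFDeriv_eq_zero_of_isBigO {f : E → ℂ} {x : E} {k : ℕ} (hf : AnalyticAt ℂ f x)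
    (hO : (fun y => f (x + y)) =O[𝓝 0] fun y => ‖y‖ ^ k) {j : ℕ} (hj : j < k) (v : Fin j → E) :
    iteratedFDeriv ℂ j f x v = 0 := by
  obtain ⟨p, ⟨r, hp⟩, hz⟩ := exists_powerSeries_of_isBigO hf hO
  rw [hp.iteratedFDeriv_eq_sum_of_completeSpace, hz j hj]
  simp

/-- A multilinear form evaluated on close arguments. -/
lemma isBigO_multilinear_sub {k : ℕ} (c : E [×k]→L[ℂ] ℂ) {u : E → E}
    (hu : (fun y => u y - y) =O[𝓝 0] fun y => ‖y‖ ^ 2) :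
    (fun y => (c fun _ => y) - c fun _ => u y) =O[𝓝 0] fun y => ‖y‖ ^ (k + 1) := by
  rcases k with _ | k
  · have : (fun y => (c fun _ => y) - c fun _ => u y) = fun _ => 0 := by
      funext y
      rw [sub_eq_zero]
      congr 1
      exact Subsingleton.elim _ _
    rw [this]
    exact isBigO_zero _ _
  obtain ⟨C, hC⟩ := hu.bound
  refine IsBigO.of_bound (‖c‖ * (k + 1) * (1 + |C|) ^ k * |C|) ?_
  filter_upwards [hC, Metric.ball_mem_nhds (0 : E) one_pos] with y hy h1
  rw [mem_ball_zero_iff] at h1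
  have hy' : ‖u y - y‖ ≤ |C| * ‖y‖ ^ 2 := by
    refine hy.trans ?_
    rw [norm_pow, norm_norm]
    exact mul_le_mul_of_nonneg_right (le_abs_self C) (by positivity)
  have hsq : ‖y‖ ^ 2 ≤ ‖y‖ := by
    rw [sq]
    exact mul_le_of_le_one_left (norm_nonneg y) h1.le
  have hu1 : ‖u y‖ ≤ (1 + |C|) * ‖y‖ := by
    have h2 : ‖u y‖ ≤ ‖u y - y‖ + ‖y‖ := by
      simpa using norm_add_le (u y - y) y
    have h3 : |C| * ‖y‖ ^ 2 ≤ |C| * ‖y‖ := mul_le_mul_of_nonneg_left hsq (abs_nonneg C)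
    linarith
  have hmax : max ‖fun _ : Fin (k + 1) => y‖ ‖fun _ : Fin (k + 1) => u y‖ ≤ (1 + |C|) * ‖y‖ := by
    rw [pi_norm_const, pi_norm_const]
    refine max_le ?_ hu1
    nlinarith [norm_nonneg y, abs_nonneg C, mul_nonneg (abs_nonneg C) (norm_nonneg y)]
  have key := c.norm_image_sub_le (fun _ => y) (fun _ => u y)
  have hdiff : ‖(fun _ : Fin (k + 1) => y) - fun _ => u y‖ = ‖u y - y‖ := by
    change ‖fun _ : Fin (k + 1) => y - u y‖ = _
    rw [pi_norm_const, norm_sub_rev]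
  rw [hdiff, Fintype.card_fin, Nat.add_sub_cancel] at key
  refine key.trans ?_
  have e : ‖(‖y‖ ^ (k + 1 + 1) : ℝ)‖ = ‖y‖ ^ (k + 2) := by
    rw [norm_pow, norm_norm]
  rw [e]
  calc ‖c‖ * ((k + 1 : ℕ) : ℝ) * max ‖fun _ : Fin (k + 1) => y‖ ‖fun _ : Fin (k + 1) => u y‖ ^ k *
        ‖u y - y‖ ≤ ‖c‖ * ((k + 1 : ℕ) : ℝ) * ((1 + |C|) * ‖y‖) ^ k * (|C| * ‖y‖ ^ 2) := by
        gcongr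
    _ = ‖c‖ * (k + 1) * (1 + |C|) ^ k * |C| * ‖y‖ ^ (k + 2) := by
        rw [mul_pow]
        push_cast
        ring

/-- An analytic map tangent to the identity differs from it in second order. -/
lemma isBigO_sub_id_of_hasFDerivAt {u : E → E} (hu : AnalyticAt ℂ u 0) (h0 : u 0 = 0)
    (hd : HasFDerivAt u (ContinuousLinearMap.id ℂ E) 0) :
    (fun y => u y - y) =O[𝓝 0] fun y => ‖y‖ ^ 2 := by
  obtain ⟨p, hp⟩ := hu
  have h1 := hp.isBigO_sub_partialSum_pow 2
  have h2 : ∀ y, p.partialSum 2 y = y := by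
    intro y
    rw [FormalMultilinearSeries.partialSum, Finset.sum_range_succ, Finset.sum_range_one,
      hp.coeff_zero, h0, zero_add]
    have h3 := hp.fderiv_eq
    rw [hd.fderiv] at h3
    have h4 := congrArg (fun T : E →L[ℂ] E => T y) h3
    simp only [ContinuousLinearMap.id_apply, continuousMultilinearCurryFin1_apply] at h4
    refine Eq.trans ?_ h4.symm
    congr 1
  simpa only [zero_add, h2] using h1

end Jets

/-! ### The power sums as local coordinates -/

section PowerSums

open Asymptotics

variable {n : ℕ}

/-- The Jacobian matrix of the power sums of `cosh² x_i`. -/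
def jacobian (x : Fin n → ℂ) : Matrix (Fin n) (Fin n) ℂ :=
  Matrix.of fun j i => (j + 1) * (Complex.cosh (x i) ^ 2) ^ (j : ℕ) *
    (2 * Complex.cosh (x i) * Complex.sinh (x i))

/-- Up to invertible diagonal factors this is the Vandermonde matrix of the `cosh² x_i`, which are
distinct at regular points. -/
lemma det_jacobian_ne_zero {x : Fin n → ℂ} (hx : x ∈ regularSet n) : (jacobian x).det ≠ 0 := by
  have e : jacobian x = Matrix.diagonal (fun j : Fin n => (j : ℂ) + 1) *
      (Matrix.vandermonde fun i => Complex.cosh (x i) ^ 2)ᵀ *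
      Matrix.diagonal fun i => 2 * Complex.cosh (x i) * Complex.sinh (x i) := by
    ext j i
    rw [Matrix.mul_diagonal, Matrix.diagonal_mul]
    rfl
  rw [e, Matrix.det_mul, Matrix.det_mul, Matrix.det_diagonal, Matrix.det_diagonal,
    Matrix.det_transpose]
  refine mul_ne_zero (mul_ne_zero ?_ ?_) ?_
  · exact Finset.prod_ne_zero_iff.2 fun j _ => Nat.cast_add_one_ne_zero _
  · exact Matrix.det_vandermonde_ne_zero_iff.2 (cosh_sq_injective_of_regular hx)
  · exact Finset.prod_ne_zero_iff.2 fun i _ => mul_ne_zero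
      (mul_ne_zero two_ne_zero (cosh_ne_zero_of_regular hx i)) (sinh_ne_zero_of_regular hx i)

lemma analyticAt_powerSums (x : Fin n → ℂ) (j : Fin n) :
    AnalyticAt ℂ (fun y => powerSums y j) x := by
  unfold powerSums
  refine Finset.analyticAt_fun_sum _ fun i _ => ?_
  have h1 : AnalyticAt ℂ (fun y : Fin n → ℂ => y i) x :=
    (ContinuousLinearMap.proj (R := ℂ) (φ := fun _ : Fin n => ℂ) i).analyticAt x
  exact ((Complex.analyticAt_cosh.comp h1).pow 2).pow _

lemma hasFDerivAt_powerSums (x : Fin n → ℂ) (j : Fin n) :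
    HasFDerivAt (fun y => powerSums y j)
      (∑ i, jacobian x j i • ContinuousLinearMap.proj (R := ℂ) (φ := fun _ : Fin n => ℂ) i) x := by
  unfold powerSums
  refine HasFDerivAt.fun_sum fun i _ => ?_
  have h1 : HasFDerivAt (fun y : Fin n → ℂ => y i)
      (ContinuousLinearMap.proj (R := ℂ) (φ := fun _ : Fin n => ℂ) i) x :=
    (ContinuousLinearMap.proj (R := ℂ) (φ := fun _ : Fin n => ℂ) i).hasFDerivAt
  have h2 : HasDerivAt (fun w : ℂ => (Complex.cosh w ^ 2) ^ (j + 1 : ℕ)) (jacobian x j i) (x i) := by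
    refine (((Complex.hasDerivAt_cosh (x i)).fun_pow 2).fun_pow (j + 1 : ℕ)).congr_deriv ?_
    simp [jacobian]
  exact h2.comp_hasFDerivAt x h1

/-- Local coordinates at `x` given by the power sums, tangent to the standard ones. -/
def localCoord (x y : Fin n → ℂ) : Fin n → ℂ :=
  (jacobian x)⁻¹ *ᵥ (powerSums (x + y) - powerSums x)

/-- Multiplication by the inverse Jacobian makes the differential at `x` the identity. -/
lemma isBigO_localCoord {x : Fin n → ℂ} (hx : x ∈ regularSet n) :
    (fun y => localCoord x y - y) =O[𝓝 0] fun y => ‖y‖ ^ 2 := by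
  have hadd : HasFDerivAt (fun y : Fin n → ℂ => x + y)
      (ContinuousLinearMap.id ℂ (Fin n → ℂ)) 0 := (hasFDerivAt_id 0).const_add x
  have hadd' : AnalyticAt ℂ (fun y : Fin n → ℂ => x + y) 0 := analyticAt_const.add analyticAt_id
  refine isBigO_sub_id_of_hasFDerivAt ?_ (by simp [localCoord]) ?_
  · refine AnalyticAt.pi fun i => ?_
    simp only [localCoord, Matrix.mulVec, dotProduct, Pi.sub_apply]
    refine Finset.analyticAt_fun_sum _ fun j _ => analyticAt_const.mul
      (AnalyticAt.sub ?_ analyticAt_const)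
    refine AnalyticAt.comp (g := fun y => powerSums y j) ?_ hadd'
    exact analyticAt_powerSums _ _
  · rw [hasFDerivAt_pi']
    intro i
    have h1 : ∀ j, HasFDerivAt (fun y => (jacobian x)⁻¹ i j * (powerSums (x + y) j - powerSums x j))
        ((jacobian x)⁻¹ i j •
          ∑ l, jacobian x j l • ContinuousLinearMap.proj (R := ℂ) (φ := fun _ : Fin n => ℂ) l)
        0 := by
      intro j
      have h2 : HasFDerivAt (fun y => powerSums y j) (∑ l, jacobian x j l •
          ContinuousLinearMap.proj (R := ℂ) (φ := fun _ : Fin n => ℂ) l) (x + 0) := by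
        rw [add_zero]
        exact hasFDerivAt_powerSums x j
      have h3 := ((h2.comp 0 hadd).sub_const (powerSums x j)).const_mul ((jacobian x)⁻¹ i j)
      exact h3
    have h4 := HasFDerivAt.fun_sum (u := Finset.univ) fun j _ => h1 j
    refine h4.congr_fderiv ?_
    ext y
    have h5 : (jacobian x)⁻¹ * jacobian x = 1 :=
      Matrix.nonsing_inv_mul _ (isUnit_iff_ne_zero.2 (det_jacobian_ne_zero hx))
    have h6 : ((jacobian x)⁻¹ *ᵥ (jacobian x *ᵥ y)) i = y i := by
      rw [Matrix.mulVec_mulVec, h5, Matrix.one_mulVec]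
    simpa [Matrix.mulVec, dotProduct] using h6

/-- Homogeneous forms in the local coordinates are polynomials in the power sums. -/
lemma exists_polynomial_localCoord (x : Fin n → ℂ) {k : ℕ} (c : (Fin n → ℂ) [×k]→L[ℂ] ℂ) :
    ∃ Q : MvPolynomial (Fin n) ℂ, ∀ y,
      MvPolynomial.eval (powerSums (x + y)) Q = c fun _ => localCoord x y := by
  set u : Fin n → MvPolynomial (Fin n) ℂ := fun i => ∑ j,
    MvPolynomial.C ((jacobian x)⁻¹ i j) * (MvPolynomial.X j - MvPolynomial.C (powerSums x j))
    with hu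
  refine ⟨∑ I : Fin k → Fin n, MvPolynomial.C (c fun l => Pi.single (I l) 1) * ∏ l, u (I l),
    fun y => ?_⟩
  have hev : ∀ i, MvPolynomial.eval (powerSums (x + y)) (u i) = localCoord x y i := by
    intro i
    simp [hu, localCoord, Matrix.mulVec, dotProduct]
  have hexp : localCoord x y = ∑ i, localCoord x y i • (Pi.single i 1 : Fin n → ℂ) := by
    funext l
    simp [Finset.sum_apply, Pi.single_apply]
  conv_rhs => rw [hexp]
  rw [ContinuousMultilinearMap.map_sum, map_sum]
  refine Finset.sum_congr rfl fun I _ => ?_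
  rw [ContinuousMultilinearMap.map_smul_univ, map_mul, map_prod, MvPolynomial.eval_C,
    smul_eq_mul, mul_comm]
  simp only [hev]

/-- Near a regular point analytic functions are approximated by polynomials in the power sums. -/
theorem exists_polynomial_isBigO {x : Fin n → ℂ} (hx : x ∈ regularSet n) {f : (Fin n → ℂ) → ℂ}
    (hf : AnalyticAt ℂ f x) (k : ℕ) : ∃ Q : MvPolynomial (Fin n) ℂ,
      (fun y => f (x + y) - MvPolynomial.eval (powerSums (x + y)) Q) =O[𝓝 0]
        fun y => ‖y‖ ^ k := by
  induction k with
  | zero =>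
    refine ⟨0, ?_⟩
    have hc : ContinuousAt (fun y => f (x + y)) 0 := by
      refine ContinuousAt.comp (g := f) ?_ (by fun_prop)
      simpa using hf.continuousAt
    simpa using hc.isBigO_one ℝ
  | succ k ih =>
    obtain ⟨Q, hQ⟩ := ih
    have hQa : AnalyticAt ℂ (fun y => MvPolynomial.eval (powerSums y) Q) x := by
      refine AnalyticAt.aeval_mvPolynomial (fun j => analyticAt_powerSums x j) Q
    obtain ⟨p, hp, hz⟩ := exists_powerSeries_of_isBigO (hf.sub hQa) hQ
    -- The leading form of the error, evaluated in the local coordinates, is a polynomial in the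
    -- power sums and has the same leading form; subtracting it gains one order.
    obtain ⟨Q', hQ'⟩ := exists_polynomial_localCoord x (p k)
    refine ⟨Q + Q', ?_⟩
    have h1 := hp.isBigO_sub_partialSum_pow (k + 1)
    have h2 : ∀ y, p.partialSum (k + 1) y = p k fun _ => y := by
      intro y
      refine Finset.sum_eq_single _ (fun i hi hik => ?_) fun hn =>
        absurd (Finset.mem_range.2 (Nat.lt_succ_self k)) hn
      rw [hz i (lt_of_le_of_ne (Finset.mem_range_succ_iff.1 hi) hik)]
      rfl
    have h3 := h1.add (isBigO_multilinear_sub (p k) (isBigO_localCoord hx))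
    refine h3.congr_left fun y => ?_
    rw [h2, map_add, hQ']
    simp only [Pi.sub_apply]
    ring

/-- Differential operators which agree on the products of a non-vanishing function with the
polynomials in the power sums agree. -/
theorem DiffOp.apply_eq_of_agreement {R R' : DiffOp n} {x : Fin n → ℂ} (hx : x ∈ regularSet n)
    {ψ₀ : (Fin n → ℂ) → ℂ} (hψ₀ : AnalyticAt ℂ ψ₀ x) (hne : ψ₀ x ≠ 0)
    (hR : ∀ Q : MvPolynomial (Fin n) ℂ,
      R.apply (fun y => MvPolynomial.eval (powerSums y) Q * ψ₀ y) x =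
        R'.apply (fun y => MvPolynomial.eval (powerSums y) Q * ψ₀ y) x)
    {ψ : (Fin n → ℂ) → ℂ} (hψ : AnalyticAt ℂ ψ x) : R.apply ψ x = R'.apply ψ x := by
  set K := max R.order R'.order + 1 with hK
  -- Approximating `ψ / ψ₀` to an order above both operator orders makes `ψ - Q ψ₀` invisible to
  -- either operator.
  obtain ⟨Q, hQ⟩ := exists_polynomial_isBigO hx (hψ.div hψ₀ hne) K
  have hQa : AnalyticAt ℂ (fun y => MvPolynomial.eval (powerSums y) Q * ψ₀ y) x :=
    (AnalyticAt.aeval_mvPolynomial (fun j => analyticAt_powerSums x j) Q).mul hψ₀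
  set d : (Fin n → ℂ) → ℂ := fun y => ψ y - MvPolynomial.eval (powerSums y) Q * ψ₀ y with hd
  have hda : AnalyticAt ℂ d x := hψ.sub hQa
  have hcont : Filter.Tendsto (fun y : Fin n → ℂ => x + y) (𝓝 0) (𝓝 x) := by
    have : ContinuousAt (fun y : Fin n → ℂ => x + y) 0 := by fun_prop
    simpa [ContinuousAt] using this
  have hdO : (fun y => d (x + y)) =O[𝓝 0] fun y => ‖y‖ ^ K := by
    have h1 : (fun y => ψ₀ (x + y)) =O[𝓝 0] fun _ => (1 : ℝ) :=
      (hψ₀.continuousAt.tendsto.comp hcont).isBigO_one ℝ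
    have h2 := h1.mul hQ
    simp only [one_mul] at h2
    refine h2.congr' ?_ Filter.EventuallyEq.rfl
    filter_upwards [hcont.eventually (hψ₀.continuousAt.eventually_ne hne)] with y hy
    simp only [hd, Pi.div_apply]
    field_simp
  have hzero : ∀ S : DiffOp n, S.order < K → S.apply d x = 0 := by
    intro S hS
    refine Finset.sum_eq_zero fun k hk => Finset.sum_eq_zero fun I _ => ?_
    rw [iteratedFDeriv_eq_zero_of_isBigO hda hdO
      (lt_of_le_of_lt (Finset.mem_range_succ_iff.1 hk) hS), mul_zero]
  have hdecomp : ψ = fun y => d y + MvPolynomial.eval (powerSums y) Q * ψ₀ y := by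
    funext y
    simp [hd]
  rw [hdecomp, DiffOp.apply_add R hda hQa, DiffOp.apply_add R' hda hQa,
    hzero R (Nat.lt_succ_of_le (le_max_left _ _)), hzero R' (Nat.lt_succ_of_le (le_max_right _ _)),
    hR]

end PowerSums

/-! ### Sums over roots, pairs and triples -/

section Sums

variable {n : ℕ}

/-- The positive roots, sorted by type. -/
def posRootEquiv (n : ℕ) :
    Fin n ⊕ Fin n ⊕ {q : Fin n × Fin n // q.1 < q.2} ⊕ {q : Fin n × Fin n // q.1 < q.2} ≃
      PosRoot n where
  toFun s := match s with
    | .inl i => .short i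
    | .inr (.inl i) => .long i
    | .inr (.inr (.inl q)) => .minus q.1.1 q.1.2 q.2
    | .inr (.inr (.inr q)) => .plus q.1.1 q.1.2 q.2
  invFun r := match r with
    | .short i => .inl i
    | .long i => .inr (.inl i)
    | .minus i j h => .inr (.inr (.inl ⟨(i, j), h⟩))
    | .plus i j h => .inr (.inr (.inr ⟨(i, j), h⟩))
  left_inv := by rintro (i | i | q | q) <;> rfl
  right_inv := by rintro (i | i | ⟨i, j, h⟩ | ⟨i, j, h⟩) <;> rfl

lemma sum_posRoot (F : PosRoot n → ℂ) :
    ∑ α, F α = ∑ i, F (.short i) + ∑ i, F (.long i) +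
      ∑ i, ∑ j, if hij : i < j then F (.minus i j hij) + F (.plus i j hij) else 0 := by
  rw [← Fintype.sum_prod_type'
    (f := fun i j => if hij : i < j then F (.minus i j hij) + F (.plus i j hij) else 0),
    ← (posRootEquiv n).sum_comp, Fintype.sum_sum_type, Fintype.sum_sum_type, Fintype.sum_sum_type,
    ← Finset.sum_add_distrib, ← add_assoc]
  refine congrArg₂ _ rfl (Fintype.sum_of_injective Subtype.val Subtype.val_injective _ _ ?_ ?_)
  · intro q hq
    rw [dif_neg]
    exact fun h => hq ⟨⟨q, h⟩, rfl⟩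
  · intro q
    rw [dif_pos q.2]
    rfl

lemma sum_lt_add_swap (H : Fin n → Fin n → ℂ) :
    ∑ i, ∑ j, (if i < j then H i j + H j i else 0) = ∑ i, ∑ j, if i = j then 0 else H i j := by
  have h1 : ∀ i j, (if i < j then H i j + H j i else 0) =
      (if i < j then H i j else 0) + if i < j then H j i else 0 := by
    intro i j
    split_ifs <;> simp
  simp only [h1, Finset.sum_add_distrib]
  rw [Finset.sum_comm (f := fun i j => if i < j then H j i else 0), ← Finset.sum_add_distrib]
  refine Finset.sum_congr rfl fun i _ => ?_
  rw [← Finset.sum_add_distrib]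
  refine Finset.sum_congr rfl fun j _ => ?_
  rcases lt_trichotomy i j with hij | rfl | hij
  · simp [hij, hij.not_gt, hij.ne]
  · simp
  · simp [hij, hij.not_gt, hij.ne']

lemma sum_off_diag_const (z : ℂ) :
    ∑ i : Fin n, ∑ j : Fin n, (if i = j then 0 else z) = n * ((n : ℂ) - 1) * z := by
  have h1 : ∀ i j : Fin n, (if i = j then 0 else z) = z - if i = j then z else 0 := by
    intro i j
    split_ifs <;> simp
  simp [h1, Finset.sum_sub_distrib]
  ring

/-- Exchanging `i` and `j` cancels the poles: the two terms of an unordered pair add up to `β`. -/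
lemma sum_pair {y : Fin n → ℂ} (hy : Function.Injective y) (α β : ℂ) :
    ∑ i, ∑ j, (if i = j then 0 else (α + β * y i) / (y i - y j)) =
      β * (n * ((n : ℂ) - 1)) / 2 := by
  have h1 : ∑ i, ∑ j, (if i = j then 0 else (α + β * y i) / (y i - y j)) =
      ∑ i, ∑ j, (if i = j then 0 else (α + β * y j) / (y j - y i)) := by
    rw [Finset.sum_comm]
    refine Finset.sum_congr rfl fun i _ => Finset.sum_congr rfl fun j _ => ?_
    simp only [eq_comm]
  have h2 : ∑ i, ∑ j, (if i = j then 0 else (α + β * y i) / (y i - y j)) +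
      ∑ i, ∑ j, (if i = j then 0 else (α + β * y j) / (y j - y i)) =
      ∑ i : Fin n, ∑ j : Fin n, (if i = j then 0 else β) := by
    rw [← Finset.sum_add_distrib]
    refine Finset.sum_congr rfl fun i _ => ?_
    rw [← Finset.sum_add_distrib]
    refine Finset.sum_congr rfl fun j _ => ?_
    split_ifs with hij
    · simp
    · have e1 : y i - y j ≠ 0 := sub_ne_zero.2 (hy.ne hij)
      have e2 : y j - y i ≠ 0 := sub_ne_zero.2 (hy.ne (Ne.symm hij))
      rw [div_add_div _ _ e1 e2, div_eq_iff (mul_ne_zero e1 e2)]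
      ring
  rw [← h1, sum_off_diag_const] at h2
  linear_combination h2 / 2

/-- For distinct indices the three cyclic permutations add up to `4`, by Lagrange interpolation;
hence each ordered triple counts `4/3`. -/
lemma sum_triple {y : Fin n → ℂ} (hy : Function.Injective y) :
    ∑ i, ∑ j, ∑ k, (if i = j ∨ i = k ∨ j = k then 0 else
      4 * (y i * (1 + y i)) / ((y i - y j) * (y i - y k))) =
      4 / 3 * (n * ((n : ℂ) - 1) * ((n : ℂ) - 2)) := by
  set T : Fin n → Fin n → Fin n → ℂ := fun i j k => if i = j ∨ i = k ∨ j = k then 0 else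
      4 * (y i * (1 + y i)) / ((y i - y j) * (y i - y k)) with hT
  have h1 : ∑ i, ∑ j, ∑ k, T i j k = ∑ i, ∑ j, ∑ k, T j k i := by
    rw [Finset.sum_comm_cycle]
  have h2 : ∑ i, ∑ j, ∑ k, T i j k = ∑ i, ∑ j, ∑ k, T k i j := by
    rw [h1, Finset.sum_comm_cycle]
  have h3 : ∀ i j k, T i j k + T j k i + T k i j =
      if i = j then 0 else 4 - (if i = k then 4 else 0) - if j = k then 4 else 0 := by
    intro i j k
    simp only [hT]
    by_cases hij : i = j
    · subst hij; simp
    by_cases hik : i = k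
    · subst hik; simp [Ne.symm hij, hij]
    by_cases hjk : j = k
    · subst hjk; simp [hij]
    have e1 : y i - y j ≠ 0 := sub_ne_zero.2 (hy.ne hij)
    have e2 : y i - y k ≠ 0 := sub_ne_zero.2 (hy.ne hik)
    have e3 : y j - y k ≠ 0 := sub_ne_zero.2 (hy.ne hjk)
    simp only [hij, hik, hjk, Ne.symm hij, Ne.symm hik, Ne.symm hjk, or_self, if_false, sub_zero]
    rw [← neg_sub (y i) (y j), ← neg_sub (y i) (y k), ← neg_sub (y j) (y k)]
    field_simp
    ring
  have h4 : ∑ i, ∑ j, ∑ k, T i j k + ∑ i, ∑ j, ∑ k, T j k i + ∑ i, ∑ j, ∑ k, T k i j =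
      ∑ i : Fin n, ∑ j : Fin n, if i = j then 0 else 4 * ((n : ℂ) - 2) := by
    simp only [← Finset.sum_add_distrib, h3]
    refine Finset.sum_congr rfl fun i _ => Finset.sum_congr rfl fun j _ => ?_
    split_ifs with hij
    · simp
    · simp [Finset.sum_sub_distrib]
      ring
  rw [← h1, ← h2, sum_off_diag_const] at h4
  linear_combination h4 / 3

end Sums

/-! ### The logarithmic derivative of the denominator -/

section Potential

variable {m n : ℕ}

/-- The diagonal derivative of `radCoeff`. -/
def radCoeffDeriv (m n : ℕ) (i : Fin n) (x : Fin n → ℂ) : ℂ :=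
  -1 / (2 * Complex.cosh (x i) ^ 2 * Complex.sinh (x i) ^ 2) -
    ((m : ℂ) - n) / Complex.sinh (x i) ^ 2 +
    ∑ j, if i = j then 0 else
      2 * (Complex.cosh (x i) ^ 2 + Complex.sinh (x i) ^ 2) /
        (Complex.sinh (x i) ^ 2 - Complex.sinh (x j) ^ 2) -
      4 * (Complex.cosh (x i) ^ 2 * Complex.sinh (x i) ^ 2) /
        (Complex.sinh (x i) ^ 2 - Complex.sinh (x j) ^ 2) ^ 2

/-- Only the `i`-th coordinate varies, so the derivative is taken in one variable along
`Function.update x i`. -/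
lemma fderiv_radCoeff {x : Fin n → ℂ} (hx : x ∈ regularSet n) (i : Fin n) :
    fderiv ℂ (radCoeff m n i) x (Pi.single i 1) = radCoeffDeriv m n i x := by
  have hs := sinh_ne_zero_of_regular hx i
  have hc := cosh_ne_zero_of_regular hx i
  have hcs := Complex.cosh_sq (x i)
  have hd : HasDerivAt (fun t => radCoeff m n i (Function.update x i t))
      (fderiv ℂ (radCoeff m n i) x (Pi.single i 1)) (x i) := by
    have h1 : HasFDerivAt (radCoeff m n i) (fderiv ℂ (radCoeff m n i) x)
        (Function.update x i (x i)) := by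
      rw [Function.update_eq_self]
      exact (differentiableAt_radCoeff m n i hx).hasFDerivAt
    exact h1.comp_hasDerivAt (x i) (hasDerivAt_update x i (x i))
  refine hd.unique ?_
  unfold radCoeff radCoeffDeriv
  simp only [Function.update_self]
  have d1 := Complex.hasDerivAt_cosh (x i)
  have d2 := Complex.hasDerivAt_sinh (x i)
  refine HasDerivAt.fun_add (HasDerivAt.congr_deriv (HasDerivAt.fun_add
    (((d1.fun_pow 2).fun_add (d2.fun_pow 2)).fun_div ((d1.const_mul 2).fun_mul d2)
      (mul_ne_zero (mul_ne_zero two_ne_zero hc) hs))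
    ((d1.fun_div d2 hs).const_mul ((m : ℂ) - n))) ?_) (HasDerivAt.fun_sum fun j _ => ?_)
  · set c := Complex.cosh (x i)
    set s := Complex.sinh (x i)
    have p1 : s * s - c * c = -1 := by linear_combination -hcs
    have p2 : (((2 : ℕ) : ℂ) * c ^ (2 - 1) * s + ((2 : ℕ) : ℂ) * s ^ (2 - 1) * c) * (2 * c * s) -
        (c ^ 2 + s ^ 2) * (2 * s * s + 2 * c * c) = -2 := by
      push_cast
      linear_combination (-2 * (c ^ 2 - s ^ 2 + 1)) * hcs
    rw [p1, p2]
    field_simp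
    ring
  · by_cases hij : i = j
    · simpa only [if_pos hij] using hasDerivAt_const _ _
    · simp only [if_neg hij, Function.update_of_ne (Ne.symm hij)]
      have hD := sinh_sq_sub_ne_zero_of_regular hx hij
      refine (((d1.fun_mul d2).const_mul 2).fun_div
        ((d2.fun_pow 2).sub_const (Complex.sinh (x j) ^ 2)) hD).congr_deriv ?_
      field_simp
      ring

/-- In `∑ i, (radCoeff i ^ 2 + ∂ᵢ radCoeff i)` the mixed terms cancel up to constants. -/
lemma sum_radCoeff_sq {x : Fin n → ℂ} (hx : x ∈ regularSet n) :
    ∑ i, (radCoeff m n i x ^ 2 + radCoeffDeriv m n i x) =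
      ∑ i, (((Complex.cosh (x i) ^ 2 + Complex.sinh (x i) ^ 2) /
          (2 * Complex.cosh (x i) * Complex.sinh (x i)) +
        ((m : ℂ) - n) * (Complex.cosh (x i) / Complex.sinh (x i))) ^ 2 -
        1 / (2 * Complex.cosh (x i) ^ 2 * Complex.sinh (x i) ^ 2) -
        ((m : ℂ) - n) / Complex.sinh (x i) ^ 2) +
      (4 + 2 * ((m : ℂ) - n)) * (n * ((n : ℂ) - 1)) +
      4 / 3 * (n * ((n : ℂ) - 1) * ((n : ℂ) - 2)) := by
  set y : Fin n → ℂ := fun i => Complex.sinh (x i) ^ 2 with hy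
  have hinj : Function.Injective y := by
    intro i j hij
    by_contra hne
    exact sinh_sq_sub_ne_zero_of_regular hx hne (sub_eq_zero.2 hij)
  -- The numerator collects all simple poles: the cross terms of the square and the simple pole part
  -- of the derivative, expressed in `y = sinh²`.
  have e1 := sum_pair hinj (4 + 4 * ((m : ℂ) - n)) (8 + 4 * ((m : ℂ) - n))
  have e2 := sum_triple hinj
  have e3 : (4 + 2 * ((m : ℂ) - n)) * (n * ((n : ℂ) - 1)) =
      (8 + 4 * ((m : ℂ) - n)) * (n * ((n : ℂ) - 1)) / 2 := by ring
  rw [e3, ← e1, ← e2, ← Finset.sum_add_distrib, ← Finset.sum_add_distrib]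
  refine Finset.sum_congr rfl fun i _ => ?_
  have hs := sinh_ne_zero_of_regular hx i
  have hc := cosh_ne_zero_of_regular hx i
  have hcs := Complex.cosh_sq (x i)
  set A : ℂ := (Complex.cosh (x i) ^ 2 + Complex.sinh (x i) ^ 2) /
      (2 * Complex.cosh (x i) * Complex.sinh (x i)) +
    ((m : ℂ) - n) * (Complex.cosh (x i) / Complex.sinh (x i)) with hA
  set B : Fin n → ℂ := fun j => if i = j then 0 else
    2 * (Complex.cosh (x i) * Complex.sinh (x i)) / (y i - y j) with hB
  have hrad : radCoeff m n i x = A + ∑ j, B j := rfl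
  have hAcs : A * (2 * (Complex.cosh (x i) * Complex.sinh (x i))) =
      (1 + 2 * y i) + 2 * ((m : ℂ) - n) * (1 + y i) := by
    rw [hA]
    field_simp
    simp only [hy, hcs]
    ring
  -- The part with distinct indices is handled by `sum_triple`; the double poles at `j = k` cancel
  -- those of `radCoeffDeriv`.
  have hBB : (∑ j, B j) ^ 2 = (∑ j, ∑ k, (if i = j ∨ i = k ∨ j = k then 0 else
      4 * (y i * (1 + y i)) / ((y i - y j) * (y i - y k)))) +
      ∑ j, if i = j then 0 else 4 * (Complex.cosh (x i) ^ 2 * Complex.sinh (x i) ^ 2) /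
        (y i - y j) ^ 2 := by
    rw [sq, Finset.sum_mul_sum, ← Finset.sum_add_distrib]
    refine Finset.sum_congr rfl fun j _ => ?_
    have h5 : (if i = j then 0 else 4 * (Complex.cosh (x i) ^ 2 * Complex.sinh (x i) ^ 2) /
        (y i - y j) ^ 2) = ∑ k, if j = k then (if i = j then 0 else
          4 * (Complex.cosh (x i) ^ 2 * Complex.sinh (x i) ^ 2) / (y i - y j) ^ 2) else 0 := by
      simp
    rw [h5, ← Finset.sum_add_distrib]
    refine Finset.sum_congr rfl fun k _ => ?_
    simp only [hB]
    by_cases hij : i = j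
    · simp [hij]
    by_cases hik : i = k
    · subst hik
      simp [Ne.symm hij]
    have f1 : y i - y j ≠ 0 := sub_ne_zero.2 (hinj.ne hij)
    have f2 : y i - y k ≠ 0 := sub_ne_zero.2 (hinj.ne hik)
    by_cases hjk : j = k
    · subst hjk
      simp only [hij, or_true, if_true, if_false]
      field_simp
      ring
    · simp only [hij, hik, hjk, or_self, if_false, add_zero]
      field_simp
      simp only [hy]
      linear_combination (4 * Complex.sinh (x i) ^ 2) * hcs
  have hAB : 2 * A * ∑ j, B j = ∑ j, if i = j then 0 else
      2 * ((1 + 2 * y i) + 2 * ((m : ℂ) - n) * (1 + y i)) / (y i - y j) := by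
    rw [Finset.mul_sum]
    refine Finset.sum_congr rfl fun j _ => ?_
    simp only [hB]
    split_ifs
    · simp
    · rw [← hAcs]
      ring
  have hD : radCoeffDeriv m n i x = - 1 / (2 * Complex.cosh (x i) ^ 2 * Complex.sinh (x i) ^ 2) -
      ((m : ℂ) - n) / Complex.sinh (x i) ^ 2 +
      ((∑ j, if i = j then 0 else 2 * (1 + 2 * y i) / (y i - y j)) -
        ∑ j, if i = j then 0 else 4 * (Complex.cosh (x i) ^ 2 * Complex.sinh (x i) ^ 2) /
        (y i - y j) ^ 2) := by
    rw [← Finset.sum_sub_distrib, radCoeffDeriv]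
    congr 1
    refine Finset.sum_congr rfl fun j _ => ?_
    split_ifs
    · simp
    · simp only [hy, hcs]
      ring
  have hP : (∑ j, if i = j then 0 else (4 + 4 * ((m : ℂ) - n) + (8 + 4 * ((m : ℂ) - n)) * y i) /
      (y i - y j)) = (∑ j, if i = j then 0 else
      2 * ((1 + 2 * y i) + 2 * ((m : ℂ) - n) * (1 + y i)) / (y i - y j)) +
      ∑ j, if i = j then 0 else 2 * (1 + 2 * y i) / (y i - y j) := by
    rw [← Finset.sum_add_distrib]
    refine Finset.sum_congr rfl fun j _ => ?_
    split_ifs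
    · simp
    · ring
  rw [hrad, hD, hP, ← hAB]
  linear_combination hBB

end Potential

/-! ### The Calogero–Moser potential -/

section CalogeroMoser

variable {m n : ℕ}

/-- The root terms written in `sinh² x_i` and `cosh² x_i`. With `r₃ = c - b + 1/2` one has `r₃ (r₃ -
1) = (c - b)² - 1/4`, and the norm `4` of a long root cancels the square in `sinh 2x = 2 sinh x cosh
x`. -/
lemma potential_eq {x : Fin n → ℂ} (hx : x ∈ regularSet n) (a b c : ℤ) (v : ℕ) :
    potential (kappaVec a b c v + sVec m n) x =
      ∑ i, (((b : ℂ) - a + ((m : ℂ) - n)) * (2 * c - a - b + ((m : ℂ) - n)) /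
          Complex.sinh (x i) ^ 2 +
        (((c : ℂ) - b) ^ 2 - 1 / 4) / (Complex.cosh (x i) ^ 2 * Complex.sinh (x i) ^ 2)) +
      ∑ i, ∑ j, if i = j then 0 else
        4 * (v * (v + 1)) * (Complex.sinh (x i) ^ 2 * Complex.cosh (x j) ^ 2) /
          (Complex.sinh (x i) ^ 2 - Complex.sinh (x j) ^ 2) ^ 2 := by
  have hr0 : (kappaVec a b c v + sVec m n) 0 = (b : ℂ) - a + ((m : ℂ) - n) := rfl
  have hr1 : (kappaVec a b c v + sVec m n) 1 = (v : ℂ) + 1 := rfl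
  have hr2 : (kappaVec a b c v + sVec m n) 2 = (c : ℂ) - b + 1 / 2 := rfl
  rw [potential, sum_posRoot, ← sum_lt_add_swap, ← Finset.sum_add_distrib]
  congr 1
  · refine Finset.sum_congr rfl fun i _ => ?_
    have hs := sinh_ne_zero_of_regular hx i
    have hc := cosh_ne_zero_of_regular hx i
    have n1 : (PosRoot.short i).normSq = 1 := by simp [PosRoot.normSq, PosRoot.vec]
    have n2 : (PosRoot.long i).normSq = 4 := by
      simp [PosRoot.normSq, PosRoot.vec]
      norm_num
    rw [n1, n2, eval_short, eval_long, Complex.sinh_two_mul]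
    simp only [mult, multDouble, hr0, hr2]
    field_simp
    ring
  · refine Finset.sum_congr rfl fun i _ => Finset.sum_congr rfl fun j _ => ?_
    by_cases hij : i < j
    · rw [dif_pos hij, if_pos hij]
      have n1 : (PosRoot.minus i j hij).normSq = 2 := by
        simp [PosRoot.normSq, PosRoot.vec, hij.ne, hij.ne']
        norm_num
      have n2 : (PosRoot.plus i j hij).normSq = 2 := by
        simp [PosRoot.normSq, PosRoot.vec, hij.ne, hij.ne']
        norm_num
      have hP := hx (.minus i j hij)
      have hQ := hx (.plus i j hij)
      rw [eval_minus] at hP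
      rw [eval_plus] at hQ
      rw [n1, n2, eval_minus, eval_plus, ← neg_sub (Complex.sinh (x i) ^ 2), neg_sq,
        sinh_sq_sub_sinh_sq]
      -- The roots `ε_i - ε_j` and `ε_i + ε_j` taken together give a sum symmetric in the two
      -- ordered pairs.
      have key : Complex.sinh (x i - x j) ^ 2 + Complex.sinh (x i + x j) ^ 2 =
          2 * (Complex.sinh (x i) ^ 2 * Complex.cosh (x j) ^ 2 +
            Complex.sinh (x j) ^ 2 * Complex.cosh (x i) ^ 2) := by
        rw [Complex.sinh_sub, Complex.sinh_add]
        ring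
      simp only [mult, multDouble, hr1]
      field_simp
      linear_combination (2 * (v : ℂ)) * key
    · rw [dif_neg hij, if_neg hij]

/-- The zeroth order term after conjugation by the denominator. -/
theorem sum_radCoeff_sq_sub_potential {x : Fin n → ℂ} (hx : x ∈ regularSet n) (a b c : ℤ)
    (v : ℕ) :
    ∑ i, (radCoeff m n i x ^ 2 + radCoeffDeriv m n i x) -
        potential (kappaVec a b c v + sVec m n) x + constC m n a b =
      2 * radPotential m n a b c (c - a) v x := by
  rw [sum_radCoeff_sq hx, potential_eq hx, radPotential]
  have hpair : ∀ i j : Fin n, (if i = j then 0 else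
      4 * (v * ((v : ℂ) + 1)) * (Complex.sinh (x i) ^ 2 * Complex.cosh (x j) ^ 2) /
          (Complex.sinh (x i) ^ 2 - Complex.sinh (x j) ^ 2) ^ 2) =
      2 * if i = j then 0 else
      2 * (v * (v + 1)) * Complex.sinh (x i) ^ 2 * Complex.cosh (x j) ^ 2 /
        (Complex.sinh (x i) ^ 2 - Complex.sinh (x j) ^ 2) ^ 2 := by
    intro i j
    split_ifs <;> ring
  simp only [hpair, ← Finset.mul_sum]
  -- The pair terms match already. For each `i` the rest is a rational function of `sinh² x_i` whose
  -- poles cancel, leaving a constant that enters `constC`.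
  have hsingle : ∑ i, (((Complex.cosh (x i) ^ 2 + Complex.sinh (x i) ^ 2) /
          (2 * Complex.cosh (x i) * Complex.sinh (x i)) +
        ((m : ℂ) - n) * (Complex.cosh (x i) / Complex.sinh (x i))) ^ 2 -
        1 / (2 * Complex.cosh (x i) ^ 2 * Complex.sinh (x i) ^ 2) -
        ((m : ℂ) - n) / Complex.sinh (x i) ^ 2) -
      ∑ i, (((b : ℂ) - a + ((m : ℂ) - n)) * (2 * c - a - b + ((m : ℂ) - n)) /
          Complex.sinh (x i) ^ 2 +
        (((c : ℂ) - b) ^ 2 - 1 / 4) / (Complex.cosh (x i) ^ 2 * Complex.sinh (x i) ^ 2)) +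
      2 * ∑ i, (((c : ℂ) - a * Complex.cosh (x i) ^ 2 + b * Complex.sinh (x i) ^ 2) ^ 2 /
        (2 * Complex.cosh (x i) ^ 2 * Complex.sinh (x i) ^ 2) +
      ((m : ℂ) - n) * ((c - a) / Complex.sinh (x i) ^ 2)) =
      n * ((1 + ((m : ℂ) - n)) ^ 2 + ((b : ℂ) - a) ^ 2) := by
    rw [Finset.mul_sum, ← Finset.sum_sub_distrib, ← Finset.sum_add_distrib]
    have hconst : (n : ℂ) * ((1 + ((m : ℂ) - n)) ^ 2 + ((b : ℂ) - a) ^ 2) =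
        ∑ _i : Fin n, ((1 + ((m : ℂ) - n)) ^ 2 + ((b : ℂ) - a) ^ 2) := by
      simp [mul_add]
    rw [hconst]
    refine Finset.sum_congr rfl fun i _ => ?_
    have hs := sinh_ne_zero_of_regular hx i
    have hc := cosh_ne_zero_of_regular hx i
    have hcs := Complex.cosh_sq (x i)
    have e1 : ((Complex.cosh (x i) ^ 2 + Complex.sinh (x i) ^ 2) /
        (2 * Complex.cosh (x i) * Complex.sinh (x i)) +
      ((m : ℂ) - n) * (Complex.cosh (x i) / Complex.sinh (x i))) ^ 2 =
      (1 + 2 * Complex.sinh (x i) ^ 2 + 2 * ((m : ℂ) - n) * (1 + Complex.sinh (x i) ^ 2)) ^ 2 /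
        (4 * (1 + Complex.sinh (x i) ^ 2) * Complex.sinh (x i) ^ 2) := by
      rw [← add_comm (Complex.sinh (x i) ^ 2) 1, ← hcs]
      field_simp
      rw [hcs]
      ring
    have hy : 1 + Complex.sinh (x i) ^ 2 ≠ 0 := by
      rw [add_comm, ← hcs]
      exact pow_ne_zero _ hc
    refine Eq.trans ?_ (?_ : (1 + 2 * Complex.sinh (x i) ^ 2 +
        2 * ((m : ℂ) - n) * (1 + Complex.sinh (x i) ^ 2)) ^ 2 /
        (4 * (1 + Complex.sinh (x i) ^ 2) * Complex.sinh (x i) ^ 2) -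
        1 / (2 * (1 + Complex.sinh (x i) ^ 2) * Complex.sinh (x i) ^ 2) -
        ((m : ℂ) - n) / Complex.sinh (x i) ^ 2 -
        (((b : ℂ) - a + ((m : ℂ) - n)) * (2 * c - a - b + ((m : ℂ) - n)) /
        Complex.sinh (x i) ^ 2 +
      (((c : ℂ) - b) ^ 2 - 1 / 4) / ((1 + Complex.sinh (x i) ^ 2) * Complex.sinh (x i) ^ 2)) +
      2 * (((c : ℂ) - a * (1 + Complex.sinh (x i) ^ 2) + b * Complex.sinh (x i) ^ 2) ^ 2 /
      (2 * (1 + Complex.sinh (x i) ^ 2) * Complex.sinh (x i) ^ 2) +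
    ((m : ℂ) - n) * ((c - a) / Complex.sinh (x i) ^ 2)) = _)
    · rw [← e1, ← add_comm (Complex.sinh (x i) ^ 2) 1, ← hcs]
    · field_simp
      ring
  rw [constC]
  linear_combination hsingle

end CalogeroMoser

/-! ### Conjugation of the Laplacian by the denominator -/

section Conjugation

variable {m n : ℕ}

lemma isOpen_regular_eventually {x : Fin n → ℂ} (hx : x ∈ regularSet n) :
    ∀ᶠ y in 𝓝 x, y ∈ regularSet n := (isOpen_regularSet n).mem_nhds hx

lemma hasFDerivAt_eval (α : PosRoot n) (y : Fin n → ℂ) :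
    HasFDerivAt α.eval (∑ j, α.vec j •
      ContinuousLinearMap.proj (R := ℂ) (φ := fun _ : Fin n => ℂ) j) y := by
  have : α.eval = (∑ j, α.vec j •
      ContinuousLinearMap.proj (R := ℂ) (φ := fun _ : Fin n => ℂ) j) := by
    funext z
    simp [PosRoot.eval, dotProduct]
  rw [this]
  exact ContinuousLinearMap.hasFDerivAt _

/-- The half multiplicities `s` are what makes the two sides agree: `coth (x_i - x_j) + coth (x_i +
x_j)` is the pair term, and `½ · 2 coth 2x_i` is the first term of `radCoeff`. -/
lemma sum_mult_coth {x : Fin n → ℂ} (hx : x ∈ regularSet n) (i : Fin n) :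
    ∑ α : PosRoot n, mult (sVec m n) α * (α.vec i *
      (Complex.cosh (α.eval x) / Complex.sinh (α.eval x))) = radCoeff m n i x := by
  have hs0 : sVec m n 0 = (m : ℂ) - n := rfl
  have hs1 : sVec m n 1 = 1 := rfl
  have hs2 : sVec m n 2 = 1 / 2 := rfl
  rw [sum_posRoot, radCoeff, add_comm ((_ : ℂ) / _)]
  congr 1
  · congr 1
    · rw [Finset.sum_eq_single i]
      · simp [mult, hs0, PosRoot.vec, eval_short]
      · intro j _ hj
        simp [PosRoot.vec, hj.symm]
      · simp
    · rw [Finset.sum_eq_single i]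
      · simp [mult, hs2, PosRoot.vec, eval_long, Complex.sinh_two_mul, Complex.cosh_two_mul]
        ring
      · intro j _ hj
        simp [PosRoot.vec, hj.symm]
      · simp
  · set K : Fin n → Fin n → ℂ := fun p q =>
      Complex.cosh (x p - x q) / Complex.sinh (x p - x q) +
        Complex.cosh (x p + x q) / Complex.sinh (x p + x q) with hK
    have hterm : ∀ p q : Fin n, (if hpq : p < q then
        mult (sVec m n) (.minus p q hpq) * ((PosRoot.minus p q hpq).vec i *
          (Complex.cosh ((PosRoot.minus p q hpq).eval x) /
            Complex.sinh ((PosRoot.minus p q hpq).eval x))) +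
        mult (sVec m n) (.plus p q hpq) * ((PosRoot.plus p q hpq).vec i *
          (Complex.cosh ((PosRoot.plus p q hpq).eval x) /
            Complex.sinh ((PosRoot.plus p q hpq).eval x))) else 0) =
        if p < q then (if i = p then K p q else 0) + (if i = q then K q p else 0) else 0 := by
      intro p q
      by_cases hpq : p < q
      · rw [dif_pos hpq, if_pos hpq, eval_minus, eval_plus]
        -- `coth` is odd, which absorbs the sign of the second coordinate of `ε_p - ε_q`.
        have e1 : Complex.cosh (x q - x p) / Complex.sinh (x q - x p) =
            -(Complex.cosh (x p - x q) / Complex.sinh (x p - x q)) := by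
          rw [← neg_sub, Complex.cosh_neg, Complex.sinh_neg, div_neg]
        simp only [hK, e1, add_comm (x q) (x p), mult, hs1, PosRoot.vec, Pi.sub_apply,
          Pi.add_apply, Pi.single_apply]
        split_ifs <;> ring
      · rw [dif_neg hpq, if_neg hpq]
    simp only [hterm]
    rw [sum_lt_add_swap (fun p q => if i = p then K p q else 0), Finset.sum_eq_single i]
    · refine Finset.sum_congr rfl fun j _ => ?_
      by_cases hij : i = j
      · rw [if_pos hij, if_pos hij]
      · rw [if_neg hij, if_neg hij, if_pos rfl, hK, sinh_sq_sub_sinh_sq]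
        have hPQ := sinh_sq_sub_ne_zero_of_regular hx hij
        rw [sinh_sq_sub_sinh_sq] at hPQ
        have hP := left_ne_zero_of_mul hPQ
        have hQ := right_ne_zero_of_mul hPQ
        have e2 : 2 * (Complex.cosh (x i) * Complex.sinh (x i)) =
            Complex.cosh (x i - x j) * Complex.sinh (x i + x j) +
              Complex.cosh (x i + x j) * Complex.sinh (x i - x j) := by
          rw [Complex.cosh_sub, Complex.sinh_add, Complex.cosh_add, Complex.sinh_sub]
          linear_combination (-2 * Complex.cosh (x i) * Complex.sinh (x i)) *
            Complex.cosh_sq (x j)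
        rw [e2]
        field_simp
    · intro p _ hp
      exact Finset.sum_eq_zero fun q _ => by simp [Ne.symm hp]
    · simp

lemma IsDenominatorBranch.analyticAt {p : Fin 3 → ℂ} {δ : (Fin n → ℂ) → ℂ} {x : Fin n → ℂ}
    (hδ : IsDenominatorBranch p δ x) : AnalyticAt ℂ δ x := by
  obtain ⟨L, hL, hδL⟩ := hδ
  refine AnalyticAt.congr ?_ (hδL.mono fun y hy => hy.symm)
  exact AnalyticAt.cexp (Finset.analyticAt_fun_sum _ fun α _ => analyticAt_const.mul (hL α).1)

lemma IsDenominatorBranch.ne_zero {p : Fin 3 → ℂ} {δ : (Fin n → ℂ) → ℂ} {x : Fin n → ℂ}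
    (hδ : IsDenominatorBranch p δ x) : δ x ≠ 0 := by
  obtain ⟨L, -, hδL⟩ := hδ
  rw [hδL.self_of_nhds]
  exact Complex.exp_ne_zero _

/-- The logarithmic derivatives of the denominator are the first order coefficients of the radial
part. -/
lemma IsDenominatorBranch.fderiv_eq {δ : (Fin n → ℂ) → ℂ} {x : Fin n → ℂ}
    (hx : x ∈ regularSet n) (hδ : IsDenominatorBranch (sVec m n) δ x) :
    ∀ᶠ y in 𝓝 x, ∀ i, fderiv ℂ δ y (Pi.single i 1) = δ y * radCoeff m n i y := by
  obtain ⟨L, hL, hδL⟩ := hδ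
  have h1 : ∀ᶠ y in 𝓝 x, ∀ α, AnalyticAt ℂ (L α) y :=
    Filter.eventually_all.2 fun α => (hL α).1.eventually_analyticAt
  have h2 : ∀ᶠ y in 𝓝 x, ∀ α, ∀ᶠ z in 𝓝 y, Complex.exp (L α z) = Complex.sinh (α.eval z) :=
    Filter.eventually_all.2 fun α => (hL α).2.eventually_nhds
  filter_upwards [h1, h2, hδL.eventually_nhds, isOpen_regular_eventually hx] with y h1 h2 h3 hy i
  -- Differentiating `exp (L α) = sinh α` gives the logarithmic derivative without choosing a
  -- branch.
  have hlog : ∀ α, fderiv ℂ (L α) y (Pi.single i 1) =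
      α.vec i * (Complex.cosh (α.eval y) / Complex.sinh (α.eval y)) := by
    intro α
    have d1 := (h1 α).differentiableAt.hasFDerivAt.cexp
    have d2 := (hasFDerivAt_eval α y).csinh.congr_of_eventuallyEq (h2 α)
    have d3 := congrArg (fun T : (Fin n → ℂ) →L[ℂ] ℂ => T (Pi.single i 1)) (d1.unique d2)
    simp only [_root_.smul_apply, smul_eq_mul, (h2 α).self_of_nhds] at d3
    have d4 : (∑ j, α.vec j • ContinuousLinearMap.proj (R := ℂ) (φ := fun _ : Fin n => ℂ) j)
        (Pi.single i 1) = α.vec i := by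
      simp [Pi.single_apply]
    rw [d4] at d3
    have := hy α
    field_simp
    linear_combination d3
  have hsum : HasFDerivAt (fun y => ∑ α, mult (sVec m n) α * L α y)
      (∑ α, mult (sVec m n) α • fderiv ℂ (L α) y) y :=
    HasFDerivAt.fun_sum fun α _ => (h1 α).differentiableAt.hasFDerivAt.const_mul _
  have hd := hsum.cexp.congr_of_eventuallyEq h3
  rw [hd.fderiv, h3.self_of_nhds, _root_.smul_apply, smul_eq_mul, ← sum_mult_coth hy]
  simp [hlog]

/-- Conjugation of the Laplacian by the denominator. -/
lemma laplacianA_mul {δ ψ : (Fin n → ℂ) → ℂ} {x : Fin n → ℂ} (hx : x ∈ regularSet n)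
    (hδ : IsDenominatorBranch (sVec m n) δ x) (hψ : AnalyticAt ℂ ψ x) :
    laplacianA (fun y => δ y * ψ y) x = δ x * ∑ i,
      (iteratedFDeriv ℂ 2 ψ x (fun _ => Pi.single i 1) +
        2 * radCoeff m n i x * fderiv ℂ ψ x (Pi.single i 1) +
        (radCoeff m n i x ^ 2 + radCoeffDeriv m n i x) * ψ x) := by
  rw [laplacianA, Finset.mul_sum]
  refine Finset.sum_congr rfl fun i _ => ?_
  rw [iteratedFDeriv_two_eq (ψ := fun y => δ y * ψ y) (hδ.analyticAt.mul hψ), iteratedFDeriv_two_eq hψ]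
  have h1 : (fun y => fderiv ℂ (fun y => δ y * ψ y) y (Pi.single i 1)) =ᶠ[𝓝 x] fun y =>
      δ y * (radCoeff m n i y * ψ y + fderiv ℂ ψ y (Pi.single i 1)) := by
    filter_upwards [hδ.fderiv_eq hx, hδ.analyticAt.eventually_analyticAt,
      hψ.eventually_analyticAt] with y h1 h2 h3
    rw [fderiv_fun_mul h2.differentiableAt h3.differentiableAt]
    simp only [_root_.add_apply, _root_.smul_apply, smul_eq_mul, h1 i]
    ring
  have dθ := differentiableAt_radCoeff m n i hx
  have dψ := hψ.differentiableAt
  have dδ := hδ.analyticAt.differentiableAt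
  have d2 : DifferentiableAt ℂ (fun y => fderiv ℂ ψ y (Pi.single i 1)) x :=
    hψ.fderiv.differentiableAt.clm_apply (differentiableAt_const _)
  rw [h1.fderiv_eq, fderiv_fun_mul dδ ((dθ.fun_mul dψ).fun_add d2),
    fderiv_fun_add (dθ.fun_mul dψ) d2, fderiv_fun_mul dθ dψ]
  simp only [_root_.add_apply, _root_.smul_apply, smul_eq_mul,
    (hδ.fderiv_eq hx).self_of_nhds i, fderiv_radCoeff hx]
  ring

theorem two_mul_radialOp_apply {δ ψ : (Fin n → ℂ) → ℂ} {x : Fin n → ℂ}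
    (hx : x ∈ regularSet n) (hδ : IsDenominatorBranch (sVec m n) δ x) (hψ : AnalyticAt ℂ ψ x)
    (a b c : ℤ) (v : ℕ) :
    2 * (radialOp m n a b c (c - a) v).apply ψ x = (δ x)⁻¹ *
      (laplacianA (fun y => δ y * ψ y) x
        - potential (kappaVec a b c v + sVec m n) x * (δ x * ψ x)
        + constC m n a b * (δ x * ψ x)) := by
  have hne := hδ.ne_zero
  have hpot := sum_radCoeff_sq_sub_potential (m := m) hx a b c v
  rw [laplacianA_mul hx hδ hψ, radialOp_apply, eq_inv_mul_iff_mul_eq₀ hne]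
  simp only [Finset.sum_add_distrib, ← Finset.sum_mul, ← Finset.mul_sum, mul_assoc (2 : ℂ)] at hpot ⊢
  linear_combination (-δ x * ψ x) * hpot

end Conjugation

end CM

theorem mainTheorem2 {m n : ℕ} (h : n ≤ m) (a b c : ℤ) (v : ℕ)
    (hκ₁ : (b - a) + (c - b) ≤ c - b) (hκ₂ : 0 ≤ (b - a) + (c - b))
    {W V : Type*} [AddCommGroup W] [Module ℂ W] [AddCommGroup V] [Module ℂ V]
    (ρW : Representation ℂ (GL (Fin m) ℂ) W) (ρV : Representation ℂ (GL (Fin n) ℂ) V)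
    (hW : CM.IsIrrepOfHighestWeight ρW (CM.weightW m n a c))
    (hV : CM.IsIrrepOfHighestWeight ρV (CM.weightV n a b c v)) :
    (∃ R : CM.DiffOp n, R.order = 2 ∧ CM.IsRadialPartOfCasimir h ρW ρV a b R) ∧
    ∀ R : CM.DiffOp n, CM.IsRadialPartOfCasimir h ρW ρV a b R →
      ∀ x ∈ CM.regularSet n, ∀ ψ δ : (Fin n → ℂ) → ℂ, AnalyticAt ℂ ψ x →
        CM.IsDenominatorBranch (CM.sVec m n) δ x →
        2 * R.apply ψ x = (δ x)⁻¹ *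
          (CM.laplacianA (fun y => δ y * ψ y) x
            - CM.potential (CM.kappaVec a b c v + CM.sVec m n) x * (δ x * ψ x)
            + CM.constC m n a b * (δ x * ψ x)) := by
  -- `N = κ₁ + κ₃` is the power of the minor and `k = κ₃` the power of the determinant of the upper
  -- left block.
  obtain ⟨N, hN⟩ := Int.eq_ofNat_of_zero_le (show 0 ≤ c - a by omega)
  obtain ⟨k, hk⟩ := Int.eq_ofNat_of_zero_le (show 0 ≤ c - b by omega)
  obtain ⟨lW, lV, hM⟩ := CM.exists_isModel (e := b + a - c - v) h hN rfl hW hV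
  have hrad := CM.isRadialPartOfCasimir_radialOp (b := b) hM (by omega)
  have hNC : (N : ℂ) = (c : ℂ) - a := by
    rw [← Int.cast_natCast, ← hN, Int.cast_sub]
  rw [hNC, add_sub_cancel] at hrad
  refine ⟨⟨_, ?_, hrad⟩, fun R hR x hx ψ δ hψ hδ => ?_⟩
  · rfl
  -- The choice `z = b + a - c` solves `k + z = a`, `z + N = b` and `e = z - v` simultaneously.
  obtain ⟨ψ₀, hψ₀, hne, hagree⟩ := hM.exists_agreement (z := b + a - c) (k := k) (b := b)
    (by omega) (by omega) rfl
  rw [CM.DiffOp.apply_eq_of_agreement hx (hψ₀ x) (hne x hx)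
    (fun Q => hagree R _ hR hrad Q x hx) hψ, CM.two_mul_radialOp_apply hx hδ hψ]
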